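/- \textbf{Setting.} Let $G$ be a finite group, $\mathsf{S}_*$ the category of pointed simplicial sets, $\Sigma_n$ the symmetric group on $n$ letters, $S^1=\Delta[1]/\partial\Delta[1]$. A symmetric spectrum $X$ consists of pointed simplicial sets $X_n$ ($n\ge 0$) with left $\Sigma_n$-actions and maps $S^1\wedge X_n\to X_{n+1}$ whose iterates $S^p\wedge X_n\to X_{n+p}$ are $\Sigma_p\times\Sigma_n$-equivariant; write $\mathsf{Sp}^\Sigma$ for their category, $S$ for the sphere spectrum ($S_n=(S^1)^{\wedge n}$), $\wedge=\otimes_S$ for the smash product of symmetric spectra, where $\otimes$ is the tensor product of symmetric sequences of pointed simplicial sets. Let $\bar S\subset S$ be the subspectrum with $\bar S_0=*$ and $\bar S_n=S_n$ for $n\ge 1$; the inclusion induces natural maps $\bar S\wedge X\to S\wedge X\cong X$. Let $\mathsf{SymSeq}$ be the category of functors $\Sigma^{\mathrm{op}}\to\mathsf{Sp}^\Sigma$, where $\Sigma$ is the category of finite sets and bijections, and let $\mathsf{SymSeq}^G$ be the category of objects of $\mathsf{SymSeq}$ with $G$-action. The value $X[\mathbf r]$ of $X\in\mathsf{SymSeq}^G$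 at a set with $r$ elements is a symmetric spectrum with an action of $\Sigma_r^{\mathrm{op}}\times G$. \textbf{Cofibrations.} (i) The flat stable (resp. positive flat stable) cofibrations of $\mathsf{Sp}^\Sigma$ are the retracts of (possibly transfinite) compositions of pushouts of the maps $S\otimes G^H_m\partial\Delta[k]_+\to S\otimes G^H_m\Delta[k]_+$, for $k\ge 0$, $m\ge 0$ (resp. $m\ge 1$) and subgroups $H\subset\Sigma_m$; here $G^H_mK$ is the symmetric sequence with $\Sigma_m/H\cdot K$ in degree $m$ and $*$ in all other degrees. The acyclic fibrations are the maps with the right lifting property with respect to these cofibrations. (ii) The (positive) flat stable cofibrations of $\mathsf{SymSeq}^G$ are those of the projective structure: the maps with the left lifting property with respect to the maps $f$ such that every $f[\mathbf r]$ is a (positive) flat stable acyclic fibration in $\mathsf{Sp}^\Sigma$. (iii) The mixed cofibrations of $\mathsf{S}_*^{\Sigma_n}$ are the retracts of (possibly transfinite) compositions of pushouts of the maps $\Sigma_n/H\cdot\partial\Delta[k]_+\to\Sigma_n/H\cdot\Delta[k]_+$ ($k\ge0$, $H\subset\Sigma_n$ a subgroup), and the acyclic fibrations are the maps with the right lifting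 property with respect to them. The cofibrations of $(\mathsf{S}_*^{\Sigma_n})^{\Sigma_r^{\mathrm{op}}\times G}$ are those of the corresponding projective structure: the maps with the left lifting property with respect to the maps whose underlying map in $\mathsf{S}_*^{\Sigma_n}$ is an acyclic fibration. \textbf{Proposition.} Let $G$ be a finite group. (a) A map $f\colon X\to Y$ in $\mathsf{SymSeq}^G$ is a flat stable cofibration if and only if the maps $X[\mathbf r]_0\to Y[\mathbf r]_0$ for $r\ge 0$, and the induced maps $$(\bar S\wedge Y[\mathbf r])_n\amalg_{(\bar S\wedge X[\mathbf r])_n}X[\mathbf r]_n\longrightarrow Y[\mathbf r]_n\qquad (r\ge 0,\ n\ge 1),$$ are cofibrations in $(\mathsf{S}_*^{\Sigma_n})^{\Sigma_r^{\mathrm{op}}\times G}$ (with $n=0$ for the former). (b) A map $f\colon X\to Y$ in $\mathsf{SymSeq}^G$ is a positive flat stable cofibration if and only if the maps $X[\mathbf r]_0\to Y[\mathbf r]_0$, $r\ge 0$, are isomorphisms and the same induced maps, for $r\ge 0$ and $n\ge 1$, are cofibrations in $(\mathsf{S}_*^{\Sigma_n})^{\Sigma_r^{\mathrm{op}}\times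 G}$. (c) For all $r,n\ge 0$, every cofibration in $(\mathsf{S}_*^{\Sigma_n})^{\Sigma_r^{\mathrm{op}}\times G}$ is a monomorphism such that $\Sigma_r^{\mathrm{op}}\times G$ acts freely on the simplices of the codomain that are not in its image. -/

import Mathlib

open CategoryTheory Limits Opposite

universe u v

namespace FlatStable

/-- A skeleton of the category of finite sets and bijections: the object `⟨n⟩` stands for the
set `Fin n`, and the morphisms are the bijections. -/
structure Sig where
  n : ℕ

instance : Category.{0} Sig where
  Hom m n := Fin m.n ≃ Fin n.n
  id m := Equiv.refl _
  comp f g := f.trans g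

/-- The bijection underlying a morphism. -/
def Sig.eqv {m n : Sig} (e : m ⟶ n) : Fin m.n ≃ Fin n.n := e

lemma Sig.eq_of_hom {m n : Sig} (e : m ⟶ n) : m.n = n.n := by
  simpa using Fintype.card_congr (Sig.eqv e)

/-- The group `Σ_n`, as a category with one object, sits in `Sig` as the automorphisms of `⟨n⟩`. -/
def incl (n : ℕ) : SingleObj (Equiv.Perm (Fin n)) ⥤ Sig where
  obj _ := ⟨n⟩
  map g := (g : Fin n ≃ Fin n)
  map_id _ := rfl
  map_comp _ _ := rfl

/-- Pointed simplicial sets (simplicial objects in pointed sets). -/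
abbrev PSSet : Type (u + 1) := SimplicialObject Pointed.{u}

/-- `X₊`: a disjoint base point is added. -/
abbrev plus : SSet.{u} ⥤ PSSet.{u} :=
  (SimplicialObject.whiskering (Type u) Pointed.{u}).obj typeToPointed.{u}

/-- Pointed simplicial sets with left `Σ_n`-action. -/
abbrev PermPSSet (n : ℕ) : Type (u + 1) := SingleObj (Equiv.Perm (Fin n)) ⥤ PSSet.{u}

/-- Symmetric sequences of pointed simplicial sets. -/
abbrev Seq : Type (u + 1) := Sig ⥤ PSSet.{u}

/-- The value at `n`, as a pointed simplicial set with `Σ_n`-action. -/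
abbrev ev (n : ℕ) : Seq.{u} ⥤ PermPSSet.{u} n :=
  (Functor.whiskeringLeft _ _ _).obj (incl n)

/-- The `k`-simplices of the `n`-th term of `A`. -/
abbrev El (A : Seq.{u}) (n : ℕ) (k : SimplexCategoryᵒᵖ) : Type u := ((A.obj ⟨n⟩).obj k : Pointed)

section elements

variable {A B : Seq.{u}} {m n : ℕ} {k l : SimplexCategoryᵒᵖ}

/-- The base point. -/
abbrev pt (A : Seq.{u}) (n : ℕ) (k : SimplexCategoryᵒᵖ) : El A n k :=
  ((A.obj ⟨n⟩).obj k).point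

/-- The action of a bijection on simplices. -/
def perm (A : Seq.{u}) (e : Fin m ≃ Fin n) (x : El A m k) : El A n k :=
  ((A.map (X := ⟨m⟩) (Y := ⟨n⟩) e).app k).toFun x

/-- The simplicial operators. -/
def simpl (A : Seq.{u}) (φ : k ⟶ l) (x : El A n k) : El A n l :=
  ((A.obj ⟨n⟩).map φ).toFun x

/-- A morphism of symmetric sequences on simplices. -/
def ap (f : A ⟶ B) (x : El A n k) : El B n k := ((f.app ⟨n⟩).app k).toFun x

lemma perm_pt (e : Fin m ≃ Fin n) : perm A e (pt A m k) = pt A n k :=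
  ((A.map (X := ⟨m⟩) (Y := ⟨n⟩) e).app k).map_point

lemma simpl_pt (φ : k ⟶ l) : simpl A φ (pt A m k) = pt A m l :=
  ((A.obj ⟨m⟩).map φ).map_point

lemma ap_pt (f : A ⟶ B) : ap f (pt A n k) = pt B n k := ((f.app ⟨n⟩).app k).map_point

lemma perm_refl (x : El A n k) : perm A (Equiv.refl _) x = x := by
  change ((A.map (𝟙 (⟨n⟩ : Sig))).app k).toFun x = x
  rw [A.map_id]; rfl

lemma perm_perm {p : ℕ} (e : Fin m ≃ Fin n) (e' : Fin n ≃ Fin p) (x : El A m k) :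
    perm A e' (perm A e x) = perm A (e.trans e') x := by
  change _ = ((A.map ((show (⟨m⟩ : Sig) ⟶ ⟨n⟩ from e) ≫ (show (⟨n⟩ : Sig) ⟶ ⟨p⟩ from e'))).app
    k).toFun x
  rw [A.map_comp]; rfl

lemma simpl_id (x : El A n k) : simpl A (𝟙 k) x = x := by
  simp [simpl]

lemma simpl_simpl {j : SimplexCategoryᵒᵖ} (φ : k ⟶ l) (ψ : l ⟶ j) (x : El A n k) :
    simpl A ψ (simpl A φ x) = simpl A (φ ≫ ψ) x := by
  simp [simpl]

lemma simpl_perm (e : Fin m ≃ Fin n) (φ : k ⟶ l) (x : El A m k) :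
    simpl A φ (perm A e x) = perm A e (simpl A φ x) :=
  congrFun (congrArg Pointed.Hom.toFun
    ((A.map (X := ⟨m⟩) (Y := ⟨n⟩) e).naturality φ)) x |>.symm

lemma ap_perm (f : A ⟶ B) (e : Fin m ≃ Fin n) (x : El A m k) :
    ap f (perm A e x) = perm B e (ap f x) :=
  congrFun (congrArg (fun g => Pointed.Hom.toFun (NatTrans.app g k))
    (f.naturality (X := ⟨m⟩) (Y := ⟨n⟩) e)) x

lemma ap_simpl (f : A ⟶ B) (φ : k ⟶ l) (x : El A n k) :
    ap f (simpl A φ x) = simpl B φ (ap f x) :=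
  congrFun (congrArg Pointed.Hom.toFun ((f.app ⟨n⟩).naturality φ)) x

lemma ap_comp {C : Seq.{u}} (f : A ⟶ B) (g : B ⟶ C) (x : El A n k) :
    ap (f ≫ g) x = ap g (ap f x) := rfl

lemma seqHom_ext {f g : A ⟶ B} (h : ∀ (n k) (x : El A n k), ap f x = ap g x) : f = g := by
  refine NatTrans.ext (funext fun n => NatTrans.ext (funext fun k => ?_))
  exact Pointed.Hom.ext (funext fun x => h n.n k x)

end elements

/-! ### Quotients of pointed sets -/

/-- The relation on `Z ⊔ {*}` generated by `r` and by `z ∼ *` for all `z` with `c z`. -/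
inductive PQuot.Rel {Z : Type u} (r : Z → Z → Prop) (c : Z → Prop) : Option Z → Option Z → Prop where
  | rel {x y : Z} : r x y → PQuot.Rel r c (some x) (some y)
  | base {x : Z} : c x → PQuot.Rel r c (some x) none

/-- The pointed set with generators `Z`, modulo the relations `x = y` for `r x y` and `z = *`
for `c z`. -/
def PQuot {Z : Type u} (r : Z → Z → Prop) (c : Z → Prop) : Pointed.{u} :=
  ⟨Quot (PQuot.Rel r c), Quot.mk _ none⟩

namespace PQuot

variable {Z : Type u} {r : Z → Z → Prop} {c : Z → Prop}

/-- The class of a generator. -/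
def mk (r : Z → Z → Prop) (c : Z → Prop) (z : Z) : PQuot r c := Quot.mk _ (some z)

lemma sound {x y : Z} (h : r x y) : mk r c x = mk r c y := Quot.sound (.rel h)

lemma sound_base {x : Z} (h : c x) : mk r c x = (PQuot r c).point := Quot.sound (.base h)

lemma ind {p : PQuot r c → Prop} (h0 : p (PQuot r c).point) (h : ∀ z, p (mk r c z))
    (x : PQuot r c) : p x := by
  obtain ⟨_ | z⟩ := x
  exacts [h0, h z]

/-- Pointed maps out of a quotient. -/
def desc {P : Pointed.{u}} (f : Z → P) (hr : ∀ x y, r x y → f x = f y)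
    (hc : ∀ x, c x → f x = P.point) : PQuot r c ⟶ P where
  toFun := Quot.lift (fun o => o.elim P.point f) (by
    rintro _ _ (h | h)
    exacts [hr _ _ h, hc _ h])
  map_point := rfl

/-- Maps between quotients induced by maps of generators. -/
def map {Z' : Type u} {r' : Z' → Z' → Prop} {c' : Z' → Prop} (f : Z → Z')
    (hr : ∀ x y, r x y → r' (f x) (f y)) (hc : ∀ x, c x → c' (f x)) : PQuot r c ⟶ PQuot r' c' :=
  desc (fun z => mk r' c' (f z)) (fun _ _ h => sound (hr _ _ h)) (fun _ h => sound_base (hc _ h))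

lemma hom_ext {P : Pointed.{u}} {f g : PQuot r c ⟶ P}
    (h : ∀ z, f.toFun (mk r c z) = g.toFun (mk r c z)) : f = g :=
  Pointed.Hom.ext (funext (ind (f.map_point.trans g.map_point.symm) h))

@[simp] lemma desc_mk {P : Pointed.{u}} (f : Z → P) (hr hc) (z : Z) :
    (desc (r := r) (c := c) f hr hc).toFun (mk r c z) = f z := rfl

@[simp] lemma map_mk {Z' : Type u} {r' : Z' → Z' → Prop} {c' : Z' → Prop} (f : Z → Z') (hr hc)
    (z : Z) : (map (r := r) (c := c) (r' := r') (c' := c') f hr hc).toFun (mk r c z) =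
      mk r' c' (f z) := rfl

end PQuot

instance : HasPushouts Pointed.{u} := by
  refine @hasPushouts_of_hasColimit_span _ _ ?_
  intro X Y Z f g
  let r : (Y ⊕ Z) → (Y ⊕ Z) → Prop := fun a b => ∃ x, a = .inl (f.toFun x) ∧ b = .inr (g.toFun x)
  let c : (Y ⊕ Z) → Prop := fun a => a = .inl Y.point ∨ a = .inr Z.point
  refine HasColimit.mk ⟨PushoutCocone.mk (W := PQuot r c)
    ⟨fun y => PQuot.mk r c (.inl y), PQuot.sound_base (Or.inl rfl)⟩
    ⟨fun z => PQuot.mk r c (.inr z), PQuot.sound_base (Or.inr rfl)⟩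
    (Pointed.Hom.ext (funext fun x => PQuot.sound ⟨x, rfl, rfl⟩)), ?_⟩
  refine PushoutCocone.IsColimit.mk _ (fun s => PQuot.desc
      (fun a => a.elim s.inl.toFun s.inr.toFun) ?_ ?_) ?_ ?_ ?_
  · rintro _ _ ⟨x, rfl, rfl⟩
    exact congrFun (congrArg Pointed.Hom.toFun s.condition) x
  · rintro _ (rfl | rfl)
    exacts [s.inl.map_point, s.inr.map_point]
  · intro s; rfl
  · intro s; rfl
  · intro s m h1 h2
    refine PQuot.hom_ext ?_
    rintro (y | z)
    · exact congrFun (congrArg Pointed.Hom.toFun h1) y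
    · exact congrFun (congrArg Pointed.Hom.toFun h2) z

instance : HasPushouts PSSet.{u} :=
  inferInstanceAs (HasPushouts (SimplexCategoryᵒᵖ ⥤ Pointed.{u}))

/-- The standard simplex `Δ[k]`. -/
abbrev simplex (k : ℕ) : SSet.{u} := SSet.stdSimplex.obj (SimplexCategory.mk k)

/-- The simplicial circle `Δ[1]/∂Δ[1]`. -/
def circle : PSSet.{u} where
  obj k := PQuot (Z := (simplex.{u} 1).obj k) (fun _ _ => False) (fun x => x ∈ (SSet.boundary.{u} 1).obj k)
  map φ := PQuot.map ((simplex.{u} 1).map φ) (fun _ _ h => h) (fun _ h => (SSet.boundary.{u} 1).map φ h)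
  map_id _ := PQuot.hom_ext fun z => by
    rw [PQuot.map_mk, Functor.map_id_apply]; rfl
  map_comp _ _ := PQuot.hom_ext fun z => by
    rw [PQuot.map_mk, Functor.map_comp_apply]; rfl

/-- The `k`-simplices of the simplicial circle. -/
abbrev Circ (k : SimplexCategoryᵒᵖ) : Type u := (circle.{u}.obj k : Pointed)

/-! ### Symmetric spectra -/

/-- The identification of the disjoint union of `Fin p` and `Fin n` with `Fin (n + p)` that puts
the first summand in front. -/
def block (p n : ℕ) : Fin p ⊕ Fin n ≃ Fin (n + p) :=
  finSumFinEquiv.trans (finCongr (Nat.add_comm p n))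

/-- The block sum of bijections; in particular `Σ_p × Σ_n → Σ_{n+p}`. -/
def blockSum {p p' n n' : ℕ} (α : Fin p ≃ Fin p') (β : Fin n ≃ Fin n') :
    Fin (n + p) ≃ Fin (n' + p') :=
  (block p n).symm.trans ((Equiv.sumCongr α β).trans (block p' n'))

/-- The iterated structure maps `S^p ∧ X_n ⟶ X_{n+p}`, on a simplex `t 0 ∧ ⋯ ∧ t (p-1) ∧ x`. -/
def iter {A : Seq.{u}}
    (σ : ∀ (n : ℕ) (k : SimplexCategoryᵒᵖ), Circ.{u} k → El A n k → El A (n + 1) k)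
    {n : ℕ} {k : SimplexCategoryᵒᵖ} : (p : ℕ) → (Fin p → Circ.{u} k) → El A n k → El A (n + p) k
  | 0, _, x => x
  | p + 1, t, x => σ (n + p) k (t 0) (iter σ p (fun i => t i.succ) x)

/-- A symmetric spectrum: pointed simplicial sets `X_n` with `Σ_n`-action, and structure maps
`S^1 ∧ X_n ⟶ X_{n+1}` (maps of pointed simplicial sets, given on pairs of simplices) such that the
iterated structure maps `S^p ∧ X_n ⟶ X_{n+p}` are `Σ_p × Σ_n`-equivariant. -/
structure SymSpec : Type (u + 1) where
  seq : Seq.{u}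
  σ : ∀ (n : ℕ) (k : SimplexCategoryᵒᵖ), Circ.{u} k → El seq n k → El seq (n + 1) k
  σ_pt_left : ∀ {n k} (x : El seq n k), σ n k (circle.obj k).point x = pt seq (n + 1) k
  σ_pt_right : ∀ {n k} (t : Circ.{u} k), σ n k t (pt seq n k) = pt seq (n + 1) k
  σ_simpl : ∀ {n k l} (φ : k ⟶ l) (t : Circ.{u} k) (x : El seq n k),
    simpl seq φ (σ n k t x) = σ n l ((circle.map φ).toFun t) (simpl seq φ x)
  σ_equivariant : ∀ {p n k} (α : Equiv.Perm (Fin p)) (β : Equiv.Perm (Fin n))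
    (t : Fin p → Circ.{u} k) (x : El seq n k),
    perm seq (blockSum α β) (iter σ p t x) = iter σ p (fun i => t (α.symm i)) (perm seq β x)

namespace SymSpec

/-- Maps of symmetric spectra. -/
@[ext]
structure Hom (X Y : SymSpec.{u}) where
  hom : X.seq ⟶ Y.seq
  comm : ∀ {n k} (t : Circ.{u} k) (x : El X.seq n k),
    ap hom (X.σ n k t x) = Y.σ n k t (ap hom x)

instance : Category.{u} SymSpec.{u} where
  Hom := Hom
  id X := ⟨𝟙 X.seq, fun _ _ => rfl⟩
  comp f g := ⟨f.hom ≫ g.hom, fun t x => by rw [ap_comp, f.comm, g.comm, ap_comp]⟩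

@[ext]
lemma hom_ext {X Y : SymSpec.{u}} {f g : X ⟶ Y} (h : f.hom = g.hom) : f = g := Hom.ext h

/-- The underlying symmetric sequence of pointed simplicial sets. -/
@[simps]
def forget : SymSpec.{u} ⥤ Seq.{u} where
  obj X := X.seq
  map f := f.hom

section

variable (X : SymSpec.{u}) {n p : ℕ} {k l : SimplexCategoryᵒᵖ}

/-- The iterated structure maps. -/
def it (p : ℕ) (t : Fin p → Circ.{u} k) (x : El X.seq n k) : El X.seq (n + p) k :=
  iter X.σ p t x

lemma it_zero (t : Fin 0 → Circ.{u} k) (x : El X.seq n k) : X.it 0 t x = x := rfl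

lemma it_succ (t : Fin (p + 1) → Circ.{u} k) (x : El X.seq n k) :
    X.it (p + 1) t x = X.σ (n + p) k (t 0) (X.it p (fun i => t i.succ) x) := rfl

lemma it_simpl (φ : k ⟶ l) (t : Fin p → Circ.{u} k) (x : El X.seq n k) :
    simpl X.seq φ (X.it p t x) = X.it p (fun i => (circle.map φ).toFun (t i))
      (simpl X.seq φ x) := by
  induction p with
  | zero => rfl
  | succ p ih => rw [it_succ, it_succ, ← ih]; exact X.σ_simpl φ _ _

lemma it_pt_right (t : Fin p → Circ.{u} k) : X.it p t (pt X.seq n k) = pt X.seq (n + p) k := by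
  induction p with
  | zero => rfl
  | succ p ih => rw [it_succ, ih]; exact X.σ_pt_right _

lemma it_pt_left (t : Fin p → Circ.{u} k) (x : El X.seq n k)
    (h : ∃ i, t i = (circle.obj k).point) : X.it p t x = pt X.seq (n + p) k := by
  induction p with
  | zero => exact h.choose.elim0
  | succ p ih =>
    obtain ⟨i, hi⟩ := h
    rw [it_succ]
    induction i using Fin.cases with
    | zero => rw [hi]; exact X.σ_pt_left _
    | succ i => rw [ih _ ⟨i, hi⟩]; exact X.σ_pt_right _

lemma ap_it {X Y : SymSpec.{u}} (f : X ⟶ Y) (t : Fin p → Circ.{u} k) (x : El X.seq n k) :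
    ap f.hom (X.it p t x) = Y.it p t (ap f.hom x) := by
  induction p with
  | zero => rfl
  | succ p ih => rw [it_succ, it_succ, ← ih]; exact f.comm _ _

/-- The equivariance, for bijections between (necessarily equinumerous) index sets. -/
lemma it_perm {p' n' : ℕ} (α : Fin p ≃ Fin p') (β : Fin n ≃ Fin n')
    (t : Fin p → Circ.{u} k) (x : El X.seq n k) :
    perm X.seq (blockSum α β) (X.it p t x) = X.it p' (fun i => t (α.symm i)) (perm X.seq β x) := by
  obtain rfl : p = p' := by simpa using Fintype.card_congr α
  obtain rfl : n = n' := by simpa using Fintype.card_congr β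
  exact X.σ_equivariant α β t x

lemma perm_cast_σ {m : ℕ} (h : m = n) (h' : m + 1 = n + 1) (t : Circ.{u} k) (x : El X.seq m k) :
    perm X.seq (finCongr h') (X.σ m k t x) = X.σ n k t (perm X.seq (finCongr h) x) := by
  subst h
  rw [finCongr_refl, finCongr_refl, perm_refl, perm_refl]

end

/-- Concatenation of tuples. -/
def append {T : Type u} {p n : ℕ} (t : Fin p → T) (s : Fin n → T) (i : Fin (n + p)) : T :=
  Sum.elim t s ((block p n).symm i)

lemma block_symm_zero (p n : ℕ) : (block (p + 1) n).symm 0 = Sum.inl 0 := by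
  rw [Equiv.symm_apply_eq]; rfl

lemma block_symm_succ (p n : ℕ) (i : Fin (n + p)) :
    (block (p + 1) n).symm i.succ = Sum.map Fin.succ id ((block p n).symm i) := by
  rw [Equiv.symm_apply_eq]
  obtain ⟨j | j, rfl⟩ := (block p n).surjective i
  · ext; simp [block]
  · ext; simp [block]; omega

lemma append_zero {T : Type u} {p n : ℕ} (t : Fin (p + 1) → T) (s : Fin n → T) :
    append t s 0 = t 0 := by
  simp [append, block_symm_zero]

lemma append_succ {T : Type u} {p n : ℕ} (t : Fin (p + 1) → T) (s : Fin n → T) (i : Fin (n + p)) :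
    append t s i.succ = append (fun i => t i.succ) s i := by
  simp only [append]
  rw [block_symm_succ]
  cases (block p n).symm i <;> rfl

lemma it_append (X : SymSpec.{u}) {n a c k} (s : Fin a → Circ.{u} k) (t : Fin c → Circ.{u} k)
    (x : El X.seq n k) :
    perm X.seq (finCongr (Nat.add_assoc n a c).symm) (X.it (a + c) (append t s) x) =
      X.it c t (X.it a s x) := by
  induction c with
  | zero =>
    rw [it_zero]
    have h : append t s = s := by
      funext i
      have : (block 0 a).symm i = Sum.inr i := by
        rw [Equiv.symm_apply_eq]; ext; simp [block]
      simp only [append]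
      rw [this]; rfl
    rw [h]
    exact perm_refl _
  | succ c ih =>
    rw [it_succ, ← ih]
    refine (X.perm_cast_σ (Nat.add_assoc n a c).symm _ _ _).trans ?_
    rw [append_zero]
    have : (fun i : Fin (a + c) => append t s i.succ) = append (fun i => t i.succ) s :=
      funext fun i => append_succ t s i
    exact congrArg (fun r => X.σ (n + a + c) k (t 0)
      (perm X.seq (finCongr (Nat.add_assoc n a c).symm) (X.it (a + c) r x))) this

end SymSpec

/-! ### The sphere spectrum -/

/-- The `k`-simplices of the sphere `S^n = (S^1)^{∧ n}`. -/
def sphereLvl (n : ℕ) (k : SimplexCategoryᵒᵖ) : Pointed.{u} :=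
  PQuot (Z := Fin n → Circ.{u} k) (fun _ _ => False) (fun t => ∃ i, t i = (circle.obj k).point)

/-- The spheres `S^n`, with `Σ_n` permuting the smash factors. -/
def sphereSeq : Seq.{u} where
  obj n :=
    { obj := fun k => sphereLvl n.n k
      map := fun φ => PQuot.map (fun t i => (circle.map φ).toFun (t i)) (fun _ _ h => h)
        (fun _ ⟨i, hi⟩ => ⟨i, (congrArg (circle.map φ).toFun hi).trans (circle.map φ).map_point⟩)
      map_id := fun k => PQuot.hom_ext fun t => by
        simp only [PQuot.map_mk, circle.map_id]; rfl
      map_comp := fun φ ψ => PQuot.hom_ext fun t => by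
        simp only [PQuot.map_mk, circle.map_comp]; rfl }
  map {m n} e :=
    { app := fun k => PQuot.map (fun t i => t ((Sig.eqv e).symm i))
        (fun _ _ h => h)
        (fun _ ⟨i, hi⟩ => ⟨(Sig.eqv e) i, by simpa using hi⟩)
      naturality := fun _ _ _ => PQuot.hom_ext fun _ => rfl }
  map_id _ := NatTrans.ext (funext fun _ => PQuot.hom_ext fun _ => rfl)
  map_comp _ _ := NatTrans.ext (funext fun _ => PQuot.hom_ext fun _ => rfl)

/-- The simplex `t 0 ∧ ⋯ ∧ t (n-1)` of the `n`-sphere. -/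
def sphereMk {n : ℕ} {k : SimplexCategoryᵒᵖ} (t : Fin n → Circ.{u} k) : El sphereSeq.{u} n k :=
  PQuot.mk _ _ t

lemma sphere_ind {n k} {P : El sphereSeq.{u} n k → Prop} (h0 : P (pt _ n k))
    (h : ∀ t, P (sphereMk t)) (z : El sphereSeq.{u} n k) : P z :=
  PQuot.ind h0 h z

/-- The structure map `S^1 ∧ S^n ⟶ S^{n+1}` of the sphere spectrum. -/
def sphereσ (n : ℕ) (k : SimplexCategoryᵒᵖ) (t₀ : Circ.{u} k) (z : El sphereSeq.{u} n k) :
    El sphereSeq.{u} (n + 1) k :=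
  (show sphereLvl n k ⟶ sphereLvl (n + 1) k from
    PQuot.map (fun t => (Fin.cons t₀ t : Fin (n + 1) → Circ.{u} k))
      (fun _ _ h => h) (fun _ ⟨i, hi⟩ => ⟨i.succ, hi⟩)).toFun z

lemma sphereσ_mk {n k} (t₀ : Circ.{u} k) (t : Fin n → Circ.{u} k) :
    sphereσ n k t₀ (sphereMk t) = sphereMk (Fin.cons t₀ t : Fin (n + 1) → Circ.{u} k) := rfl

lemma sphereσ_pt {n k} (t₀ : Circ.{u} k) :
    sphereσ n k t₀ (pt sphereSeq n k) = pt sphereSeq (n + 1) k := rfl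

lemma append_zero_left {T : Type u} {n : ℕ} (t : Fin 0 → T) (s : Fin n → T) :
    SymSpec.append t s = s := by
  funext i
  have : (block 0 n).symm i = Sum.inr i := by
    rw [Equiv.symm_apply_eq]; ext; simp [block]
  simp only [SymSpec.append]
  rw [this]; rfl

lemma iter_sphere {n k p} (t : Fin p → Circ.{u} k) (s : Fin n → Circ.{u} k) :
    iter sphereσ p t (sphereMk s) = sphereMk (SymSpec.append t s) := by
  induction p with
  | zero => rw [append_zero_left]; rfl
  | succ p ih =>
    rw [iter, ih, sphereσ_mk]
    congr 1
    funext i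
    induction i using Fin.cases with
    | zero => rw [SymSpec.append_zero]; rfl
    | succ i => rw [SymSpec.append_succ]; rfl

lemma iter_sphere_pt {n k p} (t : Fin p → Circ.{u} k) :
    iter sphereσ p t (pt sphereSeq n k) = pt sphereSeq (n + p) k := by
  induction p with
  | zero => rfl
  | succ p ih => rw [iter, ih]; rfl

/-- The sphere spectrum. -/
def sphere : SymSpec.{u} where
  seq := sphereSeq
  σ := sphereσ
  σ_pt_left {n k} x := by
    induction x using sphere_ind with
    | h0 => rfl
    | h t => exact PQuot.sound_base ⟨0, rfl⟩
  σ_pt_right _ := rfl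
  σ_simpl {n k l} φ t x := by
    induction x using sphere_ind with
    | h0 => rfl
    | h s =>
      change sphereMk _ = sphereMk _
      congr 1
      funext i
      induction i using Fin.cases <;> rfl
  σ_equivariant {p n k} α β t x := by
    induction x using sphere_ind with
    | h0 => rw [iter_sphere_pt, perm_pt, perm_pt, iter_sphere_pt]
    | h s =>
      rw [iter_sphere]
      change sphereMk _ = iter sphereσ p _ (sphereMk _)
      rw [iter_sphere]
      congr 1
      funext i
      obtain ⟨j, rfl⟩ := (blockSum α β).surjective i
      obtain ⟨j | j, rfl⟩ := (block p n).surjective j <;>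
        simp [SymSpec.append, blockSum, Sig.eqv]

/-- The `k`-simplices of `S^n` if `n > 0`, and a point if `n = 0`. -/
def sphereBarLvl (n : ℕ) (k : SimplexCategoryᵒᵖ) : Pointed.{u} :=
  ⟨{z : El sphereSeq.{u} n k // n = 0 → z = pt _ n k}, ⟨pt _ n k, fun _ => rfl⟩⟩

/-- The inclusion into `S^n`. -/
def sphereBarVal {n : ℕ} {k : SimplexCategoryᵒᵖ} (z : sphereBarLvl.{u} n k) :
    El sphereSeq.{u} n k :=
  Subtype.val z

lemma sphereBarVal_inj {n k} {z w : sphereBarLvl.{u} n k} (h : sphereBarVal z = sphereBarVal w) :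
    z = w := Subtype.ext h

lemma sphereBarVal_zero {n k} (z : sphereBarLvl.{u} n k) (h : n = 0) :
    sphereBarVal z = pt sphereSeq n k := Subtype.property z h

/-- The spheres in positive degrees, and a point in degree `0`. -/
def sphereBarSeq : Seq.{u} where
  obj n :=
    { obj := fun k => sphereBarLvl n.n k
      map := fun φ => ⟨fun z => ⟨simpl sphereSeq φ (sphereBarVal z), fun h => by
        rw [sphereBarVal_zero z h, simpl_pt]⟩, sphereBarVal_inj (simpl_pt (A := sphereSeq) (m := n.n) φ)⟩
      map_id := fun _ => Pointed.Hom.ext (funext fun z => sphereBarVal_inj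
        (simpl_id (A := sphereSeq) (sphereBarVal z)))
      map_comp := fun φ ψ => Pointed.Hom.ext (funext fun z => sphereBarVal_inj
        (simpl_simpl (A := sphereSeq) φ ψ (sphereBarVal z)).symm) }
  map {m n} e :=
    { app := fun k => ⟨fun z => ⟨perm sphereSeq (Sig.eqv e) (sphereBarVal z),
        fun h => by
          rw [sphereBarVal_zero z ((Sig.eq_of_hom e).trans h), perm_pt]⟩,
        sphereBarVal_inj (perm_pt (A := sphereSeq) (k := k) (Sig.eqv e))⟩
      naturality := fun _ _ φ => Pointed.Hom.ext (funext fun z => sphereBarVal_inj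
        (simpl_perm (A := sphereSeq) (Sig.eqv e) φ (sphereBarVal z)).symm) }
  map_id _ := NatTrans.ext (funext fun _ => Pointed.Hom.ext (funext fun z =>
    sphereBarVal_inj (perm_refl (A := sphereSeq) (sphereBarVal z))))
  map_comp {m n p} e f := NatTrans.ext (funext fun _ => Pointed.Hom.ext (funext fun z =>
    sphereBarVal_inj (perm_perm (A := sphereSeq) (Sig.eqv e)
      (Sig.eqv f) (sphereBarVal z)).symm))

/-- The structure maps of the truncated sphere spectrum. -/
def sphereBarσ (n : ℕ) (k : SimplexCategoryᵒᵖ) (t : Circ.{u} k) (z : El sphereBarSeq.{u} n k) :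
    El sphereBarSeq.{u} (n + 1) k :=
  show sphereBarLvl (n + 1) k from
    Subtype.mk (sphereσ n k t (sphereBarVal z)) fun h => absurd h (Nat.succ_ne_zero n)

lemma iter_sphereBar {n k p} (t : Fin p → Circ.{u} k) (z : El sphereBarSeq.{u} n k) :
    sphereBarVal (iter sphereBarσ p t z) = iter sphereσ p t (sphereBarVal z) := by
  induction p with
  | zero => rfl
  | succ p ih => exact congrArg (sphereσ (n + p) k (t 0)) (ih _)

/-- The truncated sphere spectrum: the subspectrum of the sphere spectrum that agrees with it in
positive degrees and is trivial in degree `0`. -/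
def sphereBar : SymSpec.{u} where
  seq := sphereBarSeq
  σ := sphereBarσ
  σ_pt_left x := sphereBarVal_inj (sphere.σ_pt_left (sphereBarVal x))
  σ_pt_right t := sphereBarVal_inj (sphere.σ_pt_right t)
  σ_simpl φ t x := sphereBarVal_inj (sphere.σ_simpl φ t (sphereBarVal x))
  σ_equivariant {p n k} α β t x := sphereBarVal_inj (by
    rw [iter_sphereBar]
    refine Eq.trans ?_ (sphere.σ_equivariant α β t (sphereBarVal x))
    exact congrArg (perm sphereSeq (blockSum α β)) (iter_sphereBar t x))

/-- The inclusion of the truncated sphere spectrum. -/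
def sphereBarι : sphereBar.{u} ⟶ sphere.{u} where
  hom :=
    { app := fun _ =>
        { app := fun _ => ⟨sphereBarVal, rfl⟩
          naturality := fun _ _ _ => rfl }
      naturality := fun _ _ _ => rfl }
  comm _ _ := rfl

/-! ### Tensor products -/

/-- A generator of `(A ⊗ B)_n` in simplicial degree `k`. -/
structure TGen (A B : Seq.{u}) (n : ℕ) (k : SimplexCategoryᵒᵖ) : Type u where
  a : ℕ
  b : ℕ
  e : Fin a ⊕ Fin b ≃ Fin n
  x : El A a k
  y : El B b k

namespace TGen

variable {A B : Seq.{u}} {n m : ℕ} {k l : SimplexCategoryᵒᵖ}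

/-- The action of a bijection on generators. -/
@[simps]
def perm (f : Fin n ≃ Fin m) (z : TGen A B n k) : TGen A B m k :=
  ⟨z.a, z.b, z.e.trans f, z.x, z.y⟩

/-- The simplicial operators on generators. -/
@[simps]
def simpl (φ : k ⟶ l) (z : TGen A B n k) : TGen A B n l :=
  ⟨z.a, z.b, z.e, FlatStable.simpl A φ z.x, FlatStable.simpl B φ z.y⟩

/-- A pair of morphisms on generators. -/
@[simps]
def map {A' B' : Seq.{u}} (f : A ⟶ A') (g : B ⟶ B') (z : TGen A B n k) : TGen A' B' n k :=
  ⟨z.a, z.b, z.e, ap f z.x, ap g z.y⟩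

/-- One of the two components is the base point. -/
def IsBase (z : TGen A B n k) : Prop := z.x = pt A z.a k ∨ z.y = pt B z.b k

lemma IsBase.simpl {z : TGen A B n k} (φ : k ⟶ l) (h : z.IsBase) : (z.simpl φ).IsBase := by
  rcases h with h | h
  · exact Or.inl ((congrArg _ h).trans (simpl_pt φ))
  · exact Or.inr ((congrArg _ h).trans (simpl_pt φ))

lemma IsBase.map {A' B' : Seq.{u}} (f : A ⟶ A') (g : B ⟶ B') {z : TGen A B n k}
    (h : z.IsBase) : (z.map f g).IsBase := by
  rcases h with h | h
  · exact Or.inl ((congrArg _ h).trans (ap_pt f))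
  · exact Or.inr ((congrArg _ h).trans (ap_pt g))

end TGen

/-- The relation on generators of `A ⊗ B` that divides out the actions of the symmetric groups
on `A_a` and `B_b`. -/
inductive TRel (A B : Seq.{u}) (n : ℕ) (k : SimplexCategoryᵒᵖ) :
    TGen A B n k → TGen A B n k → Prop
  | equivar {a a' b b' : ℕ} (α : Fin a ≃ Fin a') (β : Fin b ≃ Fin b')
      (e : Fin a' ⊕ Fin b' ≃ Fin n) (x : El A a k) (y : El B b k) :
      TRel A B n k ⟨a, b, (Equiv.sumCongr α β).trans e, x, y⟩ ⟨a', b', e, perm A α x, perm B β y⟩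

/-- A quotient of the generators, by a family of relations that is compatible with bijections and
simplicial operators. -/
def quotSeq {A B : Seq.{u}} (R : ∀ n k, TGen A B n k → TGen A B n k → Prop)
    (hperm : ∀ {n m k} (f : Fin n ≃ Fin m) z w, R n k z w → R m k (z.perm f) (w.perm f))
    (hsimpl : ∀ {n k l} (φ : k ⟶ l) z w, R n k z w → R n l (z.simpl φ) (w.simpl φ)) :
    Seq.{u} where
  obj n :=
    { obj := fun k => PQuot (R n.n k) TGen.IsBase
      map := fun φ => PQuot.map (TGen.simpl φ) (hsimpl φ) (fun _ h => h.simpl φ)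
      map_id := fun k => PQuot.hom_ext fun z => by
        rw [PQuot.map_mk]
        simp only [TGen.simpl, simpl_id]; rfl
      map_comp := fun φ ψ => PQuot.hom_ext fun z => by
        rw [PQuot.map_mk]
        simp only [TGen.simpl, ← simpl_simpl]; rfl }
  map e :=
    { app := fun k => PQuot.map (TGen.perm (Sig.eqv e)) (hperm (Sig.eqv e)) (fun _ h => h)
      naturality := fun _ _ _ => PQuot.hom_ext fun _ => rfl }
  map_id _ := NatTrans.ext (funext fun _ => PQuot.hom_ext fun _ => rfl)
  map_comp _ _ := NatTrans.ext (funext fun _ => PQuot.hom_ext fun _ => rfl)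

lemma TRel.perm {A B : Seq.{u}} {n m k} (f : Fin n ≃ Fin m) (z w) (h : TRel A B n k z w) :
    TRel A B m k (z.perm f) (w.perm f) := by
  obtain ⟨α, β, e, x, y⟩ := h
  exact .equivar α β (e.trans f) x y

lemma TRel.simpl {A B : Seq.{u}} {n k l} (φ : k ⟶ l) (z w) (h : TRel A B n k z w) :
    TRel A B n l (z.simpl φ) (w.simpl φ) := by
  obtain ⟨α, β, e, x, y⟩ := h
  simp only [TGen.simpl, simpl_perm]
  exact .equivar α β e _ _

lemma TRel.map {A B A' B' : Seq.{u}} {n k} (f : A ⟶ A') (g : B ⟶ B') (z w)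
    (h : TRel A B n k z w) : TRel A' B' n k (z.map f g) (w.map f g) := by
  obtain ⟨α, β, e, x, y⟩ := h
  simp only [TGen.map, ap_perm]
  exact .equivar α β e _ _

/-- The tensor product of symmetric sequences: the left Kan extension of the objectwise smash
product along the disjoint union of finite sets. Thus `(A ⊗ B)_n` is the quotient of the wedge of
the `A_a ∧ B_b` over all bijections `Fin a ⊕ Fin b ≃ Fin n` by the actions of `Σ_a × Σ_b`. -/
def tensor (A B : Seq.{u}) : Seq.{u} := quotSeq (TRel A B) TRel.perm TRel.simpl

/-- The class of a generator. -/
def tensorMk {A B : Seq.{u}} {n : ℕ} {k : SimplexCategoryᵒᵖ} (z : TGen A B n k) :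
    El (tensor A B) n k := PQuot.mk (TRel A B n k) TGen.IsBase z

lemma tensor_ind {A B : Seq.{u}} {n k} {P : El (tensor A B) n k → Prop} (h0 : P (pt _ n k))
    (h : ∀ z, P (tensorMk z)) (z : El (tensor A B) n k) : P z :=
  PQuot.ind h0 h z

/-- Adding `p` points in front: `Fin (a + p) ⊕ Fin b ≃ Fin (n + p)`. -/
def shiftLeft (p : ℕ) {a b n : ℕ} (e : Fin a ⊕ Fin b ≃ Fin n) :
    Fin (a + p) ⊕ Fin b ≃ Fin (n + p) :=
  (Equiv.sumCongr (block p a).symm (Equiv.refl (Fin b))).trans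
    ((Equiv.sumAssoc (Fin p) (Fin a) (Fin b)).trans
      ((Equiv.sumCongr (Equiv.refl (Fin p)) e).trans (block p n)))

lemma shiftLeft_equivar (p : ℕ) {a a' b b' n n' : ℕ} (γ : Fin p ≃ Fin p) (α : Fin a ≃ Fin a')
    (β : Fin b ≃ Fin b') (e : Fin a' ⊕ Fin b' ≃ Fin n) (f : Fin n ≃ Fin n') :
    (Equiv.sumCongr (blockSum γ α) β).trans (shiftLeft p (e.trans f)) =
      (shiftLeft p ((Equiv.sumCongr α β).trans e)).trans (blockSum γ f) := by
  ext i
  congr 1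
  obtain i | i := i
  · obtain ⟨j | j, rfl⟩ := (block p a).surjective i <;> simp [shiftLeft, blockSum]
  · simp [shiftLeft, blockSum]

lemma blockSum_refl (p n : ℕ) : blockSum (Equiv.refl (Fin p)) (Equiv.refl (Fin n)) =
    Equiv.refl _ := by
  simp [blockSum]

lemma block_zero (n : ℕ) (i : Fin n) : block 0 n (Sum.inr i) = i := by
  ext; simp [block]

lemma shiftLeft_inl_inl (p : ℕ) {a b n : ℕ} (e : Fin a ⊕ Fin b ≃ Fin n) (j : Fin p) :
    shiftLeft p e (Sum.inl (block p a (Sum.inl j))) = block p n (Sum.inl j) := by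
  simp [shiftLeft]

lemma shiftLeft_inl_inr (p : ℕ) {a b n : ℕ} (e : Fin a ⊕ Fin b ≃ Fin n) (j : Fin a) :
    shiftLeft p e (Sum.inl (block p a (Sum.inr j))) = block p n (Sum.inr (e (Sum.inl j))) := by
  simp [shiftLeft]

lemma shiftLeft_inr (p : ℕ) {a b n : ℕ} (e : Fin a ⊕ Fin b ≃ Fin n) (i : Fin b) :
    shiftLeft p e (Sum.inr i) = block p n (Sum.inr (e (Sum.inr i))) := by
  simp [shiftLeft]

lemma shiftLeft_zero {a b n : ℕ} (e : Fin a ⊕ Fin b ≃ Fin n) : shiftLeft 0 e = e := by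
  refine Equiv.ext fun i => ?_
  obtain i | i := i
  · have := shiftLeft_inl_inr 0 e i
    rwa [block_zero, block_zero] at this
  · rw [shiftLeft_inr, block_zero]

lemma block_succ_inl_zero (p n : ℕ) : block (p + 1) n (Sum.inl 0) = 0 := rfl

lemma block_succ_inl_succ (p n : ℕ) (j : Fin p) :
    block (p + 1) n (Sum.inl j.succ) = (block p n (Sum.inl j)).succ := by
  ext; simp [block]

lemma block_succ_inr (p n : ℕ) (j : Fin n) :
    block (p + 1) n (Sum.inr j) = (block p n (Sum.inr j)).succ := by
  ext; simp [block]; omega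

lemma block_one_inr (n : ℕ) (j : Fin n) : block 1 n (Sum.inr j) = j.succ := by
  rw [block_succ_inr, block_zero]

lemma shiftLeft_one_inl_zero {a b n : ℕ} (e : Fin a ⊕ Fin b ≃ Fin n) :
    shiftLeft 1 e (Sum.inl 0) = 0 :=
  shiftLeft_inl_inl 1 e 0

lemma shiftLeft_one_inl_succ {a b n : ℕ} (e : Fin a ⊕ Fin b ≃ Fin n) (i : Fin a) :
    shiftLeft 1 e (Sum.inl i.succ) = (e (Sum.inl i)).succ := by
  have := shiftLeft_inl_inr 1 e i
  rwa [block_one_inr, block_one_inr] at this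

lemma shiftLeft_succ (p : ℕ) {a b n : ℕ} (e : Fin a ⊕ Fin b ≃ Fin n) :
    shiftLeft (p + 1) e = shiftLeft 1 (shiftLeft p e) := by
  refine Equiv.ext fun i => ?_
  obtain i | i := i
  · obtain ⟨j | j, rfl⟩ := (block (p + 1) a).surjective i
    · refine (shiftLeft_inl_inl (p + 1) e j).trans ?_
      induction j using Fin.cases with
      | zero => exact (shiftLeft_one_inl_zero (shiftLeft p e)).symm
      | succ j =>
        rw [block_succ_inl_succ, block_succ_inl_succ]
        refine Eq.trans ?_ (shiftLeft_one_inl_succ (shiftLeft p e) _).symm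
        rw [shiftLeft_inl_inl]
    · refine (shiftLeft_inl_inr (p + 1) e j).trans ?_
      rw [block_succ_inr, block_succ_inr]
      refine Eq.trans ?_ (shiftLeft_one_inl_succ (shiftLeft p e) _).symm
      rw [shiftLeft_inl_inr]
  · rw [shiftLeft_inr, block_succ_inr]
    refine Eq.trans ?_ (shiftLeft_inr 1 (shiftLeft p e) i).symm
    rw [shiftLeft_inr, block_one_inr]

/-- The structure maps of `X ⊗ A`, for a symmetric spectrum `X` and a symmetric sequence `A`, on
generators. -/
def tensorGenσ (X : SymSpec.{u}) {A : Seq.{u}} {n : ℕ} {k : SimplexCategoryᵒᵖ} (t : Circ.{u} k)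
    (z : TGen X.seq A n k) : TGen X.seq A (n + 1) k :=
  ⟨z.a + 1, z.b, shiftLeft 1 z.e, X.σ z.a k t z.x, z.y⟩

lemma tensorGenσ_rel (X : SymSpec.{u}) {A : Seq.{u}} {n : ℕ} {k : SimplexCategoryᵒᵖ}
    (t : Circ.{u} k) (z w : TGen X.seq A n k) (h : TRel X.seq A n k z w) :
    TRel X.seq A (n + 1) k (tensorGenσ X t z) (tensorGenσ X t w) := by
  obtain ⟨α, β, e, x, y⟩ := h
  have h1 : perm X.seq (blockSum (Equiv.refl (Fin 1)) α) (X.σ _ k t x) =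
      X.σ _ k t (perm X.seq α x) :=
    X.it_perm (Equiv.refl (Fin 1)) α (fun _ => t) x
  have h2 := shiftLeft_equivar 1 (Equiv.refl (Fin 1)) α β e (Equiv.refl _)
  rw [blockSum_refl] at h2
  have := TRel.equivar (blockSum (Equiv.refl (Fin 1)) α) β (shiftLeft 1 e) (X.σ _ k t x) y
  rw [h1] at this
  change TRel X.seq A (n + 1) k ⟨_, _, _, _, _⟩ ⟨_, _, _, _, _⟩
  convert this using 2
  exact h2.symm

lemma tensorGenσ_base (X : SymSpec.{u}) {A : Seq.{u}} {n : ℕ} {k : SimplexCategoryᵒᵖ}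
    (t : Circ.{u} k) (z : TGen X.seq A n k) (h : z.IsBase) : (tensorGenσ X t z).IsBase := by
  rcases h with h | h
  · exact Or.inl ((congrArg (X.σ z.a k t) h).trans (X.σ_pt_right t))
  · exact Or.inr h

/-- The structure maps of `X ⊗ A`. -/
def tensorσ (X : SymSpec.{u}) (A : Seq.{u}) (n : ℕ) (k : SimplexCategoryᵒᵖ) (t : Circ.{u} k)
    (z : El (tensor X.seq A) n k) : El (tensor X.seq A) (n + 1) k :=
  (PQuot.map (tensorGenσ X t) (tensorGenσ_rel X t) (tensorGenσ_base X t) :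
    PQuot (TRel X.seq A n k) TGen.IsBase ⟶ PQuot (TRel X.seq A (n + 1) k) TGen.IsBase).toFun z

lemma iter_tensor_pt (X : SymSpec.{u}) (A : Seq.{u}) {n k p} (t : Fin p → Circ.{u} k) :
    iter (tensorσ X A) p t (pt _ n k) = pt _ (n + p) k := by
  induction p with
  | zero => rfl
  | succ p ih => rw [iter, ih]; rfl

lemma iter_tensor (X : SymSpec.{u}) (A : Seq.{u}) {n k p} (t : Fin p → Circ.{u} k)
    (z : TGen X.seq A n k) : iter (tensorσ X A) p t (tensorMk z) =
      tensorMk ⟨z.a + p, z.b, shiftLeft p z.e, X.it p t z.x, z.y⟩ := by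
  induction p with
  | zero => rw [shiftLeft_zero]; rfl
  | succ p ih => rw [iter, ih, shiftLeft_succ]; rfl

/-- For a symmetric spectrum `X` and a symmetric sequence `A`, the tensor product `X ⊗ A` is a
symmetric spectrum, the sphere spectrum acting on `X`. -/
def tensorSpec (X : SymSpec.{u}) (A : Seq.{u}) : SymSpec.{u} where
  seq := tensor X.seq A
  σ := tensorσ X A
  σ_pt_left {n k} x := by
    induction x using tensor_ind with
    | h0 => rfl
    | h z => exact PQuot.sound_base (Or.inl (X.σ_pt_left z.x))
  σ_pt_right _ := rfl
  σ_simpl {n k l} φ t x := by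
    induction x using tensor_ind with
    | h0 => rfl
    | h z =>
      change tensorMk _ = tensorMk _
      congr 1
      simp only [tensorGenσ, TGen.simpl]
      congr 1
      exact X.σ_simpl φ t z.x
  σ_equivariant {p n k} α β t x := by
    induction x using tensor_ind with
    | h0 => rw [iter_tensor_pt, perm_pt, perm_pt, iter_tensor_pt]
    | h z =>
      rw [iter_tensor]
      change tensorMk _ = iter (tensorσ X A) p _ (tensorMk _)
      rw [iter_tensor]
      obtain ⟨a, b, e, x, y⟩ := z
      have h1 := X.it_perm α (Equiv.refl (Fin a)) t x
      rw [perm_refl] at h1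
      have h2 := shiftLeft_equivar p α (Equiv.refl (Fin a)) (Equiv.refl (Fin b)) e β
      rw [Equiv.sumCongr_refl, Equiv.refl_trans] at h2
      have h3 := TRel.equivar (A := X.seq) (B := A) (blockSum α (Equiv.refl (Fin a)))
        (Equiv.refl (Fin b)) (shiftLeft p (e.trans β)) (X.it p t x) y
      rw [h1, h2, perm_refl] at h3
      exact PQuot.sound h3

/-- The functor `X ⊗ -`. -/
def tensorSpecFunctor (X : SymSpec.{u}) : Seq.{u} ⥤ SymSpec.{u} where
  obj A := tensorSpec X A
  map {A B} g :=
    { hom :=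
        { app := fun n =>
            { app := fun k => (PQuot.map (TGen.map (𝟙 X.seq) g) (TRel.map (𝟙 X.seq) g)
                (fun _ h => h.map (𝟙 X.seq) g) :
                PQuot (TRel X.seq A n.n k) TGen.IsBase ⟶ PQuot (TRel X.seq B n.n k) TGen.IsBase)
              naturality := fun _ _ φ => PQuot.hom_ext fun z => by
                change tensorMk _ = tensorMk _
                simp only [TGen.map, TGen.simpl, ap_simpl] }
          naturality := fun _ _ _ => NatTrans.ext (funext fun _ => PQuot.hom_ext fun _ => rfl) }
      comm := fun t x => by
        induction x using tensor_ind with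
        | h0 => rfl
        | h z => rfl }
  map_id _ := SymSpec.hom_ext (seqHom_ext fun _ _ x => by
    induction x using tensor_ind <;> rfl)
  map_comp _ _ := SymSpec.hom_ext (seqHom_ext fun _ _ x => by
    induction x using tensor_ind <;> rfl)

/-- The free symmetric spectrum functor `S ⊗ -`. -/
abbrev free : Seq.{u} ⥤ SymSpec.{u} := tensorSpecFunctor sphere

/-! ### The functors `G^H_m` -/

/-- The relation on pairs `(g, x)` that divides out the action of `H` on `Σ_m`. -/
def orbitRel {m n : ℕ} (H : Subgroup (Equiv.Perm (Fin m))) {K : Type u}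
    (z w : (Fin m ≃ Fin n) × K) : Prop :=
  ∃ h ∈ H, z.1 = Equiv.trans h w.1 ∧ z.2 = w.2

/-- For a subgroup `H` of `Σ_m`, the functor `K ↦ Σ_m ·_H K = Σ_m/H · K` from pointed simplicial
sets (with trivial `H`-action) to symmetric sequences concentrated at `m`. -/
def orbitSeq (m : ℕ) (H : Subgroup (Equiv.Perm (Fin m))) : PSSet.{u} ⥤ Seq.{u} where
  obj K :=
    { obj := fun n =>
        { obj := fun k => PQuot (Z := (Fin m ≃ Fin n.n) × (K.obj k : Pointed)) (orbitRel H)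
            (fun z => z.2 = (K.obj k).point)
          map := fun φ => PQuot.map (fun z => (z.1, (K.map φ).toFun z.2))
            (fun _ _ ⟨h, hH, h1, h2⟩ => ⟨h, hH, h1, congrArg (K.map φ).toFun h2⟩)
            (fun _ h => (congrArg (K.map φ).toFun h).trans (K.map φ).map_point)
          map_id := fun k => PQuot.hom_ext fun t => by
            simp only [PQuot.map_mk, K.map_id]; rfl
          map_comp := fun φ ψ => PQuot.hom_ext fun t => by
            simp only [PQuot.map_mk, K.map_comp]; rfl }
      map := fun e =>
        { app := fun k => PQuot.map (fun z => (z.1.trans (Sig.eqv e), z.2))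
            (fun _ _ ⟨h, hH, h1, h2⟩ => ⟨h, hH, by simp only [h1, Equiv.trans_assoc], h2⟩)
            (fun _ h => h)
          naturality := fun _ _ _ => PQuot.hom_ext fun _ => rfl }
      map_id := fun _ => NatTrans.ext (funext fun _ => PQuot.hom_ext fun _ => rfl)
      map_comp := fun _ _ => NatTrans.ext (funext fun _ => PQuot.hom_ext fun _ => rfl) }
  map {K L} g :=
    { app := fun n =>
        { app := fun k => PQuot.map (fun z => (z.1, (g.app k).toFun z.2))
            (fun _ _ ⟨h, hH, h1, h2⟩ => ⟨h, hH, h1, congrArg (g.app k).toFun h2⟩)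
            (fun _ h => (congrArg (g.app k).toFun h).trans (g.app k).map_point)
          naturality := fun _ _ φ => PQuot.hom_ext fun z => by
            change PQuot.mk _ _ _ = PQuot.mk _ _ _
            congr 1
            exact Prod.ext rfl (congrFun (congrArg Pointed.Hom.toFun (g.naturality φ)) z.2) }
      naturality := fun _ _ _ => NatTrans.ext (funext fun _ => PQuot.hom_ext fun _ => rfl) }
  map_id _ := NatTrans.ext (funext fun _ => NatTrans.ext (funext fun _ =>
    PQuot.hom_ext fun _ => rfl))
  map_comp _ _ := NatTrans.ext (funext fun _ => NatTrans.ext (funext fun _ =>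
    PQuot.hom_ext fun _ => rfl))

/-! ### The smash product of symmetric spectra -/

/-- The reindexing of `(x · s, y)` in degree `n`, for `s` in degree `c`. -/
def balLeft {a b c n : ℕ} (e : Fin c ⊕ (Fin a ⊕ Fin b) ≃ Fin n) : Fin (a + c) ⊕ Fin b ≃ Fin n :=
  (Equiv.sumCongr (block c a).symm (Equiv.refl (Fin b))).trans
    ((Equiv.sumAssoc (Fin c) (Fin a) (Fin b)).trans e)

/-- The reindexing of `(x, s · y)` in degree `n`, for `s` in degree `c`. -/
def balRight {a b c n : ℕ} (e : Fin c ⊕ (Fin a ⊕ Fin b) ≃ Fin n) : Fin a ⊕ Fin (b + c) ≃ Fin n :=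
  (Equiv.sumCongr (Equiv.refl (Fin a)) (block c b).symm).trans
    ((Equiv.sumAssoc (Fin a) (Fin c) (Fin b)).symm.trans
      ((Equiv.sumCongr (Equiv.sumComm (Fin a) (Fin c)) (Equiv.refl (Fin b))).trans
        ((Equiv.sumAssoc (Fin c) (Fin a) (Fin b)).trans e)))

/-- The relation on generators of `X ∧ Y = X ⊗_S Y`: besides the relation that defines `X ⊗ Y`, it
identifies `(x · s, y)` with `(x, s · y)`, for a simplex `s = s 0 ∧ ⋯ ∧ s (c-1)` of the sphere
`S^c`. The right action of `S` on `X` is the left action, precomposed with the symmetry. -/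
inductive SRel (X Y : SymSpec.{u}) (n : ℕ) (k : SimplexCategoryᵒᵖ) :
    TGen X.seq Y.seq n k → TGen X.seq Y.seq n k → Prop
  | tens (z w : TGen X.seq Y.seq n k) (h : TRel X.seq Y.seq n k z w) : SRel X Y n k z w
  | bal {a b c : ℕ} (e : Fin c ⊕ (Fin a ⊕ Fin b) ≃ Fin n) (s : Fin c → Circ.{u} k)
      (x : El X.seq a k) (y : El Y.seq b k) :
      SRel X Y n k ⟨a + c, b, balLeft e, X.it c s x, y⟩ ⟨a, b + c, balRight e, x, Y.it c s y⟩

lemma SRel.perm {X Y : SymSpec.{u}} {n m k} (f : Fin n ≃ Fin m) (z w) (h : SRel X Y n k z w) :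
    SRel X Y m k (z.perm f) (w.perm f) := by
  cases h with
  | tens _ _ h => exact .tens _ _ (h.perm f)
  | bal e s x y => exact .bal (e.trans f) s x y

lemma SRel.simpl {X Y : SymSpec.{u}} {n k l} (φ : k ⟶ l) (z w) (h : SRel X Y n k z w) :
    SRel X Y n l (z.simpl φ) (w.simpl φ) := by
  cases h with
  | tens _ _ h => exact .tens _ _ (h.simpl φ)
  | bal e s x y =>
    simp only [TGen.simpl, SymSpec.it_simpl]
    exact .bal e _ _ _

lemma SRel.map {X Y X' Y' : SymSpec.{u}} {n k} (f : X ⟶ X') (g : Y ⟶ Y') (z w)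
    (h : SRel X Y n k z w) : SRel X' Y' n k (z.map f.hom g.hom) (w.map f.hom g.hom) := by
  cases h with
  | tens _ _ h => exact .tens _ _ (h.map f.hom g.hom)
  | bal e s x y =>
    simp only [TGen.map, SymSpec.ap_it]
    exact .bal e _ _ _

/-- The symmetric sequence underlying the smash product `X ∧ Y = X ⊗_S Y` of symmetric spectra. -/
def smash (X Y : SymSpec.{u}) : Seq.{u} := quotSeq (SRel X Y) SRel.perm SRel.simpl

/-- The class of a generator. -/
def smashMk {X Y : SymSpec.{u}} {n : ℕ} {k : SimplexCategoryᵒᵖ} (z : TGen X.seq Y.seq n k) :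
    El (smash X Y) n k := PQuot.mk (SRel X Y n k) TGen.IsBase z

lemma smash_ind {X Y : SymSpec.{u}} {n k} {P : El (smash X Y) n k → Prop} (h0 : P (pt _ n k))
    (h : ∀ z, P (smashMk z)) (z : El (smash X Y) n k) : P z :=
  PQuot.ind h0 h z

/-- The smash product of maps of symmetric spectra. -/
def smashMap {X Y X' Y' : SymSpec.{u}} (f : X ⟶ X') (g : Y ⟶ Y') : smash X Y ⟶ smash X' Y' where
  app n :=
    { app := fun k => (PQuot.map (TGen.map f.hom g.hom) (SRel.map f g)
        (fun _ h => h.map f.hom g.hom) :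
        PQuot (SRel X Y n.n k) TGen.IsBase ⟶ PQuot (SRel X' Y' n.n k) TGen.IsBase)
      naturality := fun _ _ φ => PQuot.hom_ext fun z => by
        change smashMk _ = smashMk _
        simp only [TGen.map, TGen.simpl, ap_simpl] }
  naturality _ _ _ := NatTrans.ext (funext fun _ => PQuot.hom_ext fun _ => rfl)

/-- The functor `X ∧ -`. -/
def smashFunctor (X : SymSpec.{u}) : SymSpec.{u} ⥤ Seq.{u} where
  obj Y := smash X Y
  map g := smashMap (𝟙 X) g
  map_id _ := seqHom_ext fun _ _ x => by induction x using smash_ind <;> rfl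
  map_comp _ _ := seqHom_ext fun _ _ x => by induction x using smash_ind <;> rfl

/-- The left action `S^a ∧ X_b ⟶ X_{b+a}` of the sphere spectrum on a symmetric spectrum. -/
def sphereAct (X : SymSpec.{u}) {a b : ℕ} {k : SimplexCategoryᵒᵖ} (z : El sphereSeq.{u} a k)
    (x : El X.seq b k) : El X.seq (b + a) k :=
  (PQuot.desc (P := (X.seq.obj ⟨b + a⟩).obj k) (fun t => X.it a t x)
    (fun _ _ h => h.elim) (fun t h => X.it_pt_left t x h) :
    sphereLvl a k ⟶ (X.seq.obj ⟨b + a⟩).obj k).toFun z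

lemma sphereAct_mk (X : SymSpec.{u}) {a b k} (t : Fin a → Circ.{u} k) (x : El X.seq b k) :
    sphereAct X (sphereMk t) x = X.it a t x := rfl

lemma sphereAct_pt (X : SymSpec.{u}) {a b k} (x : El X.seq b k) :
    sphereAct X (pt sphereSeq a k) x = pt X.seq (b + a) k := rfl

/-- The canonical map `S ∧ X ⟶ X` on generators: the action of the sphere spectrum. -/
def unitGen (X : SymSpec.{u}) {n : ℕ} {k : SimplexCategoryᵒᵖ}
    (z : TGen sphere.{u}.seq X.seq n k) : El X.seq n k :=
  perm X.seq ((block z.a z.b).symm.trans z.e) (sphereAct X z.x z.y)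

lemma unitGen_base (X : SymSpec.{u}) {n k} (z : TGen sphere.{u}.seq X.seq n k) (h : z.IsBase) :
    unitGen X z = pt X.seq n k := by
  obtain ⟨a, b, e, x, y⟩ := z
  have h' : sphereAct X x y = pt X.seq (b + a) k := by
    rcases h with h | h
    · obtain rfl : x = pt _ a k := h
      rfl
    · obtain rfl : y = pt _ b k := h
      induction x using sphere_ind with
      | h0 => rfl
      | h t => exact X.it_pt_right t
  simp only [unitGen]
  rw [h', perm_pt]

lemma block_assoc_inl_inl {a b c : ℕ} (h : b + (c + a) = b + c + a) (j : Fin a) :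
    finCongr h (block (c + a) b (Sum.inl (block a c (Sum.inl j)))) =
      block a (b + c) (Sum.inl j) := by
  ext; simp [block]

lemma block_assoc_inl_inr {a b c : ℕ} (h : b + (c + a) = b + c + a) (j : Fin c) :
    finCongr h (block (c + a) b (Sum.inl (block a c (Sum.inr j)))) =
      block a (b + c) (Sum.inr (block c b (Sum.inl j))) := by
  ext; simp [block]

lemma block_assoc_inr {a b c : ℕ} (h : b + (c + a) = b + c + a) (j : Fin b) :
    finCongr h (block (c + a) b (Sum.inr j)) =
      block a (b + c) (Sum.inr (block c b (Sum.inr j))) := by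
  ext; simp [block]; omega

/-- The transposition of two blocks. -/
def blockSwap (c a : ℕ) : Fin (a + c) ≃ Fin (c + a) :=
  (block c a).symm.trans ((Equiv.sumComm _ _).trans (block a c))

lemma append_blockSwap {T : Type u} {a c : ℕ} (s : Fin c → T) (t : Fin a → T) :
    (fun i => SymSpec.append s t ((blockSwap c a).symm i)) = SymSpec.append t s := by
  funext i
  obtain ⟨j | j, rfl⟩ := (block a c).surjective i <;> simp [SymSpec.append, blockSwap]

lemma bal_reindex {a b c n : ℕ} (e : Fin c ⊕ (Fin a ⊕ Fin b) ≃ Fin n) :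
    (blockSum (blockSwap c a) (Equiv.refl (Fin b))).trans
      ((finCongr (Nat.add_assoc b c a).symm).trans
        ((block a (b + c)).symm.trans (balRight e))) =
      (block (a + c) b).symm.trans (balLeft e) := by
  refine Equiv.ext fun i => ?_
  obtain ⟨i | i, rfl⟩ := (block (a + c) b).surjective i
  · obtain ⟨j | j, rfl⟩ := (block c a).surjective i
    · have h : blockSum (blockSwap c a) (Equiv.refl (Fin b))
          (block (a + c) b (Sum.inl (block c a (Sum.inl j)))) =
          block (c + a) b (Sum.inl (block a c (Sum.inr j))) := by simp [blockSum, blockSwap]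
      rw [Equiv.trans_apply, h, Equiv.trans_apply, block_assoc_inl_inr]
      simp [balLeft, balRight]
    · have h : blockSum (blockSwap c a) (Equiv.refl (Fin b))
          (block (a + c) b (Sum.inl (block c a (Sum.inr j)))) =
          block (c + a) b (Sum.inl (block a c (Sum.inl j))) := by simp [blockSum, blockSwap]
      rw [Equiv.trans_apply, h, Equiv.trans_apply, block_assoc_inl_inl]
      simp [balLeft, balRight]
  · have h : blockSum (blockSwap c a) (Equiv.refl (Fin b)) (block (a + c) b (Sum.inr i)) =
        block (c + a) b (Sum.inr i) := by simp [blockSum]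
    rw [Equiv.trans_apply, h, Equiv.trans_apply, block_assoc_inr]
    simp [balLeft, balRight]

lemma unitGen_rel (X : SymSpec.{u}) {n k} (z w) (h : SRel sphere X n k z w) :
    unitGen X z = unitGen X w := by
  cases h with
  | tens _ _ h =>
    obtain ⟨α, β, e, x, y⟩ := h
    induction x using sphere_ind with
    | h0 => rw [unitGen_base _ _ (Or.inl rfl), unitGen_base _ _ (Or.inl (perm_pt (A := sphereSeq) α))]
    | h t =>
      have h1 := X.it_perm α β t y
      change perm X.seq _ (X.it _ t y) = perm X.seq _ (X.it _ (fun i => t (α.symm i)) _)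
      rw [← h1, perm_perm]
      congr 1
      refine Equiv.ext fun i => ?_
      simp [blockSum]
  | bal e s x y =>
    rename_i a b c
    induction x using sphere_ind with
    | h0 => rw [unitGen_base _ _ (Or.inl (sphere.it_pt_right s)), unitGen_base _ _ (Or.inl rfl)]
    | h t =>
      have h1 : sphere.it c s (sphereMk t) = sphereMk (SymSpec.append s t) := iter_sphere s t
      rw [h1]
      change perm X.seq _ (X.it (a + c) _ y) = perm X.seq _ (X.it a t (X.it c s y))
      rw [← SymSpec.it_append, perm_perm]
      have h2 := X.it_perm (blockSwap c a) (Equiv.refl (Fin b)) (SymSpec.append s t) y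
      rw [append_blockSwap, perm_refl] at h2
      rw [← h2, perm_perm, bal_reindex]

lemma sphereAct_simpl (X : SymSpec.{u}) {a b k l} (φ : k ⟶ l) (z : El sphereSeq.{u} a k)
    (x : El X.seq b k) :
    simpl X.seq φ (sphereAct X z x) = sphereAct X (simpl sphereSeq φ z) (simpl X.seq φ x) := by
  induction z using sphere_ind with
  | h0 => rw [simpl_pt, sphereAct_pt, sphereAct_pt, simpl_pt]
  | h t => exact X.it_simpl φ t x

lemma ap_sphereAct {X Y : SymSpec.{u}} (f : X ⟶ Y) {a b k} (z : El sphereSeq.{u} a k)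
    (x : El X.seq b k) : ap f.hom (sphereAct X z x) = sphereAct Y z (ap f.hom x) := by
  induction z using sphere_ind with
  | h0 => rw [sphereAct_pt, sphereAct_pt, ap_pt]
  | h t => exact SymSpec.ap_it f t x

/-- The canonical isomorphism `S ∧ X ⟶ X`. -/
def unitMap (X : SymSpec.{u}) : smash sphere X ⟶ X.seq where
  app n :=
    { app := fun k => (PQuot.desc (unitGen X) (unitGen_rel X) (unitGen_base X) :
        PQuot (SRel sphere X n.n k) TGen.IsBase ⟶ (X.seq.obj n).obj k)
      naturality := fun _ _ φ => PQuot.hom_ext fun z => by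
        change unitGen X (z.simpl φ) = simpl X.seq φ (unitGen X z)
        exact ((simpl_perm _ φ _).trans
          (congrArg (perm X.seq _) (sphereAct_simpl X φ z.x z.y))).symm }
  naturality m n e := NatTrans.ext (funext fun _ => PQuot.hom_ext fun z => by
    change unitGen X (z.perm (Sig.eqv e)) = perm X.seq (Sig.eqv e) (unitGen X z)
    rw [unitGen, unitGen, perm_perm]; rfl)

/-- The natural map `S̄ ∧ X ⟶ S ∧ X ≅ X` induced by the inclusion of the truncated sphere
spectrum. -/
def latch : smashFunctor sphereBar.{u} ⟶ SymSpec.forget.{u} where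
  app X := smashMap sphereBarι (𝟙 X) ≫ unitMap X
  naturality X Y f := seqHom_ext fun n k x => by
    induction x using smash_ind with
    | h0 => exact (ap_pt _).trans (ap_pt _).symm
    | h z =>
      change unitGen Y (TGen.map _ _ (TGen.map _ _ z)) = ap f.hom (unitGen X (TGen.map _ _ z))
      exact ((ap_perm f.hom _ _).trans
        (congrArg (perm Y.seq _) (ap_sphereAct f (ap sphereBarι.hom z.x) z.y))).symm

/-! ### Symmetric sequences of symmetric spectra, with an action of a group -/

/-- Symmetric sequences in symmetric spectra: functors from the opposite of the category of finite
sets and bijections to symmetric spectra. -/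
abbrev SymSeq : Type (u + 1) := Sigᵒᵖ ⥤ SymSpec.{u}

/-- Symmetric sequences in symmetric spectra with an action of `G`. -/
abbrev SymSeqG (G : Type v) [Group G] : Type (max v (u + 1)) := SingleObj G ⥤ SymSeq.{u}

/-- The group `Σ_r^op × G`, as a category with one object. -/
abbrev Shape (r : ℕ) (G : Type v) [Group G] : Type :=
  (SingleObj (Equiv.Perm (Fin r)))ᵒᵖ × SingleObj G

/-- `X ↦ X[r]`, as a symmetric spectrum with an action of `Σ_r^op × G`. -/
def evalAt (G : Type v) [Group G] (r : ℕ) : SymSeqG.{u} G ⥤ (Shape r G ⥤ SymSpec.{u}) :=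
  flipFunctor _ _ _ ⋙ Functor.uncurry ⋙
    (Functor.whiskeringLeft _ _ _).obj ((incl r).op.prod (𝟭 (SingleObj G)))

/-- Pointed simplicial sets with commuting actions of `Σ_n` and of `Σ_r^op × G`. -/
abbrev MixedDiag (G : Type v) [Group G] (r n : ℕ) : Type (max v (u + 1)) :=
  Shape r G ⥤ PermPSSet.{u} n

/-- `X ↦ X[r]_n`. -/
abbrev level (G : Type v) [Group G] (r n : ℕ) : SymSeqG.{u} G ⥤ MixedDiag.{u} G r n :=
  evalAt G r ⋙ (Functor.whiskeringRight _ _ _).obj (SymSpec.forget ⋙ ev n)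

/-- `X ↦ (S̄ ∧ X[r])_n`. -/
abbrev latching (G : Type v) [Group G] (r n : ℕ) : SymSeqG.{u} G ⥤ MixedDiag.{u} G r n :=
  evalAt G r ⋙ (Functor.whiskeringRight _ _ _).obj (smashFunctor sphereBar ⋙ ev n)

/-- The natural map `(S̄ ∧ X[r])_n ⟶ X[r]_n`. -/
abbrev latchingToLevel (G : Type v) [Group G] (r n : ℕ) :
    latching.{u} G r n ⟶ level.{u} G r n :=
  Functor.whiskerLeft (evalAt G r) ((Functor.whiskeringRight _ _ _).map
    (Functor.whiskerRight latch (ev n)))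

/-- The induced map `(S̄ ∧ Y[r])_n ⨿_{(S̄ ∧ X[r])_n} X[r]_n ⟶ Y[r]_n` from the pushout. -/
noncomputable def latchingMap {G : Type v} [Group G] {X Y : SymSeqG.{u} G} (f : X ⟶ Y)
    (r n : ℕ) :
    pushout ((latching G r n).map f) ((latchingToLevel G r n).app X) ⟶ (level G r n).obj Y :=
  pushout.desc ((latchingToLevel G r n).app Y) ((level G r n).map f)
    ((latchingToLevel G r n).naturality f)

/-! ### Cofibrations -/

/-- The map `∂Δ[k]₊ ⟶ Δ[k]₊`. -/
abbrev boundaryIncl (k : ℕ) : plus.{u}.obj (SSet.boundary k) ⟶ plus.{u}.obj (simplex k) :=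
  plus.map (SSet.boundary k).ι

/-- The generating cofibrations `S ⊗ G^H_m ∂Δ[k]₊ ⟶ S ⊗ G^H_m Δ[k]₊` with `m ≥ m₀`. -/
inductive specGenerators (m₀ : ℕ) : MorphismProperty SymSpec.{u}
  | mk (m k : ℕ) (hm : m₀ ≤ m) (H : Subgroup (Equiv.Perm (Fin m))) :
      specGenerators m₀ (free.map ((orbitSeq m H).map (boundaryIncl k)))

/-- The maps `Σ_n/H · ∂Δ[k]₊ ⟶ Σ_n/H · Δ[k]₊` of pointed simplicial sets with `Σ_n`-action. -/
inductive mixedGenerators (n : ℕ) : MorphismProperty (PermPSSet.{u} n)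
  | mk (k : ℕ) (H : Subgroup (Equiv.Perm (Fin n))) :
      mixedGenerators n ((ev n).map ((orbitSeq n H).map (boundaryIncl k)))

/-- Retracts of (possibly transfinite) compositions of pushouts of maps in `W`. -/
abbrev cellular {C : Type (u + 1)} [Category.{u} C] (W : MorphismProperty C) :
    MorphismProperty C :=
  (MorphismProperty.transfiniteCompositions.{u} W.pushouts).retracts

/-- Given the class `cof` of cofibrations of a model category `C`, the cofibrations of the
projective model structure on diagrams of shape `J` in `C`: the maps with the left lifting property
with respect to the objectwise acyclic fibrations. Here the acyclic fibrations of `C` are the maps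
with the right lifting property with respect to the cofibrations. -/
abbrev projectiveCofibrations {C : Type (u + 1)} [Category.{u} C] (cof : MorphismProperty C)
    (J : Type*) [Category J] : MorphismProperty (J ⥤ C) :=
  (cof.rlp.functorCategory J).llp

/-- The cofibrations of the flat stable (`m₀ = 0`) and of the positive flat stable (`m₀ = 1`) model
structure on symmetric spectra. -/
abbrev specCofibrations (m₀ : ℕ) : MorphismProperty SymSpec.{u} := cellular (specGenerators m₀)

/-- The cofibrations of the flat stable (`m₀ = 0`) and of the positive flat stable (`m₀ = 1`) model
structure on symmetric sequences with `G`-action, whose acyclic fibrations are those maps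
`f` for which all `f[r]` are acyclic fibrations of symmetric spectra. -/
def flatCofibrations (m₀ : ℕ) (G : Type v) [Group G] : MorphismProperty (SymSeqG.{u} G) :=
  (((specCofibrations m₀).rlp.functorCategory Sigᵒᵖ).functorCategory (SingleObj G)).llp

/-- Cofibrations in `SymSeq^G` with the flat stable model structure. -/
abbrev flatStableCofibrations (G : Type v) [Group G] : MorphismProperty (SymSeqG.{u} G) :=
  flatCofibrations 0 G

/-- Cofibrations in `SymSeq^G` with the positive flat stable model structure. -/
abbrev positiveFlatStableCofibrations (G : Type v) [Group G] : MorphismProperty (SymSeqG.{u} G) :=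
  flatCofibrations 1 G

/-- Cofibrations of pointed simplicial sets with actions of `Σ_n` and of `Σ_r^op × G`, in the
projective structure on `Σ_r^op × G`-diagrams coming from the mixed `Σ_n`-equivariant one. -/
def mixedCofibrations (G : Type v) [Group G] (r n : ℕ) : MorphismProperty (MixedDiag.{u} G r n) :=
  projectiveCofibrations (cellular (mixedGenerators n)) (Shape r G)

end FlatStable

namespace FlatStable

/-! ### Lifting properties -/

section lifting

variable {C : Type*} [Category C]

/-! Parts (a) and (b) are a Reedy argument in the spectrum degree, phrased entirely with lifting
properties. The relative latching map in degree n has the left lifting property against `p : A ⟶ B`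
exactly when the problem `LatchLift` is solvable: given compatible maps out of `X_n`, out of `(S̄ ∧
Y)_n` and from `Y_n` to `B`, find a map `Y_n ⟶ A`. On the other side, `S ⊗ -` is left adjoint to the
forgetful functor and the generators are free on sequences concentrated in one degree. So acyclic
fibrations of spectra are the maps whose terms in degrees at least `m₀` are acyclic fibrations
(`specCofibrations_rlp_iff`).

If f is a cofibration and a `LatchLift` problem is given, replace the n-th term of Y by `Y_n ×_B A`.
The map `(S̄ ∧ Y)_n ⟶ A` supplies the new structure maps into degree n; those out of it come from Y.
The projection to Y is a base change of p in degree n and an isomorphism elsewhere, hence an acyclic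
fibration. The cofibration f therefore admits a section of it under X, whose A-component solves the
problem (`latchLift_of_llp`). Conversely, `(S̄ ∧ Y)_n` involves only the terms `Y_m` with m < n. A
lift constructed below degree n thus induces a map out of `(S̄ ∧ Y)_n`, and `LatchLift` provides the
next term (`exists_lift_of_latchLift`).

All this works for diagrams over any index category. As bijections exist only between sets of equal
size, `llp_iff_evalAt` splits a lifting problem in `SymSeqG` into one for each r. In degree 0 the
latching object is trivial. In the positive case nothing is required of p there, so the map lifts
against everything, which means that it is an isomorphism.

For part (c) one test object suffices. Factor φ through the diagram of partial lifts: simplices of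
B, lifted to A over a subcomplex of the standard simplex, with labels in a free set Ω off that
subcomplex. Its projection to B lifts against all injections
(`partialLiftsProj_hasLiftingProperty`), so a projective cofibration φ admits a section under A.
Injectivity of φ is inherited from the inclusion of A, and freeness off the image comes from the
labels. -/

lemma exists_lift_of_hasLiftingProperty {A B X Y : C} {i : A ⟶ B} {p : X ⟶ Y}
    (h : HasLiftingProperty i p) (a : A ⟶ X) (b : B ⟶ Y) (sq : a ≫ p = i ≫ b) :
    ∃ l : B ⟶ X, i ≫ l = a ∧ l ≫ p = b := by
  have : CommSq a i p b := ⟨sq⟩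
  exact ⟨this.lift, this.fac_left, this.fac_right⟩

lemma hasLiftingProperty_of_exists_lift {A B X Y : C} {i : A ⟶ B} {p : X ⟶ Y}
    (h : ∀ (a : A ⟶ X) (b : B ⟶ Y), a ≫ p = i ≫ b → ∃ l : B ⟶ X, i ≫ l = a ∧ l ≫ p = b) :
    HasLiftingProperty i p where
  sq_hasLift {a b} sq := by
    obtain ⟨l, h1, h2⟩ := h a b sq.w
    exact ⟨⟨⟨l, h1, h2⟩⟩⟩

/-- A right lifting property passes to pushouts, transfinite compositions and retracts, so acyclic
fibrations may be tested on the generators alone. -/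
lemma cellular_rlp {C : Type (u + 1)} [Category.{u} C] (W : MorphismProperty C) :
    (cellular W).rlp = W.rlp := by
  have h : cellular W ≤ W.rlp.llp := by
    rw [MorphismProperty.le_llp_iff_le_rlp, MorphismProperty.rlp_retracts,
      ← MorphismProperty.le_llp_iff_le_rlp]
    refine (MorphismProperty.transfiniteCompositions_le_llp_rlp _).trans ?_
    rw [MorphismProperty.rlp_pushouts]
  refine le_antisymm (MorphismProperty.antitone_rlp ?_) ?_
  · refine le_trans ?_ (MorphismProperty.le_retracts _)
    refine le_trans ?_ (MorphismProperty.le_transfiniteCompositions _)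
    exact MorphismProperty.le_pushouts _
  · rwa [MorphismProperty.le_llp_iff_le_rlp] at h

end lifting

/-! ### Simplices of pointed simplicial sets with an action of a symmetric group -/

/-- The `k`-simplices of `A`. -/
abbrev PEl {n : ℕ} (A : PermPSSet.{u} n) (k : SimplexCategoryᵒᵖ) : Type u :=
  ((A.obj (SingleObj.star _)).obj k : Pointed)

section elements

variable {n : ℕ} {A B : PermPSSet.{u} n} {k l : SimplexCategoryᵒᵖ}

/-- The base point. -/
abbrev ppt (A : PermPSSet.{u} n) (k : SimplexCategoryᵒᵖ) : PEl A k :=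
  ((A.obj (SingleObj.star _)).obj k).point

/-- The action of a permutation on simplices. -/
def pact (A : PermPSSet.{u} n) (τ : Equiv.Perm (Fin n)) (x : PEl A k) : PEl A k :=
  ((A.map (X := SingleObj.star _) (Y := SingleObj.star _) τ).app k).toFun x

/-- The simplicial operators. -/
def psim (A : PermPSSet.{u} n) (φ : k ⟶ l) (x : PEl A k) : PEl A l :=
  ((A.obj (SingleObj.star _)).map φ).toFun x

/-- An equivariant map on simplices. -/
def pap (f : A ⟶ B) (x : PEl A k) : PEl B k := ((f.app (SingleObj.star _)).app k).toFun x

lemma pact_ppt (τ : Equiv.Perm (Fin n)) : pact A τ (ppt A k) = ppt A k :=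
  ((A.map (X := SingleObj.star _) (Y := SingleObj.star _) τ).app k).map_point

lemma psim_ppt (φ : k ⟶ l) : psim A φ (ppt A k) = ppt A l :=
  ((A.obj (SingleObj.star _)).map φ).map_point

lemma pap_ppt (f : A ⟶ B) : pap f (ppt A k) = ppt B k :=
  ((f.app (SingleObj.star _)).app k).map_point

lemma pact_refl (x : PEl A k) : pact A (Equiv.refl _) x = x := by
  change ((A.map (𝟙 (SingleObj.star _))).app k).toFun x = x
  rw [A.map_id]; rfl

lemma pact_pact (e e' : Equiv.Perm (Fin n)) (x : PEl A k) :
    pact A e' (pact A e x) = pact A (e.trans e') x := by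
  change _ = ((A.map ((show SingleObj.star _ ⟶ SingleObj.star _ from e) ≫
    (show SingleObj.star _ ⟶ SingleObj.star _ from e'))).app k).toFun x
  rw [A.map_comp]; rfl

lemma psim_id (x : PEl A k) : psim A (𝟙 k) x = x := by
  simp [psim]

lemma psim_psim {j : SimplexCategoryᵒᵖ} (φ : k ⟶ l) (ψ : l ⟶ j) (x : PEl A k) :
    psim A ψ (psim A φ x) = psim A (φ ≫ ψ) x := by
  simp [psim]

lemma psim_pact (e : Equiv.Perm (Fin n)) (φ : k ⟶ l) (x : PEl A k) :
    psim A φ (pact A e x) = pact A e (psim A φ x) :=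
  congrFun (congrArg Pointed.Hom.toFun
    ((A.map (X := SingleObj.star _) (Y := SingleObj.star _) e).naturality φ)) x |>.symm

lemma pap_pact (f : A ⟶ B) (e : Equiv.Perm (Fin n)) (x : PEl A k) :
    pap f (pact A e x) = pact B e (pap f x) :=
  congrFun (congrArg (fun g => Pointed.Hom.toFun (NatTrans.app g k))
    (f.naturality (X := SingleObj.star _) (Y := SingleObj.star _) e)) x

lemma pap_psim (f : A ⟶ B) (φ : k ⟶ l) (x : PEl A k) :
    pap f (psim A φ x) = psim B φ (pap f x) :=
  congrFun (congrArg Pointed.Hom.toFun ((f.app (SingleObj.star _)).naturality φ)) x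

lemma pap_comp {C : PermPSSet.{u} n} (f : A ⟶ B) (g : B ⟶ C) (x : PEl A k) :
    pap (f ≫ g) x = pap g (pap f x) := rfl

lemma permHom_ext {f g : A ⟶ B} (h : ∀ (k) (x : PEl A k), pap f x = pap g x) : f = g := by
  refine NatTrans.ext (funext fun s => NatTrans.ext (funext fun k => ?_))
  exact Pointed.Hom.ext (funext fun x => h k x)

/-- Equivariant maps from functions on simplices. -/
def permHomMk (f : ∀ k, PEl A k → PEl B k) (hpt : ∀ k, f k (ppt A k) = ppt B k)
    (hsim : ∀ {k l} (φ : k ⟶ l) (x : PEl A k), f l (psim A φ x) = psim B φ (f k x))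
    (hact : ∀ {k} (τ : Equiv.Perm (Fin n)) (x : PEl A k), f k (pact A τ x) = pact B τ (f k x)) :
    A ⟶ B where
  app _ :=
    { app := fun k => ⟨f k, hpt k⟩
      naturality := fun _ _ φ => Pointed.Hom.ext (funext fun x => hsim φ x) }
  naturality _ _ τ := NatTrans.ext (funext fun _ => Pointed.Hom.ext (funext fun x => hact τ x))

/-- The trivial map. -/
def permZero (A B : PermPSSet.{u} n) : A ⟶ B :=
  permHomMk (fun k _ => ppt B k) (fun _ => rfl) (fun φ _ => (psim_ppt φ).symm)
    (fun τ _ => (pact_ppt τ).symm)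

end elements

/-! ### Symmetric sequences concentrated in one degree -/

section seq

variable {A B : Seq.{u}}

/-- Maps of symmetric sequences from functions on simplices. -/
def seqHomMk (f : ∀ n k, El A n k → El B n k) (hpt : ∀ n k, f n k (pt A n k) = pt B n k)
    (hsim : ∀ {n k l} (φ : k ⟶ l) (x : El A n k), f n l (simpl A φ x) = simpl B φ (f n k x))
    (hact : ∀ {m n k} (e : Fin m ≃ Fin n) (x : El A m k),
      f n k (perm A e x) = perm B e (f m k x)) : A ⟶ B where
  app n :=
    { app := fun k => ⟨f n.n k, hpt n.n k⟩
      naturality := fun _ _ φ => Pointed.Hom.ext (funext fun x => hsim φ x) }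
  naturality _ _ e := NatTrans.ext (funext fun _ => Pointed.Hom.ext (funext fun x =>
    hact (Sig.eqv e) x))

/-- Maps of symmetric sequences from their terms. -/
def seqHomOfTerms (g : ∀ n, (ev n).obj A ⟶ (ev n).obj B) : A ⟶ B :=
  seqHomMk (fun n _ x => pap (g n) x) (fun n _ => pap_ppt (g n)) (fun φ x => pap_psim (g _) φ x)
    (fun {m n k} e x => by
      -- In the skeleton a bijection forces equal degrees, so equivariance under each symmetric
      -- group is all of naturality.
      obtain rfl : m = n := by simpa using Fintype.card_congr e
      exact pap_pact (g m) e x)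

@[simp] lemma ap_seqHomOfTerms (g : ∀ n, (ev n).obj A ⟶ (ev n).obj B) {n k} (x : El A n k) :
    ap (seqHomOfTerms g) x = pap (g n) x := rfl

lemma ev_map_seqHomOfTerms (g : ∀ n, (ev n).obj A ⟶ (ev n).obj B) (n : ℕ) :
    (ev n).map (seqHomOfTerms g) = g n := permHom_ext fun _ _ => rfl

lemma seqHom_ext_terms {f g : A ⟶ B} (h : ∀ n, (ev n).map f = (ev n).map g) : f = g :=
  seqHom_ext fun n k x =>
    congrArg (fun q : (ev n).obj A ⟶ (ev n).obj B => pap (k := k) q x) (h n)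

/-- The symmetric sequence `A` is trivial outside degree `m`. -/
def ConcentratedAt (m : ℕ) (A : Seq.{u}) : Prop :=
  ∀ (n : ℕ), n ≠ m → ∀ (k) (x : El A n k), x = pt A n k

lemma ConcentratedAt.hom_ext {m n : ℕ} (h : ConcentratedAt m A) (hn : n ≠ m)
    (f g : (ev n).obj A ⟶ (ev n).obj B) : f = g :=
  permHom_ext fun k x => by
    obtain rfl : x = ppt _ k := h n hn k x
    rw [pap_ppt, pap_ppt]

/-- Different degrees of a symmetric sequence do not interact. Outside degree m both source and
target are trivial, so squares and lifts are determined by their degree m part, and any such part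
extends by trivial maps. -/
lemma ConcentratedAt.hasLiftingProperty_iff {m : ℕ} {X Y : Seq.{u}} (hA : ConcentratedAt m A)
    (hB : ConcentratedAt m B) (i : A ⟶ B) (f : X ⟶ Y) :
    HasLiftingProperty i f ↔ HasLiftingProperty ((ev m).map i) ((ev m).map f) := by
  have ext {A X : Seq.{u}} (g : (ev m).obj A ⟶ (ev m).obj X) :
      ∃ g' : A ⟶ X, (ev m).map g' = g :=
    ⟨seqHomOfTerms (Function.update (fun n => permZero _ _) m g), by
      rw [ev_map_seqHomOfTerms, Function.update_self]⟩
  have ext' {A X : Seq.{u}} (hA : ConcentratedAt m A) {g g' : A ⟶ X}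
      (h : (ev m).map g = (ev m).map g') : g = g' := seqHom_ext_terms fun n => by
    by_cases hn : n = m
    · subst hn; exact h
    · exact hA.hom_ext hn _ _
  constructor
  · intro h
    refine hasLiftingProperty_of_exists_lift fun a b sq => ?_
    obtain ⟨a, rfl⟩ := ext a
    obtain ⟨b, rfl⟩ := ext b
    rw [← Functor.map_comp, ← Functor.map_comp] at sq
    obtain ⟨l, rfl, rfl⟩ := exists_lift_of_hasLiftingProperty h a b (ext' hA sq)
    exact ⟨(ev m).map l, by rw [← Functor.map_comp], by rw [← Functor.map_comp]⟩
  · intro h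
    refine hasLiftingProperty_of_exists_lift fun a b sq => ?_
    obtain ⟨l, h1, h2⟩ := exists_lift_of_hasLiftingProperty h ((ev m).map a) ((ev m).map b)
      (by rw [← Functor.map_comp, ← Functor.map_comp, sq])
    obtain ⟨l, rfl⟩ := ext l
    exact ⟨l, ext' hA (by rw [Functor.map_comp, h1]), ext' hB (by rw [Functor.map_comp, h2])⟩

lemma concentratedAt_orbitSeq (m : ℕ) (H : Subgroup (Equiv.Perm (Fin m))) (K : PSSet.{u}) :
    ConcentratedAt m ((orbitSeq m H).obj K) := fun n hn k x => by
  refine PQuot.ind (p := fun x => x = pt ((orbitSeq m H).obj K) n k) rfl ?_ x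
  rintro ⟨e, -⟩
  exact absurd (by simpa using (Fintype.card_congr e).symm) hn

end seq

/-! ### The adjunction between symmetric sequences and symmetric spectra -/

lemma blockSum_inl {p p' n n' : ℕ} (α : Fin p ≃ Fin p') (β : Fin n ≃ Fin n') (i : Fin p) :
    blockSum α β (block p n (Sum.inl i)) = block p' n' (Sum.inl (α i)) := by
  simp [blockSum]

lemma blockSum_inr {p p' n n' : ℕ} (α : Fin p ≃ Fin p') (β : Fin n ≃ Fin n') (i : Fin n) :
    blockSum α β (block p n (Sum.inr i)) = block p' n' (Sum.inr (β i)) := by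
  simp [blockSum]

lemma shiftLeft_one_reindex {a b n : ℕ} (e : Fin a ⊕ Fin b ≃ Fin n) :
    (block (a + 1) b).symm.trans (shiftLeft 1 e) =
      blockSum (Equiv.refl (Fin 1)) ((block a b).symm.trans e) := by
  have h0 := blockSum_inl (Equiv.refl (Fin 1)) ((block a b).symm.trans e) 0
  have h1 := fun j => blockSum_inr (Equiv.refl (Fin 1)) ((block a b).symm.trans e) j
  simp only [block_one_inr] at h1
  refine Equiv.ext fun i => ?_
  obtain ⟨i | i, rfl⟩ := (block (a + 1) b).surjective i
  · rw [Equiv.trans_apply, Equiv.symm_apply_apply]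
    induction i using Fin.cases with
    | zero => exact (shiftLeft_one_inl_zero e).trans h0.symm
    | succ i =>
      refine (shiftLeft_one_inl_succ e i).trans (Eq.trans ?_ (h1 (block a b (Sum.inl i))).symm)
      simp
  · rw [Equiv.trans_apply, Equiv.symm_apply_apply, block_succ_inr]
    refine (shiftLeft_inr 1 e i).trans (Eq.trans ?_ (h1 (block a b (Sum.inr i))).symm)
    simp [block_one_inr]

lemma unitGen_mk (X : SymSpec.{u}) {a b n k} (e : Fin a ⊕ Fin b ≃ Fin n) (t : Fin a → Circ.{u} k)
    (y : El X.seq b k) :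
    unitGen X ⟨a, b, e, sphereMk t, y⟩ = perm X.seq ((block a b).symm.trans e) (X.it a t y) := rfl

/-- The element `1 ∧ x` of `S ⊗ A`. -/
def freeUnit {A : Seq.{u}} {n k} (x : El A n k) : El (free.obj A).seq n k :=
  tensorMk (A := sphereSeq) ⟨0, n, block 0 n, sphereMk Fin.elim0, x⟩

lemma freeUnit_simpl {A : Seq.{u}} {n k l} (φ : k ⟶ l) (x : El A n k) :
    freeUnit (simpl A φ x) = simpl (free.obj A).seq φ (freeUnit x) := by
  have : simpl sphereSeq φ (sphereMk Fin.elim0) = sphereMk Fin.elim0 :=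
    congrArg sphereMk (funext fun i => i.elim0)
  exact congrArg (fun s => tensorMk (A := sphereSeq) ⟨0, n, block 0 n, s, simpl A φ x⟩) this.symm

lemma freeUnit_perm {A : Seq.{u}} {m n k} (e : Fin m ≃ Fin n) (x : El A m k) :
    freeUnit (perm A e x) = perm (free.obj A).seq e (freeUnit x) := by
  have h := TRel.equivar (A := sphereSeq) (B := A) (Equiv.refl (Fin 0)) e (block 0 n)
    (sphereMk Fin.elim0) x
  rw [perm_refl] at h
  refine (PQuot.sound h).symm.trans ?_
  change tensorMk _ = tensorMk _
  congr 2
  refine Equiv.ext fun i => ?_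
  obtain i | i := i
  · exact i.elim0
  · simp only [Equiv.trans_apply, Equiv.sumCongr_apply, Sum.map_inr, block_zero]; rfl

/-- The simplices `1 ∧ y` generate `S ⊗ A` under structure maps and bijections; this gives the
uniqueness half of freeness. -/
lemma tensorMk_eq_it {A : Seq.{u}} {a b n k} (e : Fin a ⊕ Fin b ≃ Fin n) (t : Fin a → Circ.{u} k)
    (y : El A b k) :
    tensorMk (A := sphereSeq) ⟨a, b, e, sphereMk t, y⟩ =
      perm (free.obj A).seq ((block a b).symm.trans e) ((free.obj A).it a t (freeUnit y)) := by
  have h := iter_tensor sphere A t (⟨0, b, block 0 b, sphereMk Fin.elim0, y⟩ : TGen sphereSeq A b k)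
  refine Eq.trans ?_ (congrArg (perm (free.obj A).seq ((block a b).symm.trans e)) h.symm)
  -- The iterated structure map yields a generator of sphere degree `0 + a` instead of `a`; dividing
  -- out the cast bijection repairs this.
  have h2 := TRel.equivar (A := sphereSeq) (B := A) (n := n)
    (finCongr (Nat.zero_add a).symm) (Equiv.refl (Fin b))
    ((shiftLeft a (block 0 b)).trans ((block a b).symm.trans e)) (sphereMk t) y
  rw [perm_refl] at h2
  refine Eq.trans ?_ ((PQuot.sound h2).trans ?_)
  · change tensorMk _ = tensorMk _
    congr 2
    refine Equiv.ext fun i => ?_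
    obtain i | i := i
    · have : finCongr (Nat.zero_add a).symm i = block a 0 (Sum.inl i) := by
        ext; simp only [block, finCongr_apply, Equiv.trans_apply, Fin.val_cast]; rfl
      simp [this, shiftLeft_inl_inl]
    · simp [shiftLeft_inr, block_zero]
  · change tensorMk _ = tensorMk _
    congr 2
    refine Eq.trans ?_ (iter_sphere t Fin.elim0).symm
    change sphereMk _ = sphereMk _
    congr 1
    funext i
    obtain ⟨i | i, rfl⟩ := (block a 0).surjective i
    · simp only [SymSpec.append, Equiv.symm_apply_apply, Sum.elim_inl]
      refine congrArg t (Fin.ext ?_)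
      simp only [block, Equiv.trans_apply]
      rfl
    · exact i.elim0

lemma unitGen_map {X : SymSpec.{u}} {A : Seq.{u}} (g : A ⟶ X.seq) {n k}
    (z w : TGen sphere.{u}.seq A n k) (h : TRel sphere.{u}.seq A n k z w) :
    unitGen X (z.map (𝟙 _) g) = unitGen X (w.map (𝟙 _) g) :=
  unitGen_rel X _ _ (.tens _ _ (TRel.map (𝟙 _) g _ _ h))

/-- The map `S ⊗ A ⟶ X` that extends a map `A ⟶ X` of symmetric sequences. -/
def freeDesc {X : SymSpec.{u}} {A : Seq.{u}} (g : A ⟶ X.seq) : free.obj A ⟶ X where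
  hom :=
    { app := fun n =>
        { app := fun k => (PQuot.desc (fun z => unitGen X (z.map (𝟙 _) g)) (unitGen_map g)
            (fun _ h => unitGen_base X _ (h.map _ _)) :
            PQuot (TRel sphere.seq A n.n k) TGen.IsBase ⟶ (X.seq.obj n).obj k)
          naturality := fun _ _ φ => PQuot.hom_ext fun z => by
            change unitGen X ((z.simpl φ).map (𝟙 _) g) = simpl X.seq φ (unitGen X (z.map (𝟙 _) g))
            refine ((simpl_perm _ φ _).trans
              (congrArg (perm X.seq _) ((sphereAct_simpl X φ z.x (ap g z.y)).trans ?_))).symm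
            rw [← ap_simpl]; rfl }
      naturality := fun m n e => NatTrans.ext (funext fun k => PQuot.hom_ext fun z => by
        change unitGen X ((z.perm (Sig.eqv e)).map (𝟙 _) g) =
          perm X.seq (Sig.eqv e) (unitGen X (z.map (𝟙 _) g))
        rw [unitGen, unitGen, perm_perm]; rfl) }
  comm {n k} t x := by
    induction x using tensor_ind with
    | h0 =>
      refine Eq.trans ?_ (X.σ_pt_right t).symm
      rfl
    | h z =>
      obtain ⟨a, b, e, x, y⟩ := z
      change unitGen X ⟨a + 1, b, shiftLeft 1 e, sphereσ a k t x, ap g y⟩ =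
        X.σ n k t (unitGen X ⟨a, b, e, x, ap g y⟩)
      induction x using sphere_ind with
      | h0 =>
        rw [sphereσ_pt, unitGen_base X _ (Or.inl rfl), unitGen_base X _ (Or.inl rfl), X.σ_pt_right]
      | h s =>
        rw [sphereσ_mk, unitGen_mk, unitGen_mk]
        have h1 : ∀ w, X.σ n k t w = X.it 1 (fun _ => t) w := fun _ => rfl
        have h2 : X.it (a + 1) (Fin.cons t s) (ap g y) = X.it 1 (fun _ => t) (X.it a s (ap g y)) :=
          rfl
        rw [h1, h2]
        have h3 := X.it_perm (Equiv.refl (Fin 1)) ((block a b).symm.trans e) (fun _ => t)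
          (X.it a s (ap g y))
        refine Eq.trans ?_ h3
        congr 1
        exact shiftLeft_one_reindex e

lemma ap_freeDesc {X : SymSpec.{u}} {A : Seq.{u}} (g : A ⟶ X.seq) {n k} (x : El A n k) :
    ap (freeDesc g).hom (freeUnit x) = ap g x := by
  change unitGen X ⟨0, n, block 0 n, sphereMk Fin.elim0, ap g x⟩ = _
  rw [unitGen_mk, Equiv.symm_trans_self, perm_refl]; rfl

lemma freeHom_ext {X : SymSpec.{u}} {A : Seq.{u}} {f g : free.obj A ⟶ X}
    (h : ∀ (n k) (x : El A n k), ap f.hom (freeUnit x) = ap g.hom (freeUnit x)) : f = g := by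
  refine SymSpec.hom_ext (seqHom_ext fun n k x => ?_)
  induction x using tensor_ind with
  | h0 => exact (ap_pt f.hom).trans (ap_pt g.hom).symm
  | h z =>
    obtain ⟨a, b, e, x, y⟩ := z
    induction x using sphere_ind with
    | h0 =>
      have : tensorMk (⟨a, b, e, pt _ a k, y⟩ : TGen sphere.{u}.seq A n k) = pt _ n k :=
        PQuot.sound_base (Or.inl rfl)
      refine (congrArg (ap f.hom) this).trans (Eq.trans ?_ (congrArg (ap g.hom) this).symm)
      exact (ap_pt f.hom).trans (ap_pt g.hom).symm
    | h t =>
      refine (congrArg (ap f.hom) (tensorMk_eq_it e t y)).trans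
        (Eq.trans ?_ (congrArg (ap g.hom) (tensorMk_eq_it e t y)).symm)
      rw [ap_perm, SymSpec.ap_it, ap_perm, SymSpec.ap_it, h]

/-- The restriction of a map `S ⊗ A ⟶ X` to `A`. -/
def freeRestrict {X : SymSpec.{u}} {A : Seq.{u}} (f : free.obj A ⟶ X) : A ⟶ X.seq :=
  seqHomMk (fun _ _ x => ap f.hom (freeUnit x))
    (fun _ _ => (congrArg (ap f.hom) (PQuot.sound_base (Or.inr rfl))).trans (ap_pt f.hom))
    (fun φ x => (congrArg (ap f.hom) (freeUnit_simpl φ x)).trans (ap_simpl f.hom φ _))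
    (fun e x => (congrArg (ap f.hom) (freeUnit_perm e x)).trans (ap_perm f.hom e _))

/-- The adjunction `S ⊗ - ⊣ forget`. -/
def freeAdj : free.{u} ⊣ SymSpec.forget.{u} :=
  Adjunction.mkOfHomEquiv
    { homEquiv := fun _ _ =>
        { toFun := fun f => freeRestrict f
          invFun := fun g => freeDesc g
          left_inv := fun f => freeHom_ext fun _ _ x => ap_freeDesc (freeRestrict f) x
          right_inv := fun g => seqHom_ext fun _ _ x => ap_freeDesc g x }
      homEquiv_naturality_left_symm := fun f g => freeHom_ext fun _ _ x =>
        (ap_freeDesc _ x).trans (ap_freeDesc g (ap f x)).symm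
      homEquiv_naturality_right := fun _ _ => rfl }

lemma free_map_hasLiftingProperty_iff {m : ℕ} {A B : Seq.{u}} (hA : ConcentratedAt m A)
    (hB : ConcentratedAt m B) (i : A ⟶ B) {X Y : SymSpec.{u}} (f : X ⟶ Y) :
    HasLiftingProperty (free.map i) f ↔ HasLiftingProperty ((ev m).map i) ((ev m).map f.hom) :=
  (freeAdj.hasLiftingProperty_iff i f).trans (hA.hasLiftingProperty_iff hB i f.hom)

/-- The generators of spectra in degree m are free on those of `mixedGenerators m`, so the
adjunction and concentration in degree m turn one lifting test into the other. Degrees below `m₀`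
are not tested. -/
lemma specCofibrations_rlp_iff (m₀ : ℕ) {X Y : SymSpec.{u}} (f : X ⟶ Y) :
    (specCofibrations m₀).rlp f ↔
      ∀ m, m₀ ≤ m → (cellular (mixedGenerators m)).rlp ((ev m).map f.hom) := by
  simp only [cellular_rlp]
  constructor
  · rintro h m hm _ _ _ ⟨k, H⟩
    exact (free_map_hasLiftingProperty_iff (concentratedAt_orbitSeq m H _)
      (concentratedAt_orbitSeq m H _) _ f).1 (h _ (.mk m k hm H))
  · rintro h _ _ _ ⟨m, k, hm, H⟩
    exact (free_map_hasLiftingProperty_iff (concentratedAt_orbitSeq m H _)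
      (concentratedAt_orbitSeq m H _) _ f).2 (h m hm _ (.mk k H))

/-! ### Simplices of the smash product with the truncated sphere spectrum -/

/-- The simplex `t 0 ∧ ⋯ ∧ t p` of the truncated sphere spectrum. -/
def sphereBarMk {p : ℕ} {k : SimplexCategoryᵒᵖ} (t : Fin (p + 1) → Circ.{u} k) :
    El sphereBar.{u}.seq (p + 1) k :=
  show sphereBarLvl (p + 1) k from Subtype.mk (sphereMk t) fun h => absurd h (Nat.succ_ne_zero p)

/-- The simplex `t 0 ∧ ⋯ ∧ t p ∧ y` of the smash product with the truncated sphere spectrum. -/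
def barMk {Y : SymSpec.{u}} {p m n k} (e : Fin (p + 1) ⊕ Fin m ≃ Fin n)
    (t : Fin (p + 1) → Circ.{u} k) (y : El Y.seq m k) : El (smash sphereBar Y) n k :=
  smashMk ⟨p + 1, m, e, sphereBarMk t, y⟩

section barMk

variable {Y : SymSpec.{u}} {p m n : ℕ} {k l : SimplexCategoryᵒᵖ}

/-- Since `S̄` is trivial in degree 0, a nontrivial simplex has at least one sphere coordinate. The
resulting strict bound `m < n` makes the latching object depend on lower terms only. -/
lemma bar_ind {P : El (smash sphereBar Y) n k → Prop} (h0 : P (pt _ n k))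
    (h : ∀ {p m} (e : Fin (p + 1) ⊕ Fin m ≃ Fin n) (t : Fin (p + 1) → Circ.{u} k)
      (y : El Y.seq m k), m < n → P (barMk e t y)) (x : El (smash sphereBar Y) n k) : P x := by
  induction x using smash_ind with
  | h0 => exact h0
  | h z =>
    obtain ⟨a, b, e, x, y⟩ := z
    by_cases hx : x = pt sphereBar.seq a k
    · have : smashMk (⟨a, b, e, x, y⟩ : TGen sphereBar.{u}.seq Y.seq n k) = pt _ n k :=
        PQuot.sound_base (Or.inl hx)
      exact this ▸ h0
    -- In sphere degree 0 the first component could only be the base point, which has been excluded.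
    · obtain _ | a := a
      · exact absurd (sphereBarVal_inj (sphereBarVal_zero x rfl)) hx
      · have hn : b < n := by
          have := Fintype.card_congr e
          simp only [Fintype.card_sum, Fintype.card_fin] at this
          omega
        obtain ⟨x, hx'⟩ := x
        induction x using sphere_ind with
        | h0 => exact absurd (sphereBarVal_inj rfl) hx
        | h t => exact h e t y hn

lemma barMk_equivar {p' m' : ℕ} (α : Fin (p + 1) ≃ Fin (p' + 1)) (β : Fin m ≃ Fin m')
    (e : Fin (p' + 1) ⊕ Fin m' ≃ Fin n) (t : Fin (p + 1) → Circ.{u} k) (y : El Y.seq m k) :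
    barMk ((Equiv.sumCongr α β).trans e) t y =
      barMk e (fun i => t (α.symm i)) (perm Y.seq β y) :=
  PQuot.sound (.tens _ _ (.equivar α β e (sphereBarMk t) y))

lemma barMk_pt (e : Fin (p + 1) ⊕ Fin m ≃ Fin n) (t : Fin (p + 1) → Circ.{u} k) :
    barMk e t (pt Y.seq m k) = pt _ n k :=
  PQuot.sound_base (Or.inr rfl)

lemma barMk_pt_left (e : Fin (p + 1) ⊕ Fin m ≃ Fin n) (t : Fin (p + 1) → Circ.{u} k)
    (y : El Y.seq m k) (i : Fin (p + 1)) (hi : t i = (circle.obj k).point) :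
    barMk e t y = pt _ n k :=
  PQuot.sound_base (Or.inl (sphereBarVal_inj (PQuot.sound_base ⟨i, hi⟩)))

lemma ap_latch_barMk (e : Fin (p + 1) ⊕ Fin m ≃ Fin n)
    (t : Fin (p + 1) → Circ.{u} k) (y : El Y.seq m k) :
    ap (latch.app Y) (barMk e t y) =
      perm Y.seq ((block (p + 1) m).symm.trans e) (Y.it (p + 1) t y) := rfl

/-- The reindexing in `balRight`. -/
def balRightReindex (a b c : ℕ) : Fin a ⊕ Fin (b + c) ≃ Fin c ⊕ (Fin a ⊕ Fin b) :=
  (Equiv.sumCongr (Equiv.refl (Fin a)) (block c b).symm).trans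
    ((Equiv.sumAssoc (Fin a) (Fin c) (Fin b)).symm.trans
      ((Equiv.sumCongr (Equiv.sumComm (Fin a) (Fin c)) (Equiv.refl (Fin b))).trans
        (Equiv.sumAssoc (Fin c) (Fin a) (Fin b))))

lemma balRight_eq {a b c n : ℕ} (e : Fin c ⊕ (Fin a ⊕ Fin b) ≃ Fin n) :
    balRight e = (balRightReindex a b c).trans e := rfl

/-- Over S all sphere coordinates but the first can be moved onto y, leaving an element of `S̄` in
degree 1. This lets structure maps defined with one sphere coordinate have the expected iterates. -/
lemma barMk_bal (e : Fin (m + (p + 2)) ≃ Fin n) (t : Fin (p + 2) → Circ.{u} k) (y : El Y.seq m k) :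
    barMk ((block 1 (m + (p + 1))).trans e) (fun _ => t 0) (Y.it (p + 1) (fun i => t i.succ) y) =
      barMk ((block (p + 2) m).trans e) t y := by
  -- Chosen so that `balRight E` is the reindexing of the left-hand side.
  let E : Fin (p + 1) ⊕ (Fin 1 ⊕ Fin m) ≃ Fin n :=
    (balRightReindex 1 m (p + 1)).symm.trans ((block 1 (m + (p + 1))).trans e)
  have hE : balRight E = (block 1 (m + (p + 1))).trans e := by
    rw [balRight_eq, ← Equiv.trans_assoc, Equiv.self_trans_symm, Equiv.refl_trans]
  have h1 := PQuot.sound (c := TGen.IsBase) (SRel.bal (X := sphereBar) (Y := Y) E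
    (fun i => t i.succ) (sphereBarMk (fun _ : Fin 1 => t 0)) y)
  rw [hE] at h1
  refine h1.symm.trans ?_
  -- The action of the sphere puts the moved coordinates before `t 0`; a block transposition
  -- restores the order.
  have h2 : sphereBar.it (p + 1) (fun i => t i.succ) (sphereBarMk (fun _ : Fin 1 => t 0)) =
      perm sphereBar.seq (blockSwap 1 (p + 1)) (sphereBarMk t) := by
    refine sphereBarVal_inj ((iter_sphereBar _ _).trans ((iter_sphere _ _).trans ?_))
    change sphereMk _ = sphereMk _
    congr 1
    funext i
    obtain ⟨i | i, rfl⟩ := (block (p + 1) 1).surjective i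
    · have : (blockSwap 1 (p + 1)).symm (block (p + 1) 1 (Sum.inl i)) = i.succ := by
        simp [blockSwap, block_one_inr]
      simp only [SymSpec.append, Equiv.symm_apply_apply, Sum.elim_inl]
      exact congrArg t this.symm
    · have : (blockSwap 1 (p + 1)).symm (block (p + 1) 1 (Sum.inr i)) = 0 := by
        simp [blockSwap, Subsingleton.elim i 0, block_succ_inl_zero]
      simp only [SymSpec.append, Equiv.symm_apply_apply, Sum.elim_inr]
      exact congrArg t this.symm
  rw [h2]
  have h3 := PQuot.sound (c := TGen.IsBase) (SRel.tens _ _ (TRel.equivar (A := sphereBar.seq)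
    (B := Y.seq) (blockSwap 1 (p + 1)) (Equiv.refl (Fin m)) (balLeft E) (sphereBarMk t) y))
  rw [perm_refl] at h3
  refine h3.symm.trans ?_
  change smashMk _ = smashMk _
  congr 2
  have e1 (j : Fin 1 ⊕ Fin (m + (p + 1))) : E (balRightReindex 1 m (p + 1) j) =
      e (block 1 (m + (p + 1)) j) := by simp [E]
  refine Equiv.ext fun i => ?_
  obtain i | i := i
  · obtain ⟨i | i, rfl⟩ := (block 1 (p + 1)).surjective i
    · have h4 := e1 (Sum.inl i)
      simp only [balRightReindex, Equiv.trans_apply, Equiv.sumCongr_apply, Sum.map_inl,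
        Equiv.refl_apply, Equiv.sumAssoc_symm_apply_inl, Equiv.sumComm_apply, Sum.swap_inl,
        Equiv.sumAssoc_apply_inl_inr] at h4
      simp only [Equiv.trans_apply, Equiv.sumCongr_apply, Sum.map_inl, blockSwap,
        Equiv.symm_apply_apply, Equiv.sumComm_apply, Sum.swap_inl, balLeft,
        Equiv.sumAssoc_apply_inl_inr]
      rw [h4, Subsingleton.elim i 0]
      rfl
    · have h4 := e1 (Sum.inr (block (p + 1) m (Sum.inl i)))
      simp only [balRightReindex, Equiv.trans_apply, Equiv.sumCongr_apply, Sum.map_inr,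
        Equiv.symm_apply_apply, Equiv.sumAssoc_symm_apply_inr_inl, Sum.map_inl,
        Equiv.sumComm_apply, Sum.swap_inr, Equiv.sumAssoc_apply_inl_inl] at h4
      simp only [Equiv.trans_apply, Equiv.sumCongr_apply, Sum.map_inl, blockSwap,
        Equiv.symm_apply_apply, Equiv.sumComm_apply, Sum.swap_inr, balLeft,
        Equiv.sumAssoc_apply_inl_inl]
      rw [h4, block_one_inr, block_one_inr]
      exact congrArg e (block_succ_inl_succ _ _ _).symm
  · have h4 := e1 (Sum.inr (block (p + 1) m (Sum.inr i)))
    simp only [balRightReindex, Equiv.trans_apply, Equiv.sumCongr_apply, Sum.map_inr,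
      Equiv.symm_apply_apply, Equiv.sumAssoc_symm_apply_inr_inr, Equiv.refl_apply,
      Equiv.sumAssoc_apply_inr] at h4
    simp only [Equiv.trans_apply, Equiv.sumCongr_apply, Sum.map_inr, Equiv.refl_apply, balLeft,
      Equiv.sumAssoc_apply_inr]
    rw [h4, block_one_inr]
    exact congrArg e (block_succ_inr _ _ _).symm

end barMk

/-! ### Replacing one term of a symmetric spectrum -/

/-- Maps `v : Y_n ⟶ B` and `w : (S̄ ∧ Y)_n ⟶ A` that are compatible with `p : A ⟶ B`. -/
structure LatchData (n : ℕ) (Y : SymSpec.{u}) where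
  A : PermPSSet.{u} n
  B : PermPSSet.{u} n
  p : A ⟶ B
  v : (ev n).obj Y.seq ⟶ B
  w : (ev n).obj (smash sphereBar Y) ⟶ A
  comp : w ≫ p = (ev n).map (latch.app Y) ≫ v

namespace LatchData

variable {n : ℕ} {Y : SymSpec.{u}} (D : LatchData n Y)

lemma p_w_barMk {p m : ℕ} {k} (e : Fin (m + (p + 1)) ≃ Fin n) (t : Fin (p + 1) → Circ.{u} k)
    (y : El Y.seq m k) :
    pap D.p (pap D.w (barMk ((block (p + 1) m).trans e) t y)) =
      pap D.v (perm Y.seq e (Y.it (p + 1) t y)) := by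
  refine (congrArg (fun f : (ev n).obj (smash sphereBar Y) ⟶ D.B => pap (k := k) f
    (barMk ((block (p + 1) m).trans e) t y)) D.comp).trans (congrArg (pap D.v) ?_)
  refine (ap_latch_barMk ((block (p + 1) m).trans e) t y).trans ?_
  rw [← Equiv.trans_assoc, Equiv.symm_trans_self]; rfl

lemma w_barMk_trans {p m : ℕ} {k} (e : Fin (p + 1) ⊕ Fin m ≃ Fin n) (τ : Equiv.Perm (Fin n))
    (t : Fin (p + 1) → Circ.{u} k) (y : El Y.seq m k) :
    pap D.w (barMk (e.trans τ) t y) = pact D.A τ (pap D.w (barMk e t y)) :=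
  pap_pact D.w τ (barMk e t y)

/-- The simplices of the `m`-th term of the spectrum that agrees with `Y` outside degree `n`, and
is `Y_n ×_B A` in degree `n`. -/
@[ext]
structure Simplex (m : ℕ) (k : SimplexCategoryᵒᵖ) : Type u where
  y : El Y.seq m k
  -- Indexing by bijections avoids a case distinction on m. For `m ≠ n` there are none and only y
  -- remains; for `m = n` equivariance reduces the family to its value at the identity, giving a
  -- point of `Y_n ×_B A`.
  a : (Fin m ≃ Fin n) → PEl D.A k
  p_a : ∀ e, pap D.p (a e) = pap D.v (perm Y.seq e y)
  act_a : ∀ e τ, a (e.trans τ) = pact D.A τ (a e)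

/-- The symmetric sequence that agrees with `Y` outside degree `n`, and is `Y_n ×_B A` in
degree `n`. -/
def seq : Seq.{u} where
  obj m :=
    { obj := fun k => ⟨D.Simplex m.n k, pt Y.seq m.n k, fun _ => ppt D.A k,
        fun e => by rw [pap_ppt, perm_pt]; exact (pap_ppt D.v).symm, fun _ τ => (pact_ppt τ).symm⟩
      map := fun φ => ⟨fun x => ⟨simpl Y.seq φ x.y, fun e => psim D.A φ (x.a e),
          fun e => by
            rw [pap_psim, x.p_a, ← simpl_perm]; exact (pap_psim D.v φ _).symm,
          fun e τ => by rw [x.act_a, psim_pact]⟩,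
        Simplex.ext (simpl_pt φ) (funext fun _ => psim_ppt φ)⟩
      map_id := fun k => Pointed.Hom.ext (funext fun x =>
        Simplex.ext (simpl_id _) (funext fun _ => psim_id _))
      map_comp := fun φ ψ => Pointed.Hom.ext (funext fun x =>
        Simplex.ext (simpl_simpl φ ψ _).symm (funext fun _ => (psim_psim φ ψ _).symm)) }
  map ε :=
    { app := fun k => ⟨fun x => ⟨perm Y.seq (Sig.eqv ε) x.y, fun e => x.a ((Sig.eqv ε).trans e),
          fun e => by rw [x.p_a, perm_perm],
          fun e τ => by rw [← x.act_a]; rfl⟩,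
        Simplex.ext (perm_pt (A := Y.seq) (Sig.eqv ε)) rfl⟩
      naturality := fun _ _ φ => Pointed.Hom.ext (funext fun x =>
        Simplex.ext (simpl_perm (A := Y.seq) (Sig.eqv ε) φ x.y).symm rfl) }
  map_id _ := NatTrans.ext (funext fun _ => Pointed.Hom.ext (funext fun x =>
    Simplex.ext (perm_refl (A := Y.seq) x.y) rfl))
  map_comp ε ε' := NatTrans.ext (funext fun _ => Pointed.Hom.ext (funext fun x =>
    Simplex.ext (perm_perm (A := Y.seq) (Sig.eqv ε) (Sig.eqv ε') x.y).symm rfl))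

/-- The structure maps of the spectrum that agrees with `Y` outside degree `n`, and is
`Y_n ×_B A` in degree `n`. -/
def σ (m : ℕ) (k : SimplexCategoryᵒᵖ) (t : Circ.{u} k) (x : El D.seq m k) :
    El D.seq (m + 1) k :=
  show D.Simplex (m + 1) k from
  { y := Y.σ m k t (Simplex.y x)
    -- Into degree n, the A-component of the structure map is prescribed by w; in any other degree
    -- this family is empty.
    a := fun e => pap D.w (barMk ((block 1 m).trans e) (fun _ => t) (Simplex.y x))
    p_a := fun e => D.p_w_barMk e (fun _ => t) (Simplex.y x)
    act_a := fun e τ => D.w_barMk_trans ((block 1 m).trans e) τ (fun _ => t) (Simplex.y x) }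

/-- Each further structure map replaces the A-component by w of a simplex with a single sphere
coordinate, and `barMk_bal` collects the coordinates again. Equivariance of the new spectrum then
follows from the relations in `S̄ ∧ Y`. -/
lemma iter_σ {m p : ℕ} {k} (t : Fin (p + 1) → Circ.{u} k) (x : El D.seq m k) :
    iter D.σ (p + 1) t x = Simplex.mk (D := D) (Y.it (p + 1) t (Simplex.y x))
      (fun e => pap D.w (barMk ((block (p + 1) m).trans e) t (Simplex.y x)))
      (fun e => D.p_w_barMk e t (Simplex.y x))
      (fun e τ => D.w_barMk_trans ((block (p + 1) m).trans e) τ t (Simplex.y x)) := by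
  induction p with
  | zero =>
    refine Simplex.ext rfl (funext fun e => ?_)
    refine congrArg (fun t => pap D.w (barMk ((block 1 m).trans e) t (Simplex.y x))) ?_
    funext i
    rw [show i = 0 from Subsingleton.elim (α := Fin 1) _ _]
  | succ p ih =>
    rw [iter, ih]
    refine Simplex.ext rfl (funext fun e => ?_)
    exact congrArg (pap D.w) (barMk_bal e t (Simplex.y x))

lemma blockSum_zero {m m' : ℕ} (α : Fin 0 ≃ Fin 0) (β : Fin m ≃ Fin m') : blockSum α β = β := by
  refine Equiv.ext fun i => ?_
  obtain ⟨i | i, rfl⟩ := (block 0 m).surjective i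
  · exact i.elim0
  · exact (blockSum_inr α β i).trans (by rw [block_zero, block_zero])

/-- The symmetric spectrum that agrees with `Y` outside degree `n`, and is `Y_n ×_B A` in
degree `n`. -/
def spec : SymSpec.{u} where
  seq := D.seq
  σ := D.σ
  σ_pt_left x := Simplex.ext (Y.σ_pt_left (Simplex.y x)) (funext fun e =>
    (congrArg (pap D.w) (barMk_pt_left _ _ _ 0 rfl)).trans (pap_ppt D.w))
  σ_pt_right t := Simplex.ext (Y.σ_pt_right t) (funext fun e =>
    (congrArg (pap D.w) (barMk_pt _ _)).trans (pap_ppt D.w))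
  σ_simpl φ t x := Simplex.ext (Y.σ_simpl φ t (Simplex.y x)) (funext fun e =>
    (pap_psim D.w φ _).symm)
  σ_equivariant {p m k} α β t x := by
    -- Without sphere coordinates the iterated map is the identity; `iter_σ` needs at least one
    -- coordinate.
    obtain _ | p := p
    · rw [blockSum_zero]; rfl
    · rw [iter_σ, iter_σ]
      refine Simplex.ext (Y.it_perm α β t (Simplex.y x)) (funext fun e => ?_)
      refine congrArg (pap D.w) (Eq.trans ?_ (barMk_equivar α β ((block (p + 1) m).trans e) t
        (Simplex.y x)))
      refine congrArg (fun e => barMk e t (Simplex.y x)) (Equiv.ext fun i => ?_)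
      simp [Sig.eqv, blockSum]

/-- The map to `Y`. -/
def proj : D.spec ⟶ Y where
  hom := seqHomMk (fun _ _ x => Simplex.y x) (fun _ _ => rfl) (fun _ _ => rfl) (fun _ _ => rfl)
  comm _ _ := rfl

/-- The projection of the `n`-th term to `A`. -/
def toA : (ev n).obj D.spec.seq ⟶ D.A :=
  permHomMk (fun _ x => Simplex.a x (Equiv.refl _)) (fun _ => rfl) (fun _ _ => rfl)
    (fun τ x => Simplex.act_a x (Equiv.refl _) τ)

lemma toA_p : D.toA ≫ D.p = (ev n).map D.proj.hom ≫ D.v := permHom_ext fun _ x =>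
  (Simplex.p_a x (Equiv.refl _)).trans
    (congrArg (pap D.v) (perm_refl (A := Y.seq) (Simplex.y x)))

/-- By `iter_σ` every simplex in the image of the latching map has A-component given by w. Through
this identity a section of `proj` satisfies the condition on `(S̄ ∧ Y)_n` in `LatchLift`. -/
lemma latch_toA : (ev n).map (latch.app D.spec) ≫ D.toA =
    (ev n).map ((smashFunctor sphereBar).map D.proj) ≫ D.w := permHom_ext fun k x => by
  induction x using bar_ind with
  | h0 =>
    refine Eq.trans ?_ (pap_ppt _).symm
    exact pap_ppt ((ev n).map (latch.app D.spec) ≫ D.toA)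
  | @h p m e t y _ =>
    refine (congrArg (fun x : D.Simplex (m + (p + 1)) k => x.a ((block (p + 1) m).symm.trans e))
      (D.iter_σ t y)).trans ?_
    change pap D.w (barMk ((block (p + 1) m).trans ((block (p + 1) m).symm.trans e)) t _) = _
    rw [← Equiv.trans_assoc, Equiv.self_trans_symm, Equiv.refl_trans]
    rfl

/-- A map to the modified spectrum, from a map to `Y` and a map to `A`. -/
def lift {X : SymSpec.{u}} (f : X ⟶ Y) (a : (ev n).obj X.seq ⟶ D.A)
    (h : a ≫ D.p = (ev n).map f.hom ≫ D.v)
    (h' : (ev n).map ((smashFunctor sphereBar).map f) ≫ D.w = (ev n).map (latch.app X) ≫ a) :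
    X ⟶ D.spec where
  hom := seqHomMk
    (fun m k x => (show D.Simplex m k from
      { y := ap f.hom x
        a := fun e => pap a (perm X.seq e x)
        p_a := fun e => (congrArg (fun g : (ev n).obj X.seq ⟶ D.B =>
          pap (k := k) g (perm X.seq e x)) h).trans (congrArg (pap D.v) (ap_perm f.hom e x))
        act_a := fun e τ => by rw [← perm_perm]; exact pap_pact a τ (perm X.seq e x) }))
    (fun _ _ => Simplex.ext (ap_pt f.hom) (funext fun e =>
      (congrArg (pap a) (perm_pt e)).trans (pap_ppt a)))
    (fun φ x => Simplex.ext (ap_simpl f.hom φ x) (funext fun e =>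
      (congrArg (pap a) (simpl_perm e φ x).symm).trans (pap_psim a φ (perm X.seq e x))))
    (fun ε x => Simplex.ext (ap_perm f.hom ε x) (funext fun e =>
      congrArg (pap a) (perm_perm ε e x)))
  comm {m k} t x := Simplex.ext (f.comm t x) (funext fun e => by
    have h1 := congrArg (fun g : (ev n).obj (smash sphereBar X) ⟶ D.A =>
      pap (k := k) g (barMk ((block 1 m).trans e) (fun _ => t) x)) h'
    refine Eq.trans ?_ h1.symm
    refine congrArg (pap a) ?_
    refine Eq.trans ?_ (ap_latch_barMk ((block 1 m).trans e) (fun _ => t) x).symm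
    rw [← Equiv.trans_assoc, Equiv.symm_trans_self]; rfl)

lemma lift_toA_apply {X : SymSpec.{u}} (f : X ⟶ Y) (a : (ev n).obj X.seq ⟶ D.A) (h) (h') {k}
    (x : El X.seq n k) :
    pap D.toA (k := k) (ap (D.lift f a h h').hom x) = pap a (k := k) x :=
  congrArg (pap a) (perm_refl (A := X.seq) x)

/-- The uniqueness half of the universal property, with `lift` as existence. It makes the
construction functorial in diagrams. -/
lemma hom_ext {X : SymSpec.{u}} {f g : X ⟶ D.spec} (h : f ≫ D.proj = g ≫ D.proj)
    (h' : (ev n).map f.hom ≫ D.toA = (ev n).map g.hom ≫ D.toA) : f = g := by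
  refine SymSpec.hom_ext (seqHom_ext fun m k x => Simplex.ext ?_ (funext fun e => ?_))
  · exact congrArg (fun q : X ⟶ Y => ap q.hom x) h
  -- A bijection exists only in degree n, where equivariance reduces to the identity bijection, that
  -- is, to `toA`.
  · obtain rfl : m = n := by simpa using Fintype.card_congr e
    have h1 := fun q : X ⟶ D.spec => Simplex.act_a (ap q.hom x) (Equiv.refl _) e
    refine (h1 f).trans (Eq.trans ?_ (h1 g).symm)
    exact congrArg (fun q : (ev m).obj X.seq ⟶ D.A => pact D.A e (pap (k := k) q x)) h'

/-- In degree n the projection is the base change of p along v, and right lifting properties are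
stable under base change. -/
lemma ev_proj_rlp (W : MorphismProperty (PermPSSet.{u} n)) (h : W.rlp D.p) :
    W.rlp ((ev n).map D.proj.hom) := fun K L i hi => by
  refine hasLiftingProperty_of_exists_lift fun a b sq => ?_
  obtain ⟨l, h1, h2⟩ := exists_lift_of_hasLiftingProperty (h i hi) (a ≫ D.toA) (b ≫ D.v)
    (by rw [Category.assoc, D.toA_p, ← Category.assoc, sq, Category.assoc])
  refine ⟨permHomMk (fun k x => (show D.Simplex n k from
      { y := pap b x
        a := fun e => pact D.A e (pap l x)
        p_a := fun e => ?_
        act_a := fun e τ => (pact_pact _ _ _).symm })) (fun k => ?_) (fun φ x => ?_)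
        (fun τ x => ?_), ?_, ?_⟩
  · rw [pap_pact, ← pap_comp, h2]
    exact (pap_pact D.v e (pap b x)).symm
  · exact Simplex.ext (pap_ppt b) (funext fun e =>
      (congrArg (pact D.A e) (pap_ppt l)).trans (pact_ppt e))
  · exact Simplex.ext (pap_psim b φ x) (funext fun e => by
      change pact D.A e (pap l (psim L φ x)) = psim D.A φ (pact D.A e (pap l x))
      rw [psim_pact, pap_psim])
  · exact Simplex.ext (pap_pact b τ x) (funext fun e =>
      (congrArg (pact D.A e) (pap_pact l τ x)).trans (pact_pact τ e (pap l x)))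
  · refine permHom_ext fun k x => Simplex.ext ?_ (funext fun e => ?_)
    · exact congrArg (fun q : K ⟶ (ev n).obj Y.seq => pap (k := k) q x) sq.symm
    · refine Eq.trans ?_ (Simplex.act_a (pap a x) (Equiv.refl _) e).symm
      exact congrArg (fun q : K ⟶ D.A => pact D.A e (pap (k := k) q x)) h1
  · exact permHom_ext fun k x => rfl

lemma ev_proj_isIso {m : ℕ} (hm : m ≠ n) : IsIso ((ev m).map D.proj.hom) := by
  have hE (e : Fin m ≃ Fin n) : False := hm (by simpa using Fintype.card_congr e)
  refine ⟨permHomMk (fun k x => (show D.Simplex m k from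
    ⟨x, fun e => (hE e).elim, fun e => (hE e).elim, fun e => (hE e).elim⟩)) (fun k => ?_)
      (fun φ x => ?_) (fun τ x => ?_), ?_, ?_⟩
  · exact Simplex.ext rfl (funext fun e => (hE e).elim)
  · exact Simplex.ext rfl (funext fun e => (hE e).elim)
  · exact Simplex.ext rfl (funext fun e => (hE e).elim)
  · exact permHom_ext fun k x => Simplex.ext rfl (funext fun e => (hE e).elim)
  · exact permHom_ext fun k x => rfl

/-- Only degree n differs from Y. If n lies below `m₀`, that degree is not tested, so p may be
arbitrary. -/
lemma proj_rlp (m₀ : ℕ) (h : m₀ ≤ n → (cellular (mixedGenerators n)).rlp D.p) :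
    (specCofibrations m₀).rlp D.proj := by
  rw [specCofibrations_rlp_iff]
  intro m hm
  by_cases hmn : m = n
  · subst hmn
    exact D.ev_proj_rlp _ (h hm)
  · have := D.ev_proj_isIso hmn
    exact MorphismProperty.rlp_of_isIso _ _

end LatchData

end FlatStable

-- Latching functors and the relative latching lifting problem for diagrams

universe w w'

namespace FlatStable

/-- The functor `X ↦ X_n`. -/
abbrev termFunctor (n : ℕ) : SymSpec.{u} ⥤ PermPSSet.{u} n := SymSpec.forget ⋙ ev n

/-- The functor `X ↦ (S̄ ∧ X)_n`. -/
abbrev latchFunctor (n : ℕ) : SymSpec.{u} ⥤ PermPSSet.{u} n := smashFunctor sphereBar ⋙ ev n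

/-- The natural map `(S̄ ∧ X)_n ⟶ X_n`. -/
abbrev latchTerm (n : ℕ) : latchFunctor.{u} n ⟶ termFunctor.{u} n := Functor.whiskerRight latch (ev n)

/-- Maps out of `(S̄ ∧ Y)_n` are determined by their values on the simplices `t 0 ∧ ⋯ ∧ t p ∧ y`. -/
lemma latchFunctor_hom_ext {Y : SymSpec.{u}} {n : ℕ} {A : PermPSSet.{u} n}
    {f g : (latchFunctor n).obj Y ⟶ A}
    (h : ∀ {p m k} (e : Fin (p + 1) ⊕ Fin m ≃ Fin n) (t : Fin (p + 1) → Circ.{u} k)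
      (y : El Y.seq m k), m < n →
      pap f (k := k) (barMk e t y) = pap g (k := k) (barMk e t y)) : f = g :=
  permHom_ext fun k x => by
    induction x using bar_ind with
    | h0 => exact (pap_ppt f).trans (pap_ppt g).symm
    | h e t y hn => exact h e t y hn

section actOn

variable {a b n : ℕ} {k l : SimplexCategoryᵒᵖ}

/-- The value of `t 0 ∧ ⋯ ∧ t (a-1) ∧ y` under the action of the sphere spectrum, reindexed
by `e`. -/
def actOn (Z : SymSpec.{u}) (e : Fin a ⊕ Fin b ≃ Fin n) (t : Fin a → Circ.{u} k)
    (y : El Z.seq b k) : El Z.seq n k :=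
  perm Z.seq ((block a b).symm.trans e) (Z.it a t y)

lemma ap_actOn {Y Z : SymSpec.{u}} (f : Y ⟶ Z) (e : Fin a ⊕ Fin b ≃ Fin n)
    (t : Fin a → Circ.{u} k) (y : El Y.seq b k) :
    ap f.hom (actOn Y e t y) = actOn Z e t (ap f.hom y) := by
  rw [actOn, ap_perm, SymSpec.ap_it]; rfl

lemma simpl_actOn (Z : SymSpec.{u}) (φ : k ⟶ l) (e : Fin a ⊕ Fin b ≃ Fin n)
    (t : Fin a → Circ.{u} k) (y : El Z.seq b k) :
    simpl Z.seq φ (actOn Z e t y) =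
      actOn Z e (fun i => (circle.map φ).toFun (t i)) (simpl Z.seq φ y) := by
  rw [actOn, simpl_perm, SymSpec.it_simpl]; rfl

lemma perm_actOn (Z : SymSpec.{u}) {n' : ℕ} (τ : Fin n ≃ Fin n') (e : Fin a ⊕ Fin b ≃ Fin n)
    (t : Fin a → Circ.{u} k) (y : El Z.seq b k) :
    perm Z.seq τ (actOn Z e t y) = actOn Z (e.trans τ) t y := by
  rw [actOn, perm_perm]; rfl

lemma actOn_block (Z : SymSpec.{u}) (t : Fin a → Circ.{u} k) (y : El Z.seq b k) :
    actOn Z (block a b) t y = Z.it a t y := by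
  rw [actOn, Equiv.symm_trans_self, perm_refl]

end actOn

variable {J : Type w} [Category.{w'} J]

/-- The lifting property of the induced map `(S̄ ∧ Y)_n ⨿_{(S̄ ∧ X)_n} X_n ⟶ Y_n` with respect
to `p`. -/
def LatchLift {X Y : J ⥤ SymSpec.{u}} (f : X ⟶ Y) {n : ℕ} {A B : J ⥤ PermPSSet.{u} n}
    (p : A ⟶ B) : Prop :=
  ∀ (a : X ⋙ termFunctor n ⟶ A) (v : Y ⋙ termFunctor n ⟶ B) (w : Y ⋙ latchFunctor n ⟶ A),
    a ≫ p = Functor.whiskerRight f (termFunctor n) ≫ v →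
    w ≫ p = Functor.whiskerLeft Y (latchTerm n) ≫ v →
    Functor.whiskerRight f (latchFunctor n) ≫ w = Functor.whiskerLeft X (latchTerm n) ≫ a →
    ∃ h : Y ⋙ termFunctor n ⟶ A, Functor.whiskerRight f (termFunctor n) ≫ h = a ∧
      Functor.whiskerLeft Y (latchTerm n) ≫ h = w ∧ h ≫ p = v

lemma diagram_naturality {n : ℕ} {A B : J ⥤ PermPSSet.{u} n} (p : A ⟶ B) {i j : J} (g : i ⟶ j)
    {k} (x : PEl (A.obj i) k) :
    pap (p.app j) (pap (A.map g) x) = pap (B.map g) (pap (p.app i) x) :=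
  congrArg (fun q => pap (k := k) q x) (p.naturality g)

/-! ### The relative latching maps of a projective cofibration -/

section diagram

variable {n : ℕ} {Y : J ⥤ SymSpec.{u}} {A B : J ⥤ PermPSSet.{u} n} (p : A ⟶ B)
  (v : Y ⋙ termFunctor n ⟶ B) (w : Y ⋙ latchFunctor n ⟶ A)
  (hw : w ≫ p = Functor.whiskerLeft Y (latchTerm n) ≫ v)

/-- The values of compatible maps of diagrams. -/
abbrev latchData (j : J) : LatchData n (Y.obj j) where
  A := A.obj j
  B := B.obj j
  p := p.app j
  v := v.app j
  w := w.app j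
  comp := congrArg (fun q => NatTrans.app q j) hw

/-- The functoriality of the spectra that agree with the values of `Y` outside degree `n`, and are
given by `Y_n ×_B A` in degree `n`. -/
def replaceTermMap {i j : J} (g : i ⟶ j) :
    (latchData p v w hw i).spec ⟶ (latchData p v w hw j).spec :=
  (latchData p v w hw j).lift ((latchData p v w hw i).proj ≫ Y.map g)
    ((latchData p v w hw i).toA ≫ A.map g)
    (permHom_ext fun k x => by
      have h1 := congrArg (fun q => pap (k := k) q x) (latchData p v w hw i).toA_p
      refine (diagram_naturality p g _).trans ((congrArg (pap (B.map g)) h1).trans ?_)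
      exact (diagram_naturality v g _).symm)
    (latchFunctor_hom_ext fun {q m k} e t y hm => by
      have h1 := congrArg (fun r => pap (k := k) r (barMk e t y)) (latchData p v w hw i).latch_toA
      refine Eq.trans ?_ (congrArg (pap (A.map g)) h1.symm)
      exact diagram_naturality w g
        (barMk e t (ap (latchData p v w hw i).proj.hom y)))

lemma replaceTermMap_toA {i j : J} (g : i ⟶ j) {k}
    (x : El (latchData p v w hw i).spec.seq n k) :
    pap (latchData p v w hw j).toA (k := k) (ap (replaceTermMap p v w hw g).hom x) =
      pap (A.map g) (pap (latchData p v w hw i).toA (k := k) x) :=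
  (latchData p v w hw j).lift_toA_apply _ _ _ _ x

/-- The diagram of symmetric spectra that agrees with `Y` outside degree `n`, and is `Y_n ×_B A`
in degree `n`. -/
def replaceTerm : J ⥤ SymSpec.{u} where
  obj j := (latchData p v w hw j).spec
  map g := replaceTermMap p v w hw g
  map_id j := (latchData p v w hw j).hom_ext
    ((congrArg _ (Y.map_id j)).trans ((Category.comp_id _).trans (Category.id_comp _).symm))
    (permHom_ext fun k x => (replaceTermMap_toA p v w hw _ x).trans
      (congrArg (fun q => pap (k := k) q _) (A.map_id j)))
  map_comp {i _ k} g g' := (latchData p v w hw k).hom_ext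
    (congrArg ((latchData p v w hw i).proj ≫ ·) (Y.map_comp g g'))
    (permHom_ext fun l x => (replaceTermMap_toA p v w hw _ x).trans
      ((congrArg (fun q => pap (k := l) q _) (A.map_comp g g')).trans
        ((replaceTermMap_toA p v w hw g' _).trans
          (congrArg (pap (A.map g')) (replaceTermMap_toA p v w hw g x))).symm))

/-- The map to `Y`. -/
def replaceTermProj : replaceTerm p v w hw ⟶ Y where
  app j := (latchData p v w hw j).proj
  naturality _ _ _ := rfl

/-- The projection of the `n`-th term to `A`. -/
def replaceTermToA : replaceTerm p v w hw ⋙ termFunctor n ⟶ A where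
  app j := (latchData p v w hw j).toA
  naturality _ _ g := permHom_ext fun _ x => replaceTermMap_toA p v w hw g x

end diagram

/-- The data a, v, w of the problem define a replacement of Y in degree n and a map from X to it.
Lifting the identity of Y along the projection gives a section, and its A-component is the desired
map. -/
lemma latchLift_of_llp {X Y : J ⥤ SymSpec.{u}} (f : X ⟶ Y) {m₀ : ℕ}
    (hf : ((specCofibrations m₀).rlp.functorCategory J).llp f) {n : ℕ}
    {A B : J ⥤ PermPSSet.{u} n} (p : A ⟶ B)
    (hp : m₀ ≤ n → ((cellular (mixedGenerators n)).rlp.functorCategory J) p) : LatchLift f p := by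
  intro a v w h1 hw h2
  let D := latchData p v w hw
  have hq (j k) (x : El (X.obj j).seq n k) : pap (D j).toA (k := k)
      (ap ((D j).lift (f.app j) (a.app j) (congrArg (fun q => NatTrans.app q j) h1)
        (congrArg (fun q => NatTrans.app q j) h2)).hom x) = pap (a.app j) (k := k) x :=
    (D j).lift_toA_apply _ _ _ _ x
  let q : X ⟶ replaceTerm p v w hw :=
    { app := fun j => (D j).lift (f.app j) (a.app j)
        (congrArg (fun q => NatTrans.app q j) h1) (congrArg (fun q => NatTrans.app q j) h2)
      naturality := fun i j g => by
        refine (D j).hom_ext (f.naturality g) (permHom_ext fun k x => ?_)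
        exact (hq j k _).trans ((diagram_naturality a g x).trans
          ((replaceTermMap_toA p v w hw g _).trans (congrArg _ (hq i k x))).symm) }
  -- The top edge q encodes a; the bottom edge is the identity of Y.
  obtain ⟨l, hl1, hl2⟩ := exists_lift_of_hasLiftingProperty
    (hf (replaceTermProj p v w hw) fun j => (D j).proj_rlp m₀ fun hm => hp hm j) q (𝟙 Y) rfl
  have hl (j) {m k} (y : El (Y.obj j).seq m k) : ap (D j).proj.hom (ap (l.app j).hom y) = y :=
    congrArg (fun r : Y ⟶ Y => ap (r.app j).hom y) hl2
  refine ⟨Functor.whiskerRight l (termFunctor n) ≫ replaceTermToA p v w hw, ?_, ?_, ?_⟩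
  · refine NatTrans.ext (funext fun j => permHom_ext fun k x => Eq.trans ?_ (hq j k x))
    exact congrArg (fun r : X ⟶ replaceTerm p v w hw => pap (D j).toA (k := k)
      (ap (r.app j).hom x)) hl1
  · refine NatTrans.ext (funext fun j => latchFunctor_hom_ext fun {q m k} e t y hm => ?_)
    have h3 := congrArg (fun r => pap (k := k) r (barMk e t (ap (l.app j).hom y))) (D j).latch_toA
    refine Eq.trans ?_ (h3.trans ?_)
    · exact congrArg (fun z : El (D j).spec.seq n k => pap (D j).toA (k := k) z)
        (ap_actOn (l.app j) e t y)
    · exact congrArg (fun y => pap (w.app j) (k := k) (barMk e t y)) (hl j y)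
  · refine NatTrans.ext (funext fun j => permHom_ext fun k x => ?_)
    refine (congrArg (fun r => pap (k := k) r (ap (l.app j).hom x)) (D j).toA_p).trans ?_
    exact congrArg (pap (v.app j)) (hl j x)

/-! ### Lifting degree by degree -/

section partialLatch

variable {Y Z : SymSpec.{u}}

/-- A map of symmetric sequences is compatible with the structure maps below degree `n`. -/
def CommutesBelow (n : ℕ) (g : Y.seq ⟶ Z.seq) : Prop :=
  ∀ m, m + 1 < n → ∀ (k) (t : Circ.{u} k) (y : El Y.seq m k),
    ap g (Y.σ m k t y) = Z.σ m k t (ap g y)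

variable {g : Y.seq ⟶ Z.seq} {n : ℕ} (hg : CommutesBelow n g)

lemma CommutesBelow.ap_it (hg : CommutesBelow n g) {c b : ℕ} (h : b + c < n) {k} (s : Fin c → Circ.{u} k) (y : El Y.seq b k) :
    ap g (Y.it c s y) = Z.it c s (ap g y) := by
  induction c with
  | zero => rfl
  | succ c ih =>
    rw [SymSpec.it_succ, SymSpec.it_succ, ← ih (by omega)]
    exact hg (b + c) h k _ _

/-- If the `S̄`-component of a balancing relation is not the base point, it has positive degree a.
The sphere action on the Y-side then ends in degree `b + c < n`, where g is already compatible with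
it. -/
lemma CommutesBelow.unitGen_map (hg : CommutesBelow n g) {k} (z w : TGen sphereBar.{u}.seq Y.seq n k)
    (h : SRel sphereBar Y n k z w) :
    unitGen Z (z.map sphereBarι.hom g) = unitGen Z (w.map sphereBarι.hom g) := by
  cases h with
  | tens _ _ h => exact unitGen_rel Z _ _ (.tens _ _ (h.map sphereBarι.hom g))
  | bal e s x y =>
    rename_i a b c
    by_cases hx : ap sphereBarι.hom x = pt sphere.seq a k
    · refine (unitGen_base Z _ (Or.inl ?_)).trans (unitGen_base Z _ (Or.inl hx)).symm
      refine (SymSpec.ap_it sphereBarι s x).trans ?_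
      rw [hx]
      exact sphere.it_pt_right s
    · have ha : a ≠ 0 := fun ha => hx (sphereBarVal_zero x ha)
      have hn : b + c < n := by
        have := Fintype.card_congr e
        simp only [Fintype.card_sum, Fintype.card_fin] at this
        omega
      have h := unitGen_rel Z _ _ (SRel.bal e s (ap sphereBarι.hom x) (ap g y))
      rw [← SymSpec.ap_it, ← hg.ap_it hn] at h
      exact h

/-- The map `(S̄ ∧ Y)_n ⟶ Z_n` induced by a map `Y ⟶ Z` of symmetric sequences that is compatible
with the structure maps below degree `n`, on simplices. -/
def partialLatchFun {k} (x : El (smash sphereBar Y) n k) : El Z.seq n k :=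
  (PQuot.desc (fun z => unitGen Z (z.map sphereBarι.hom g)) hg.unitGen_map
    (fun _ h => unitGen_base Z _ (h.map _ _)) :
      PQuot (SRel sphereBar Y n k) TGen.IsBase ⟶ (Z.seq.obj ⟨n⟩).obj k).toFun x

/-- The map `(S̄ ∧ Y)_n ⟶ Z_n` induced by a map `Y ⟶ Z` of symmetric sequences that is compatible
with the structure maps below degree `n`. -/
def partialLatch : (latchFunctor n).obj Y ⟶ (termFunctor n).obj Z :=
  permHomMk (fun _ => partialLatchFun hg) (fun _ => rfl)
    (fun {k l} φ x => by
      induction x using bar_ind with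
      | h0 => exact (simpl_pt (A := Z.seq) (m := n) φ).symm
      | @h q m e t y _ =>
        exact (congrArg (fun y => actOn Z e (fun i => (circle.map φ).toFun (t i)) y)
          (ap_simpl g φ y)).trans (simpl_actOn Z φ e t (ap g y)).symm)
    (fun {k} τ x => by
      induction x using bar_ind with
      | h0 => exact (perm_pt (A := Z.seq) (m := n) (n := n) τ).symm
      | @h q m e t y _ => exact (perm_actOn Z τ e t (ap g y)).symm)

end partialLatch

/-! ### Extending lifts of diagrams of spectra by one degree -/

section reedy

variable {X Y Z T : J ⥤ SymSpec.{u}} (f : X ⟶ Y) (q : Z ⟶ T) (a : X ⟶ Z) (b : Y ⟶ T)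

/-- A map of diagrams of symmetric sequences on simplices. -/
def diagramAp (g : Y ⋙ SymSpec.forget ⟶ Z ⋙ SymSpec.forget) (j : J) {n : ℕ} {k}
    (y : El (Y.obj j).seq n k) : El (Z.obj j).seq n k :=
  ap (A := (Y.obj j).seq) (B := (Z.obj j).seq) (g.app j) y

lemma diagramAp_naturality (g : Y ⋙ SymSpec.forget ⟶ Z ⋙ SymSpec.forget) {i j : J} (γ : i ⟶ j)
    {n : ℕ} {k} (y : El (Y.obj i).seq n k) :
    diagramAp g j (ap (Y.map γ).hom y) = ap (Z.map γ).hom (diagramAp g i y) :=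
  congrArg (fun q : (Y.obj i).seq ⟶ (Z.obj j).seq => ap q y) (g.naturality γ)

/-- A map of diagrams of symmetric sequences is a lift of the square below degree `n`. -/
structure IsPartialLift (n : ℕ) (g : Y ⋙ SymSpec.forget ⟶ Z ⋙ SymSpec.forget) : Prop where
  left : ∀ m, m < n → ∀ (j k) (x : El (X.obj j).seq m k),
    diagramAp g j (ap (f.app j).hom x) = ap (a.app j).hom x
  right : ∀ m, m < n → ∀ (j k) (y : El (Y.obj j).seq m k),
    ap (q.app j).hom (diagramAp g j y) = ap (b.app j).hom y
  comm : ∀ j, CommutesBelow (Y := Y.obj j) (Z := Z.obj j) n (g.app j)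

variable {f q a b}

/-- Replacing one term of a map of diagrams of symmetric sequences. -/
def updateTerm (n : ℕ) (g : Y ⋙ SymSpec.forget ⟶ Z ⋙ SymSpec.forget)
    (h : Y ⋙ termFunctor n ⟶ Z ⋙ termFunctor n) : Y ⋙ SymSpec.forget ⟶ Z ⋙ SymSpec.forget where
  app j := seqHomOfTerms (Function.update (fun m => (ev m).map (g.app j)) n (h.app j))
  naturality i j γ := seqHom_ext_terms fun m => by
    rw [Functor.map_comp, Functor.map_comp, ev_map_seqHomOfTerms, ev_map_seqHomOfTerms]
    by_cases hm : m = n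
    · subst hm
      rw [Function.update_self, Function.update_self]
      exact h.naturality γ
    · rw [Function.update_of_ne hm, Function.update_of_ne hm, ← Functor.map_comp,
        ← Functor.map_comp, g.naturality]

lemma updateTerm_self (n : ℕ) (g : Y ⋙ SymSpec.forget ⟶ Z ⋙ SymSpec.forget)
    (h : Y ⋙ termFunctor n ⟶ Z ⋙ termFunctor n) (j : J) {k} (y : El (Y.obj j).seq n k) :
    diagramAp (updateTerm n g h) j y =
      pap (h.app j) (k := k) y := by
  refine (ap_seqHomOfTerms _ y).trans ?_
  rw [Function.update_self]; rfl

lemma updateTerm_of_ne {n m : ℕ} (hm : m ≠ n) (g : Y ⋙ SymSpec.forget ⟶ Z ⋙ SymSpec.forget)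
    (h : Y ⋙ termFunctor n ⟶ Z ⋙ termFunctor n) (j : J) {k} (y : El (Y.obj j).seq m k) :
    diagramAp (updateTerm n g h) j y =
      diagramAp g j y := by
  refine (ap_seqHomOfTerms _ y).trans ?_
  rw [Function.update_of_ne hm]; rfl

/-- The terms of g below n determine a map from `(S̄ ∧ Y)_n` to `Z_n`. Compatibility with it is
exactly what the n-th term needs in order to commute with the structure maps into degree n. -/
lemma IsPartialLift.extend (sq : a ≫ q = f ≫ b) {n : ℕ}
    {g : Y ⋙ SymSpec.forget ⟶ Z ⋙ SymSpec.forget} (hg : IsPartialLift f q a b n g)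
    (hf : LatchLift f (Functor.whiskerRight q (termFunctor n))) :
    ∃ g', IsPartialLift f q a b (n + 1) g' ∧ ∀ m, m < n → ∀ (j k) (y : El (Y.obj j).seq m k),
      diagramAp g' j y =
        diagramAp g j y := by
  let w : Y ⋙ latchFunctor n ⟶ Z ⋙ termFunctor n :=
    { app := fun j => partialLatch (hg.comm j)
      naturality := fun i j γ => latchFunctor_hom_ext fun {p m k} e t y _ => by
        have h1 := diagramAp_naturality g γ y
        exact (congrArg (fun y => actOn (Z.obj j) e t y) h1).trans
          (ap_actOn (Z.map γ) e t _).symm }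
  obtain ⟨h, h1, h2, h3⟩ := hf (Functor.whiskerRight a (termFunctor n))
    (Functor.whiskerRight b (termFunctor n)) w
    (by rw [← Functor.whiskerRight_comp, ← Functor.whiskerRight_comp, sq])
    (NatTrans.ext (funext fun j => latchFunctor_hom_ext fun {p m k} e t y hm => by
      refine (ap_actOn (q.app j) e t _).trans ?_
      exact (congrArg (fun y => actOn (T.obj j) e t y) (hg.right m hm j k y)).trans
        (ap_actOn (b.app j) e t y).symm))
    (NatTrans.ext (funext fun j => latchFunctor_hom_ext fun {p m k} e t y hm => by
      exact (congrArg (fun y => actOn (Z.obj j) e t y) (hg.left m hm j k y)).trans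
        (ap_actOn (a.app j) e t y).symm))
  refine ⟨updateTerm n g h, ⟨fun m hm j k x => ?_, fun m hm j k y => ?_,
    fun j m hm k t y => ?_⟩, fun m hm j k y => updateTerm_of_ne hm.ne g h j y⟩
  · by_cases hmn : m = n
    · subst hmn
      rw [updateTerm_self]
      exact congrArg (fun r => pap (k := k) (NatTrans.app r j) x) h1
    · rw [updateTerm_of_ne hmn]
      exact hg.left m (by omega) j k x
  · by_cases hmn : m = n
    · subst hmn
      rw [updateTerm_self]
      exact congrArg (fun r => pap (k := k) (NatTrans.app r j) y) h3
    · rw [updateTerm_of_ne hmn]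
      exact hg.right m (by omega) j k y
  · by_cases hmn : m + 1 = n
    · subst hmn
      change diagramAp (updateTerm (m + 1) g h) j ((Y.obj j).σ m k t y) =
        (Z.obj j).σ m k t (diagramAp (updateTerm (m + 1) g h) j y)
      rw [updateTerm_self, updateTerm_of_ne (by omega)]
      -- Compatibility with the last structure map is the latching condition on simplices with a
      -- single sphere coordinate.
      have h4 := congrArg (fun r => pap (k := k) (NatTrans.app r j)
        (barMk (block 1 m) (fun _ => t) y)) h2
      refine Eq.trans ?_ (h4.trans (actOn_block (Z.obj j) (fun _ : Fin 1 => t) _))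
      exact congrArg (fun y : El (Y.obj j).seq (m + 1) k => pap (h.app j) (k := k) y)
        (actOn_block (Y.obj j) (fun _ : Fin 1 => t) y).symm
    · change diagramAp (updateTerm n g h) j ((Y.obj j).σ m k t y) =
        (Z.obj j).σ m k t (diagramAp (updateTerm n g h) j y)
      rw [updateTerm_of_ne hmn, updateTerm_of_ne (by omega)]
      exact hg.comm j m (by omega) k t y

/-- Stage n changes only the n-th term, so the stages stabilise in each degree and their stable
terms assemble to a lift. -/
lemma exists_lift_of_latchLift (sq : a ≫ q = f ≫ b)
    (hf : ∀ n, LatchLift f (Functor.whiskerRight q (termFunctor n))) :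
    ∃ l : Y ⟶ Z, f ≫ l = a ∧ l ≫ q = b := by
  choose! ext hext using fun (n : ℕ) (g : Y ⋙ SymSpec.forget ⟶ Z ⋙ SymSpec.forget)
    (hg : IsPartialLift f q a b n g) => hg.extend sq (hf n)
  -- The starting map is irrelevant, since being a partial lift below degree 0 is no condition.
  let g₀ : Y ⋙ SymSpec.forget ⟶ Z ⋙ SymSpec.forget :=
    { app := fun j => seqHomOfTerms fun m => permZero _ _
      naturality := fun i j γ => seqHom_ext fun n k x => (ap_pt (Z.map γ).hom).symm }
  let G : ℕ → (Y ⋙ SymSpec.forget ⟶ Z ⋙ SymSpec.forget) := fun n => Nat.rec g₀ ext n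
  have hG : ∀ n, IsPartialLift f q a b n (G n) := fun n => by
    induction n with
    | zero =>
      exact ⟨fun m hm => absurd hm (Nat.not_lt_zero m), fun m hm => absurd hm (Nat.not_lt_zero m),
        fun j m hm => absurd hm (Nat.not_lt_zero _)⟩
    | succ n ih => exact (hext n _ ih).1
  have hG' := fun n => (hext n _ (hG n)).2
  refine ⟨{ app := fun j =>
              { hom := seqHomOfTerms fun m => (ev m).map ((G (m + 1)).app j)
                comm := fun {m k} t y => ?_ }
            naturality := fun i j γ => SymSpec.hom_ext (seqHom_ext fun m k x => ?_) }, ?_, ?_⟩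
  -- Stage `m + 2` is the first known to commute with the structure map from degree m to `m + 1`; in
  -- degree m it still equals stage `m + 1`.
  · refine ((hG (m + 2)).comm j m (by omega) k t y).trans ?_
    exact congrArg _ (hG' (m + 1) m (by omega) j k y)
  · exact diagramAp_naturality (G (m + 1)) γ x
  · refine NatTrans.ext (funext fun j => SymSpec.hom_ext (seqHom_ext fun m k x => ?_))
    exact (hG (m + 1)).left m (by omega) j k x
  · refine NatTrans.ext (funext fun j => SymSpec.hom_ext (seqHom_ext fun m k x => ?_))
    exact (hG (m + 1)).right m (by omega) j k x

end reedy

/-- Projective cofibrations of diagrams of symmetric spectra are detected by the relative latching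
maps. -/
theorem llp_iff_latchLift (m₀ : ℕ) {X Y : J ⥤ SymSpec.{u}} (f : X ⟶ Y) :
    ((specCofibrations m₀).rlp.functorCategory J).llp f ↔
      ∀ (n : ℕ) (A B : J ⥤ PermPSSet.{u} n) (p : A ⟶ B),
        (m₀ ≤ n → ((cellular (mixedGenerators n)).rlp.functorCategory J) p) → LatchLift f p := by
  refine ⟨fun h n A B p hp => latchLift_of_llp f h p hp, fun h Z T q hq => ?_⟩
  exact hasLiftingProperty_of_exists_lift fun a b sq => exists_lift_of_latchLift sq fun n =>
    h n _ _ _ fun hn j => (specCofibrations_rlp_iff m₀ _).1 (hq j) n hn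

/-! ### Reduction from symmetric sequences with G-action to their values -/

section gluing

variable {G : Type v} [Group G]

/-- The action of a bijection on the values of a symmetric sequence with `G`-action. -/
lemma evalAt_map (X : SymSeqG.{u} G) (r : ℕ) (τ : Equiv.Perm (Fin r)) {g g' : SingleObj G}
    (γ : g ⟶ g') :
    ((evalAt G r).obj X).map (X := (op (SingleObj.star _), g)) (Y := (op (SingleObj.star _), g'))
      (Quiver.Hom.op (show SingleObj.star _ ⟶ SingleObj.star _ from τ), γ) =
      (X.obj g).map (Quiver.Hom.op (show (⟨r⟩ : Sig) ⟶ ⟨r⟩ from τ)) ≫ (X.map γ).app (op ⟨r⟩) :=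
  rfl

/-- A map of symmetric sequences with `G`-action, from its values. -/
def glue {X Y : SymSeqG.{u} G} (φ : ∀ r, (evalAt G r).obj X ⟶ (evalAt G r).obj Y) : X ⟶ Y where
  app g :=
    { app := fun s => (φ s.unop.n).app (op (SingleObj.star _), g)
      naturality := fun s s' e => by
        obtain ⟨⟨r⟩⟩ := s
        obtain ⟨⟨r'⟩⟩ := s'
        obtain rfl : r' = r := Sig.eq_of_hom e.unop
        have h := (φ r').naturality (X := (op (SingleObj.star _), g))
          (Y := (op (SingleObj.star _), g))
          (Quiver.Hom.op (show SingleObj.star _ ⟶ SingleObj.star _ from Sig.eqv e.unop), 𝟙 g)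
        rw [evalAt_map, evalAt_map, X.map_id, Y.map_id, NatTrans.id_app, NatTrans.id_app,
          Category.comp_id, Category.comp_id] at h
        exact h }
  naturality g g' γ := by
    refine NatTrans.ext (funext fun s => ?_)
    obtain ⟨⟨r⟩⟩ := s
    have h := (φ r).naturality (X := (op (SingleObj.star _), g))
      (Y := (op (SingleObj.star _), g')) (𝟙 _, γ)
    have h1 := fun X : SymSeqG.{u} G => evalAt_map X r (Equiv.refl _) γ
    have h2 := fun (X : SymSeqG.{u} G) (g : SingleObj G) => (X.obj g).map_id (op ⟨r⟩)
    refine Eq.trans ?_ (h.trans ?_)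
    · refine congrArg (· ≫ (φ r).app _) ((h1 X).trans ?_).symm
      exact (congrArg (· ≫ (X.map γ).app (op ⟨r⟩)) (h2 X g)).trans (Category.id_comp _)
    · refine congrArg ((φ r).app _ ≫ ·) ((h1 Y).trans ?_)
      exact (congrArg (· ≫ (Y.map γ).app (op ⟨r⟩)) (h2 Y g)).trans (Category.id_comp _)

lemma evalAt_map_glue {X Y : SymSeqG.{u} G} (φ : ∀ r, (evalAt G r).obj X ⟶ (evalAt G r).obj Y)
    (r : ℕ) : (evalAt G r).map (glue φ) = φ r := rfl

lemma symSeqG_hom_ext {X Y : SymSeqG.{u} G} {f g : X ⟶ Y}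
    (h : ∀ r, (evalAt G r).map f = (evalAt G r).map g) : f = g :=
  NatTrans.ext (funext fun γ => NatTrans.ext (funext fun s =>
    congrArg (fun q => NatTrans.app q (op (SingleObj.star _), γ)) (h s.unop.n)))

variable (F : ∀ r, Shape r G ⥤ SymSpec.{u})

/-- The action of bijections on a family of diagrams. -/
def assembleMap (g : SingleObj G) {n n' : ℕ} (e : Fin n' ≃ Fin n) :
    (F n).obj (op (SingleObj.star _), g) ⟶ (F n').obj (op (SingleObj.star _), g) :=
  have h : n = n' := by simpa using (Fintype.card_congr e).symm
  -- Source and target are values of different members of the family, equal only after identifying n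
  -- with n'; the cast is trivial once n = n', as in `assembleMap_perm`.
  eqToHom (by rw [h]) ≫ (F n').map
    (Quiver.Hom.op (show SingleObj.star _ ⟶ SingleObj.star _ from e.trans (finCongr h)), 𝟙 g)

lemma assembleMap_perm (g : SingleObj G) {n : ℕ} (τ : Equiv.Perm (Fin n)) :
    assembleMap F g τ = (F n).map
      (Quiver.Hom.op (show SingleObj.star _ ⟶ SingleObj.star _ from τ), 𝟙 g) := by
  rw [assembleMap, eqToHom_refl, Category.id_comp]
  rfl

/-- The symmetric sequence with prescribed values. -/
def assemble : SymSeqG.{u} G where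
  obj g :=
    { obj := fun s => (F s.unop.n).obj (op (SingleObj.star _), g)
      map := fun e => assembleMap F g (Sig.eqv e.unop)
      map_id := fun s => (assembleMap_perm F g _).trans ((F s.unop.n).map_id _)
      map_comp := fun {s s' s''} e e' => by
        obtain ⟨⟨r⟩⟩ := s
        obtain ⟨⟨r'⟩⟩ := s'
        obtain ⟨⟨r''⟩⟩ := s''
        obtain rfl : r' = r := Sig.eq_of_hom e.unop
        obtain rfl : r'' = r' := Sig.eq_of_hom e'.unop
        refine (assembleMap_perm F g _).trans (Eq.trans ?_ (congrArg₂ (· ≫ ·)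
          (assembleMap_perm F g _) (assembleMap_perm F g _)).symm)
        rw [← Functor.map_comp]
        exact congrArg (F r'').map (Prod.ext rfl (Category.id_comp _).symm) }
  map γ :=
    { app := fun s => (F s.unop.n).map (𝟙 _, γ)
      naturality := fun s s' e => by
        obtain ⟨⟨r⟩⟩ := s
        obtain ⟨⟨r'⟩⟩ := s'
        obtain rfl : r' = r := Sig.eq_of_hom e.unop
        refine (congrArg (· ≫ (F r').map (𝟙 _, γ)) (assembleMap_perm F _ _)).trans
          (Eq.trans ?_ (congrArg ((F r').map (𝟙 _, γ) ≫ ·) (assembleMap_perm F _ _)).symm)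
        rw [← Functor.map_comp, ← Functor.map_comp]
        exact congrArg (F r').map (Prod.ext ((Category.comp_id _).trans (Category.id_comp _).symm)
          ((Category.id_comp _).trans (Category.comp_id _).symm)) }
  map_id g := NatTrans.ext (funext fun s => (F s.unop.n).map_id _)
  map_comp γ γ' := NatTrans.ext (funext fun s => by
    refine Eq.trans ?_ ((F s.unop.n).map_comp _ _)
    rfl)

/-- The values of the symmetric sequence with prescribed values. -/
def evalAssemble (r : ℕ) : (evalAt G r).obj (assemble F) ≅ F r :=
  NatIso.ofComponents (fun _ => Iso.refl _) fun {d d'} g => by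
    refine (Category.comp_id _).trans (Eq.trans ?_ (Category.id_comp _).symm)
    refine Eq.trans (b := assembleMap F d.2 (show Equiv.Perm (Fin r) from g.1.unop) ≫ (F r).map
      ((𝟙 _, g.2) : (op (SingleObj.star _), d.2) ⟶ (op (SingleObj.star _), d'.2))) rfl ?_
    rw [assembleMap_perm]
    refine ((F r).map_comp _ _).symm.trans ?_
    exact congrArg (F r).map (Prod.ext (Category.comp_id g.1) (Category.id_comp g.2))

/-- A commutative square of diagrams with a given left edge. -/
structure SquareUnder {J : Type w} [Category.{w'} J] {X Y : J ⥤ SymSpec.{u}} (f : X ⟶ Y) where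
  A : J ⥤ SymSpec.{u}
  B : J ⥤ SymSpec.{u}
  a : X ⟶ A
  b : Y ⟶ B
  p : A ⟶ B
  sq : a ≫ p = f ≫ b

/-- Maps of symmetric sequences with G-action are families of equivariant maps between their values,
without conditions relating different r. A problem at one r becomes a global one by inserting
trivially solvable problems elsewhere. -/
lemma llp_iff_evalAt (W : MorphismProperty SymSpec.{u}) [W.ContainsIdentities]
    {X Y : SymSeqG.{u} G} (f : X ⟶ Y) :
    ((W.functorCategory Sigᵒᵖ).functorCategory (SingleObj G)).llp f ↔
      ∀ r, (W.functorCategory (Shape r G)).llp ((evalAt G r).map f) := by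
  constructor
  · intro h r A B p hp
    refine hasLiftingProperty_of_exists_lift fun a b sq => ?_
    -- The filler square has right edge the identity of `Y[i]`, which lies in W because W contains
    -- identities.
    let S₀ : ∀ i, SquareUnder ((evalAt G i).map f) := fun i =>
      ⟨_, _, (evalAt G i).map f, 𝟙 _, 𝟙 _, rfl⟩
    let S := Function.update S₀ r ⟨A, B, a, b, p, sq⟩
    have hS : S r = ⟨A, B, a, b, p, sq⟩ := Function.update_self _ _ _
    have hW : ∀ i, W.functorCategory _ (S i).p := fun i => by
      by_cases hi : i = r
      · subst hi; rw [hS]; exact hp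
      · rw [show S i = S₀ i from Function.update_of_ne hi _ _]
        exact fun d => W.id_mem _
    let FA := fun i => (S i).A
    let FB := fun i => (S i).B
    let q : assemble FA ⟶ assemble FB :=
      glue fun i => (evalAssemble FA i).hom ≫ (S i).p ≫ (evalAssemble FB i).inv
    let a' : X ⟶ assemble FA := glue fun i => (S i).a ≫ (evalAssemble FA i).inv
    let b' : Y ⟶ assemble FB := glue fun i => (S i).b ≫ (evalAssemble FB i).inv
    have hq : ((W.functorCategory Sigᵒᵖ).functorCategory (SingleObj G)) q := fun g s => by
      have : (q.app g).app s = (S s.unop.n).p.app (op (SingleObj.star _), g) :=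
        (Category.id_comp _).trans (Category.comp_id _)
      rw [this]
      exact hW _ _
    have sq' : a' ≫ q = f ≫ b' := symSeqG_hom_ext fun i => by
      rw [Functor.map_comp, Functor.map_comp, evalAt_map_glue, evalAt_map_glue, evalAt_map_glue]
      simpa using congrArg (· ≫ (evalAssemble FB i).inv) (S i).sq
    obtain ⟨l, h1, h2⟩ := exists_lift_of_hasLiftingProperty (h q hq) a' b' sq'
    -- Stated for `S r`, so that the equality `hS` of whole squares is rewritten in one go and no
    -- casts arise.
    have key : ∃ l : (evalAt G r).obj Y ⟶ (S r).A, (evalAt G r).map f ≫ l = (S r).a ∧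
        l ≫ (S r).p = (S r).b := by
      refine ⟨(evalAt G r).map l ≫ (evalAssemble FA r).hom, ?_, ?_⟩
      · rw [← Category.assoc, ← Functor.map_comp, h1, evalAt_map_glue]
        simp
      · have h3 := congrArg (fun t => (evalAt G r).map t ≫ (evalAssemble FB r).hom) h2
        simp only [Functor.map_comp] at h3
        rw [evalAt_map_glue, evalAt_map_glue] at h3
        simpa using h3
    rw [hS] at key
    exact key
  · intro h A B p hp
    refine hasLiftingProperty_of_exists_lift fun a b sq => ?_
    have key := fun r => exists_lift_of_hasLiftingProperty
      (h r ((evalAt G r).map p) fun d => hp d.2 (op ⟨r⟩)) ((evalAt G r).map a) ((evalAt G r).map b)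
      (by rw [← Functor.map_comp, ← Functor.map_comp, sq])
    choose l h1 h2 using key
    refine ⟨glue l, symSeqG_hom_ext fun r => ?_, symSeqG_hom_ext fun r => ?_⟩
    · rw [Functor.map_comp, evalAt_map_glue, h1]
    · rw [Functor.map_comp, evalAt_map_glue, h2]

/-! ### Parts (a) and (b) -/

lemma flatCofibrations_iff (m₀ : ℕ) {X Y : SymSeqG.{u} G} (f : X ⟶ Y) :
    flatCofibrations m₀ G f ↔ ∀ (r n : ℕ) (A B : MixedDiag.{u} G r n) (p : A ⟶ B),
      (m₀ ≤ n → ((cellular (mixedGenerators n)).rlp.functorCategory (Shape r G)) p) →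
        LatchLift ((evalAt G r).map f) p := by
  rw [flatCofibrations, llp_iff_evalAt]
  exact forall_congr' fun r => llp_iff_latchLift m₀ _

/-- Maps out of the pushout are compatible pairs, so a square from the latching map to p is
precisely a triple a, v, w as in `LatchLift`. -/
lemma latchingMap_hasLiftingProperty_iff {X Y : SymSeqG.{u} G} (f : X ⟶ Y) {r n : ℕ}
    {A B : MixedDiag.{u} G r n} (p : A ⟶ B) :
    HasLiftingProperty (latchingMap f r n) p ↔ LatchLift ((evalAt G r).map f) p := by
  have hl : pushout.inl _ _ ≫ latchingMap f r n = (latchingToLevel G r n).app Y :=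
    pushout.inl_desc _ _ _
  have hr : pushout.inr _ _ ≫ latchingMap f r n = (level G r n).map f := pushout.inr_desc _ _ _
  constructor
  · intro h a v w h1 h2 h3
    obtain ⟨l, h4, h5⟩ := exists_lift_of_hasLiftingProperty h (pushout.desc w a h3) v
      (pushout.hom_ext
        (by
          rw [← Category.assoc, ← Category.assoc, hl, pushout.inl_desc]
          exact h2)
        (by
          rw [← Category.assoc, ← Category.assoc, hr, pushout.inr_desc]
          exact h1))
    refine ⟨l, ?_, ?_, h5⟩
    · refine (congrArg (· ≫ l) hr.symm).trans ?_
      rw [Category.assoc, h4, pushout.inr_desc]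
    · refine (congrArg (· ≫ l) hl.symm).trans ?_
      rw [Category.assoc, h4, pushout.inl_desc]
  · intro h
    refine hasLiftingProperty_of_exists_lift fun a v sq => ?_
    obtain ⟨l, h4, h5, h6⟩ := h (pushout.inr _ _ ≫ a) v (pushout.inl _ _ ≫ a)
      (by
        rw [Category.assoc, sq, ← Category.assoc]
        exact congrArg (· ≫ v) hr)
      (by
        rw [Category.assoc, sq, ← Category.assoc]
        exact congrArg (· ≫ v) hl)
      (by
        rw [← Category.assoc, ← Category.assoc]
        exact congrArg (· ≫ a) pushout.condition)
    refine ⟨l, pushout.hom_ext ?_ ?_, h6⟩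
    · rw [← Category.assoc, hl]
      exact h5
    · rw [← Category.assoc, hr]
      exact h4

/-- By the strict bound in `bar_ind`, `(S̄ ∧ Y)_0` is trivial, so w and the conditions on it carry
no information. -/
lemma level_zero_hasLiftingProperty_iff {X Y : SymSeqG.{u} G} (f : X ⟶ Y) {r : ℕ}
    {A B : MixedDiag.{u} G r 0} (p : A ⟶ B) :
    HasLiftingProperty ((level G r 0).map f) p ↔ LatchLift ((evalAt G r).map f) p := by
  have ext {Y : Shape r G ⥤ SymSpec.{u}} {A : MixedDiag.{u} G r 0}
      (w w' : Y ⋙ latchFunctor 0 ⟶ A) : w = w' :=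
    NatTrans.ext (funext fun j => latchFunctor_hom_ext fun _ _ _ hm => absurd hm (Nat.not_lt_zero _))
  constructor
  · intro h a v w h1 _ _
    obtain ⟨l, h4, h5⟩ := exists_lift_of_hasLiftingProperty h a v h1
    exact ⟨l, h4, ext _ _, h5⟩
  · intro h
    refine hasLiftingProperty_of_exists_lift fun a v sq => ?_
    obtain ⟨l, h4, -, h6⟩ := h a v
      { app := fun j => permZero _ _
        naturality := fun i j g => latchFunctor_hom_ext fun _ _ _ hm =>
          absurd hm (Nat.not_lt_zero _) } sq (ext _ _) (ext _ _)
    exact ⟨l, h4, h6⟩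

theorem flatStableCofibrations_iff {X Y : SymSeqG.{u} G} (f : X ⟶ Y) :
    flatStableCofibrations G f ↔
      (∀ r : ℕ, mixedCofibrations G r 0 ((level G r 0).map f)) ∧
        ∀ r n : ℕ, 1 ≤ n → mixedCofibrations G r n (latchingMap f r n) := by
  rw [flatStableCofibrations, flatCofibrations_iff]
  constructor
  · refine fun h => ⟨fun r A B p hp => ?_, fun r n _ A B p hp => ?_⟩
    · exact (level_zero_hasLiftingProperty_iff f p).2 (h r 0 A B p fun _ => hp)
    · exact (latchingMap_hasLiftingProperty_iff f p).2 (h r n A B p fun _ => hp)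
  · rintro ⟨h0, h1⟩ r n A B p hp
    obtain _ | n := n
    · exact (level_zero_hasLiftingProperty_iff f p).1 (h0 r p (hp le_rfl))
    · exact (latchingMap_hasLiftingProperty_iff f p).1 (h1 r _ (Nat.le_add_left 1 n) p
        (hp (Nat.zero_le _)))

theorem positiveFlatStableCofibrations_iff {X Y : SymSeqG.{u} G} (f : X ⟶ Y) :
    positiveFlatStableCofibrations G f ↔
      (∀ r : ℕ, IsIso ((level G r 0).map f)) ∧
        ∀ r n : ℕ, 1 ≤ n → mixedCofibrations G r n (latchingMap f r n) := by
  rw [positiveFlatStableCofibrations, flatCofibrations_iff]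
  constructor
  · refine fun h => ⟨fun r => ?_, fun r n _ A B p hp => ?_⟩
    -- With `m₀ = 1` every p is allowed in degree 0, in particular the level map itself; lifting the
    -- identities against it gives an inverse.
    · obtain ⟨l, h1, h2⟩ := exists_lift_of_hasLiftingProperty
        ((level_zero_hasLiftingProperty_iff f ((level G r 0).map f)).2
          (h r 0 _ _ _ fun h => absurd h (by decide))) (𝟙 _) (𝟙 _)
        ((Category.id_comp _).trans (Category.comp_id _).symm)
      exact ⟨l, h1, h2⟩
    · exact (latchingMap_hasLiftingProperty_iff f p).2 (h r n A B p fun _ => hp)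
  · rintro ⟨h0, h1⟩ r n A B p hp
    obtain _ | n := n
    · have := h0 r
      exact (level_zero_hasLiftingProperty_iff f p).1 inferInstance
    · exact (latchingMap_hasLiftingProperty_iff f p).1 (h1 r _ (Nat.le_add_left 1 n) p
        (hp (Nat.le_add_left 1 n)))

end gluing

/-! ### The generating cofibrations are injective -/

lemma orbitSeq_map_injective {n : ℕ} (H : Subgroup (Equiv.Perm (Fin n))) {K L : PSSet.{u}}
    (g : K ⟶ L) (hg : ∀ k, Function.Injective (g.app k).toFun) (k : SimplexCategoryᵒᵖ) :
    Function.Injective (pap (k := k) ((ev n).map ((orbitSeq n H).map g))) := by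
  have : Nonempty (K.obj k : Pointed) := ⟨(K.obj k).point⟩
  -- A retraction in one fixed simplicial degree; it need not be simplicial, since injectivity is
  -- checked degreewise.
  let r : (L.obj k).X → (K.obj k).X := Function.invFun (g.app k).toFun
  have hr : ∀ x, r ((g.app k).toFun x) = x := Function.leftInverse_invFun (hg k)
  have hr₀ : r (L.obj k).point = (K.obj k).point := by
    rw [← (g.app k).map_point, hr]
  let R : PQuot (Z := (Fin n ≃ Fin n) × (L.obj k : Pointed)) (orbitRel H)
      (fun z => z.2 = (L.obj k).point) ⟶
      PQuot (Z := (Fin n ≃ Fin n) × (K.obj k : Pointed)) (orbitRel H)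
        (fun z => z.2 = (K.obj k).point) :=
    PQuot.map (fun z => (z.1, r z.2))
      (fun _ _ ⟨h, hH, h1, h2⟩ => ⟨h, hH, h1, congrArg r h2⟩)
      (fun _ h => (congrArg r h).trans hr₀)
  refine Function.LeftInverse.injective (g := R.toFun) fun x => ?_
  refine PQuot.ind (p := fun x => R.toFun (pap (k := k) ((ev n).map ((orbitSeq n H).map g)) x) = x)
    rfl (fun z => ?_) x
  exact congrArg (fun y => PQuot.mk (orbitRel H) (fun z => z.2 = (K.obj k).point) (z.1, y))
    (hr z.2)

lemma mixedGenerators_injective {n : ℕ} {K L : PermPSSet.{u} n} {i : K ⟶ L}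
    (hi : mixedGenerators n i) (k : SimplexCategoryᵒᵖ) : Function.Injective (pap (k := k) i) := by
  obtain ⟨m, H⟩ := hi
  refine orbitSeq_map_injective H (boundaryIncl m) (fun k => ?_) k
  exact Option.map_injective fun x y h => Subtype.ext h

/-! ### A factorization into an injection with free complement and an acyclic fibration -/

section partialLift

variable {n : ℕ} {A B : PermPSSet.{u} n} (φ : A ⟶ B) (Ω : Type u)

/-- A simplex of `B`, with a lift to `A` of its restriction to a subcomplex of the standard simplex,
and a function to `Ω` on the simplices of the complement. -/
@[ext]
structure PartialLift (k : SimplexCategoryᵒᵖ) : Type u where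
  b : PEl B k
  -- A morphism `k ⟶ l` in the opposite category is a simplex of the standard simplex. Where z takes
  -- values in A it is a lift of b; by `face_z` this happens on a subcomplex.
  z : ∀ l, (k ⟶ l) → PEl A l ⊕ Ω
  map_z : ∀ l θ a, z l θ = Sum.inl a → pap φ a = psim B θ b
  face_z : ∀ l θ a, z l θ = Sum.inl a → ∀ l' (θ' : l ⟶ l'), z l' (θ ≫ θ') = Sum.inl (psim A θ' a)

variable {φ Ω}

/-- The simplicial operators on partial lifts. -/
def PartialLift.sim {k k' : SimplexCategoryᵒᵖ} (ψ : k ⟶ k') (x : PartialLift φ Ω k) :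
    PartialLift φ Ω k' where
  b := psim B ψ x.b
  z l θ := x.z l (ψ ≫ θ)
  map_z l θ a h := by rw [psim_psim]; exact x.map_z l _ a h
  face_z l θ a h l' θ' := by rw [← Category.assoc]; exact x.face_z l _ a h l' θ'

/-- The functoriality of partial lifts. -/
def PartialLift.map {A' B' : PermPSSet.{u} n} {φ' : A' ⟶ B'} {Ω' : Type u} {k}
    (f : ∀ {l}, PEl A l → PEl A' l) (g : ∀ {l}, PEl B l → PEl B' l) (o : Ω → Ω')
    (hφ : ∀ {l} (a : PEl A l), pap φ' (f a) = g (pap φ a))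
    (hf : ∀ {l l'} (θ : l ⟶ l') (a : PEl A l), f (psim A θ a) = psim A' θ (f a))
    (hg : ∀ {l l'} (θ : l ⟶ l') (b : PEl B l), g (psim B θ b) = psim B' θ (g b))
    (x : PartialLift φ Ω k) : PartialLift φ' Ω' k where
  b := g x.b
  z l θ := Sum.map f o (x.z l θ)
  map_z l θ a h := by
    cases hz : x.z l θ with
    | inl a' =>
      rw [hz] at h
      obtain rfl := Sum.inl.inj h
      rw [hφ, x.map_z l θ a' hz, hg]
    | inr _ => rw [hz] at h; cases h
  face_z l θ a h l' θ' := by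
    cases hz : x.z l θ with
    | inl a' =>
      rw [hz] at h
      obtain rfl := Sum.inl.inj h
      rw [x.face_z l θ a' hz l' θ', Sum.map_inl, hf]
    | inr _ => rw [hz] at h; cases h

/-- The partial lift given by a simplex of `A`. -/
def PartialLift.incl (φ : A ⟶ B) (Ω : Type u) {k} (a : PEl A k) : PartialLift φ Ω k where
  b := pap φ a
  z l θ := Sum.inl (psim A θ a)
  map_z l θ a' h := by
    obtain rfl := Sum.inl.inj h
    exact pap_psim φ θ a
  face_z l θ a' h l' θ' := by
    obtain rfl := Sum.inl.inj h
    rw [psim_psim]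

/-- A subcomplex containing the identity simplex is the whole standard simplex, and the lift on it
is determined by its value there. -/
lemma PartialLift.eq_incl {k} (x : PartialLift φ Ω k) (a : PEl A k) (h : x.z k (𝟙 k) = Sum.inl a) :
    x = PartialLift.incl φ Ω a := by
  refine PartialLift.ext ?_ (funext fun l => funext fun θ => ?_)
  · exact ((x.map_z k _ a h).trans (psim_id _)).symm
  · have := x.face_z k _ a h l θ
    rwa [Category.id_comp] at this

lemma PartialLift.incl_injective {k} :
    Function.Injective (PartialLift.incl φ Ω : PEl A k → PartialLift φ Ω k) := fun a a' h => by
  have h1 := congrArg (fun x => x.z k (𝟙 k)) h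
  have h2 := Sum.inl.inj h1
  rwa [psim_id, psim_id] at h2

variable (φ Ω) in
/-- The pointed simplicial set with `Σ_n`-action of partial lifts. -/
def partialLifts : PermPSSet.{u} n where
  obj _ :=
    { obj := fun k => ⟨PartialLift φ Ω k, PartialLift.incl φ Ω (ppt A k)⟩
      map := fun ψ => ⟨PartialLift.sim ψ, PartialLift.ext
        ((pap_psim φ ψ _).symm.trans (congrArg (pap φ) (psim_ppt ψ)))
        (funext fun l => funext fun θ => congrArg Sum.inl
          ((psim_ppt _).trans (psim_ppt _).symm))⟩
      map_id := fun k => Pointed.Hom.ext (funext fun x => PartialLift.ext (psim_id _)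
        (funext fun l => funext fun θ => congrArg (x.z l) (Category.id_comp θ)))
      map_comp := fun ψ ψ' => Pointed.Hom.ext (funext fun x => PartialLift.ext
        (psim_psim ψ ψ' _).symm
        (funext fun l => funext fun θ => congrArg (x.z l) (Category.assoc ψ ψ' θ))) }
  map τ :=
    { app := fun k => ⟨PartialLift.map (pact A τ) (pact B τ) id (fun a => pap_pact φ τ a)
          (fun θ a => (psim_pact τ θ a).symm) (fun θ b => (psim_pact τ θ b).symm),
        PartialLift.ext ((pap_pact φ τ _).symm.trans (congrArg (pap φ) (pact_ppt τ)))
          (funext fun l => funext fun θ => congrArg Sum.inl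
            ((psim_pact τ θ _).symm.trans (congrArg (psim A θ) (pact_ppt τ))))⟩
      naturality := fun k l ψ => Pointed.Hom.ext (funext fun x =>
        PartialLift.ext (psim_pact τ ψ _).symm rfl) }
  map_id _ := NatTrans.ext (funext fun k => Pointed.Hom.ext (funext fun x =>
    PartialLift.ext (pact_refl _) (funext fun l => funext fun θ => by
      change Sum.map (pact A (Equiv.refl _)) id (x.z l θ) = x.z l θ
      rw [show (pact A (Equiv.refl _) : PEl A l → PEl A l) = id from funext pact_refl,
        Sum.map_id_id, id])))
  map_comp τ τ' := NatTrans.ext (funext fun k => Pointed.Hom.ext (funext fun x =>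
    PartialLift.ext (pact_pact τ τ' _).symm (funext fun l => funext fun θ => by
      change Sum.map (pact A (Equiv.trans τ τ')) id (x.z l θ) =
        Sum.map (pact A τ') id (Sum.map (pact A τ) id (x.z l θ))
      rw [Sum.map_map]
      exact congrArg (fun f => Sum.map f id (x.z l θ))
        (funext fun a => (pact_pact τ τ' a).symm))))

variable (φ Ω) in
/-- The projection from the partial lifts. -/
def partialLiftsProj : partialLifts φ Ω ⟶ B :=
  permHomMk (fun _ x => PartialLift.b x) (fun _ => pap_ppt φ) (fun _ _ => rfl) (fun _ _ => rfl)

variable (φ Ω) in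
/-- The inclusion into the partial lifts. -/
def partialLiftsIncl : A ⟶ partialLifts φ Ω :=
  permHomMk (fun _ a => PartialLift.incl φ Ω a) (fun _ => rfl)
    (fun ψ a => PartialLift.ext (pap_psim φ ψ a) (funext fun _ => funext fun θ =>
      congrArg Sum.inl (psim_psim ψ θ a)))
    (fun τ a => PartialLift.ext (pap_pact φ τ a) (funext fun _ => funext fun θ =>
      congrArg Sum.inl (psim_pact τ θ a)))

/-- A simplex of L is mapped to its image in B, with the part of it lying in K lifted or labelled as
s prescribes and the rest labelled by a constant. Consistency holds because the image of i is a
subcomplex stable under the permutations. -/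
lemma partialLiftsProj_hasLiftingProperty [Nonempty Ω] {K L : PermPSSet.{u} n} (i : K ⟶ L)
    (hi : ∀ k, Function.Injective (pap (k := k) i)) :
    HasLiftingProperty i (partialLiftsProj φ Ω) := by
  classical
  refine hasLiftingProperty_of_exists_lift fun s t sq => ?_
  let S (k) (κ : PEl K k) : PartialLift φ Ω k := pap s κ
  have hS (k) (κ : PEl K k) : (S k κ).b = pap t (pap i κ) :=
    congrArg (fun q => pap (k := k) q κ) sq
  have S_sim {k l} (θ : k ⟶ l) (κ : PEl K k) : S l (psim K θ κ) = (S k κ).sim θ := pap_psim s θ κ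
  have S_act {k} (τ : Equiv.Perm (Fin n)) (κ : PEl K k) (l) (θ : k ⟶ l) :
      (S k (pact K τ κ)).z l θ = Sum.map (pact A τ) id ((S k κ).z l θ) :=
    congrArg (fun x : PartialLift φ Ω k => x.z l θ) (pap_pact s τ κ)
  -- Any constant is equivariant, because permutations act trivially on labels; the action of J
  -- plays no role in an objectwise lift.
  let ω : Ω := Classical.arbitrary Ω
  let val (l) (x : PEl L l) : PEl A l ⊕ Ω :=
    if h : ∃ κ, pap i κ = x then (S l h.choose).z l (𝟙 l) else Sum.inr ω
  have val_i {l} (κ : PEl K l) : val l (pap i κ) = (S l κ).z l (𝟙 l) := by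
    have h : ∃ κ', pap i κ' = pap i κ := ⟨κ, rfl⟩
    simp only [val, dif_pos h, hi l h.choose_spec]
  have val_not {l} (x : PEl L l) (h : ¬ ∃ κ, pap i κ = x) : val l x = Sum.inr ω := dif_neg h
  have z_id {k l} (κ : PEl K k) (θ : k ⟶ l) :
      (S l (psim K θ κ)).z l (𝟙 l) = (S k κ).z l θ := by
    rw [S_sim]
    exact congrArg _ (Category.comp_id θ)
  refine ⟨permHomMk (fun k x => (show PartialLift φ Ω k from
    { b := pap t x
      z := fun l θ => val l (psim L θ x)
      map_z := fun l θ a h => ?_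
      face_z := fun l θ a h l' θ' => ?_ })) (fun k => ?_) (fun {k l} ψ x => ?_)
      (fun {k} τ x => ?_), ?_, ?_⟩
  · by_cases hx : ∃ κ, pap i κ = psim L θ x
    · obtain ⟨κ, hκ⟩ := hx
      rw [← hκ, val_i] at h
      rw [(S l κ).map_z l _ a h, psim_id, hS, hκ, pap_psim]
    · rw [val_not _ hx] at h
      cases h
  · by_cases hx : ∃ κ, pap i κ = psim L θ x
    · obtain ⟨κ, hκ⟩ := hx
      rw [← hκ, val_i] at h
      rw [← psim_psim, ← hκ, ← pap_psim, val_i, z_id]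
      have := (S l κ).face_z l _ a h l' θ'
      rwa [Category.id_comp] at this
    · rw [val_not _ hx] at h
      cases h
  · refine PartialLift.ext ((pap_ppt t).trans (pap_ppt φ).symm)
      (funext fun l => funext fun θ => ?_)
    change val l (psim L θ (ppt L k)) = Sum.inl (psim A θ (ppt A k))
    rw [psim_ppt, ← pap_ppt i, val_i, psim_ppt]
    refine (congrArg (fun x : PartialLift φ Ω l => x.z l (𝟙 l)) (pap_ppt s)).trans ?_
    exact congrArg Sum.inl (psim_ppt _)
  · refine PartialLift.ext (pap_psim t ψ x) (funext fun l' => funext fun θ => ?_)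
    exact congrArg (val l') (psim_psim ψ θ x)
  · refine PartialLift.ext (pap_pact t τ x) (funext fun l => funext fun θ => ?_)
    change val l (psim L θ (pact L τ x)) = Sum.map (pact A τ) id (val l (psim L θ x))
    rw [psim_pact]
    by_cases hx : ∃ κ, pap i κ = psim L θ x
    · obtain ⟨κ, hκ⟩ := hx
      rw [← hκ, ← pap_pact, val_i, val_i, S_act]
    · rw [val_not _ hx, val_not]
      · rfl
      · rintro ⟨κ, hκ⟩
        refine hx ⟨pact K τ.symm κ, ?_⟩
        rw [pap_pact, hκ, pact_pact, Equiv.self_trans_symm, pact_refl]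
  · refine permHom_ext fun k κ => PartialLift.ext (hS k κ).symm
      (funext fun l => funext fun θ => ?_)
    change val l (psim L θ (pap i κ)) = (S k κ).z l θ
    rw [← pap_psim, val_i, z_id]
  · exact permHom_ext fun k x => rfl

lemma partialLiftsProj_rlp [Nonempty Ω] :
    (cellular (mixedGenerators n)).rlp (partialLiftsProj φ Ω) := by
  rw [cellular_rlp]
  exact fun _ _ i hi => partialLiftsProj_hasLiftingProperty i (mixedGenerators_injective hi)

end partialLift

/-! ### Projective cofibrations are free injections -/

/-- A family of nonempty sets on which the endomorphisms in `J` act freely. -/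
structure FreeFamily (J : Type w) [Category.{w'} J] where
  obj : J → Type u
  map : ∀ {d d' : J}, (d ⟶ d') → obj d → obj d'
  map_id : ∀ (d : J) (x : obj d), map (𝟙 d) x = x
  map_comp : ∀ {d d' d'' : J} (g : d ⟶ d') (g' : d' ⟶ d'') (x : obj d),
    map (g ≫ g') x = map g' (map g x)
  nonempty : ∀ d, Nonempty (obj d)
  free : ∀ {d : J} (g : d ⟶ d) (x : obj d), map g x = x → g = 𝟙 d

section free

variable {J : Type w} [Category.{w'} J] {n : ℕ} {A B : J ⥤ PermPSSet.{u} n}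

/-- The diagram of partial lifts. -/
def partialLiftsDiagram (φ : A ⟶ B) (Ω : FreeFamily.{u} J) : J ⥤ PermPSSet.{u} n where
  obj d := partialLifts (φ.app d) (Ω.obj d)
  map g := permHomMk
    (fun k => PartialLift.map (pap (A.map g)) (pap (B.map g)) (Ω.map g)
      (fun a => diagram_naturality φ g a) (fun θ a => pap_psim _ θ a) (fun θ b => pap_psim _ θ b))
    (fun k => PartialLift.ext ((diagram_naturality φ g _).symm.trans
        (congrArg (pap (φ.app _)) (pap_ppt (A.map g))))
      (funext fun l => funext fun θ => congrArg Sum.inl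
        ((pap_psim _ θ _).trans (congrArg (psim _ θ) (pap_ppt (A.map g))))))
    (fun ψ x => PartialLift.ext (pap_psim _ ψ _) rfl)
    (fun τ x => PartialLift.ext (pap_pact _ τ _) (funext fun l => funext fun θ => by
      change Sum.map _ _ (Sum.map _ _ (PartialLift.z x l θ)) =
        Sum.map _ _ (Sum.map _ _ (PartialLift.z x l θ))
      rw [Sum.map_map, Sum.map_map]
      exact congrArg (fun f => Sum.map f _ (PartialLift.z x l θ))
        (funext fun a => pap_pact _ τ a)))
  map_id d := permHom_ext fun k x => PartialLift.ext
    (congrArg (fun q => pap (k := k) q (PartialLift.b x)) (B.map_id d))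
    (funext fun l => funext fun θ => by
      change Sum.map (pap (A.map (𝟙 d))) (Ω.map (𝟙 d)) (PartialLift.z x l θ) = PartialLift.z x l θ
      rw [A.map_id, show Ω.map (𝟙 d) = id from funext (Ω.map_id d)]
      exact congrFun Sum.map_id_id _)
  map_comp g g' := permHom_ext fun k x => PartialLift.ext
    (congrArg (fun q => pap (k := k) q (PartialLift.b x)) (B.map_comp g g'))
    (funext fun l => funext fun θ => by
      change Sum.map (pap (A.map (g ≫ g'))) (Ω.map (g ≫ g')) (PartialLift.z x l θ) =
        Sum.map (pap (A.map g')) (Ω.map g') (Sum.map (pap (A.map g)) (Ω.map g)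
          (PartialLift.z x l θ))
      rw [A.map_comp, show Ω.map (g ≫ g') = Ω.map g' ∘ Ω.map g from funext (Ω.map_comp g g'),
        Sum.map_map]
      rfl)

/-- Projective cofibrations are injective, with free complement. -/
theorem injective_and_free_of_projectiveCofibrations (Ω : FreeFamily.{u} J) (φ : A ⟶ B)
    (hφ : projectiveCofibrations (cellular (mixedGenerators n)) J φ) :
    (∀ d k, Function.Injective (pap (k := k) (φ.app d))) ∧
      ∀ (d : J) (g : d ⟶ d), g ≠ 𝟙 d → ∀ k (y : PEl (B.obj d) k),
        y ∉ Set.range (pap (k := k) (φ.app d)) → pap (B.map g) y ≠ y := by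
  let π : partialLiftsDiagram φ Ω ⟶ B :=
    { app := fun d => partialLiftsProj (φ.app d) (Ω.obj d)
      naturality := fun _ _ _ => rfl }
  let ι : A ⟶ partialLiftsDiagram φ Ω :=
    { app := fun d => partialLiftsIncl (φ.app d) (Ω.obj d)
      naturality := fun d d' g => permHom_ext fun k a => PartialLift.ext
        (diagram_naturality φ g a) (funext fun l => funext fun θ =>
          congrArg Sum.inl (pap_psim (A.map g) θ a).symm) }
  -- Lifting the identity of B gives a section h of π under A, and this h respects the action of J
  -- on labels.
  obtain ⟨h, h1, h2⟩ := exists_lift_of_hasLiftingProperty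
    (hφ π fun d => by
      have := Ω.nonempty d
      exact partialLiftsProj_rlp) ι (𝟙 B) (by
        rw [Category.comp_id]
        exact NatTrans.ext (funext fun d => permHom_ext fun k a => rfl))
  have h1' (d k) (a : PEl (A.obj d) k) : pap (h.app d) (pap (φ.app d) a) =
      PartialLift.incl (φ.app d) (Ω.obj d) a :=
    congrArg (fun q => pap (k := k) (NatTrans.app q d) a) h1
  have h2' (d k) (y : PEl (B.obj d) k) :
      PartialLift.b (φ := φ.app d) (Ω := Ω.obj d) (pap (h.app d) y) = y :=
    congrArg (fun q => pap (k := k) (NatTrans.app q d) y) h2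
  refine ⟨fun d k a a' haa => ?_, fun d g hg k y hy hgy => ?_⟩
  · refine PartialLift.incl_injective (φ := φ.app d) (Ω := Ω.obj d) ?_
    rw [← h1', ← h1', haa]
  · let x : PartialLift (φ.app d) (Ω.obj d) k := pap (h.app d) y
    have hx : Sum.map (pap (A.map g)) (Ω.map g) (x.z k (𝟙 k)) = x.z k (𝟙 k) := by
      have h3 := diagram_naturality h g y
      rw [hgy] at h3
      exact (congrArg (fun x : PartialLift (φ.app d) (Ω.obj d) k => x.z k (𝟙 k)) h3).symm
    cases hz : x.z k (𝟙 k) with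
    -- If the whole simplex is lifted, then `h y` comes from a, and projecting to B puts y in the
    -- image of φ.
    | inl a =>
      refine hy ⟨a, ?_⟩
      exact (congrArg PartialLift.b (x.eq_incl a hz)).symm.trans (h2' d k y)
    -- Otherwise the top simplex carries a label, which g would have to fix.
    | inr ω =>
      rw [hz] at hx
      exact hg (Ω.free g ω (Sum.inr.inj hx))

end free

/-- The translation action of `Σ_r^op × G` on itself. -/
noncomputable def shapeFreeFamily (r : ℕ) (G : Type v) [Group G] [Finite G] :
    FreeFamily.{u} (Shape r G) :=
  have hfin : Finite ((Equiv.Perm (Fin r)) × G) := inferInstance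
  -- G may live in another universe than the simplicial sets; finiteness allows its translation
  -- action to be moved to theirs.
  have hsmall : Small.{u} ((Equiv.Perm (Fin r)) × G) := inferInstance
  let e (d : Shape r G) : (((op (SingleObj.star _), SingleObj.star G) : Shape r G) ⟶ d) ≃
      (Equiv.Perm (Fin r)) × G :=
    ⟨fun g => (g.1.unop, g.2), fun g => (Quiver.Hom.op g.1, g.2), fun _ => rfl, fun _ => rfl⟩
  have hs (d : Shape r G) : Small.{u} (((op (SingleObj.star _), SingleObj.star G) : Shape r G) ⟶ d) :=
    small_map (e d)
  { obj := fun d => Shrink.{u} (((op (SingleObj.star _), SingleObj.star G) : Shape r G) ⟶ d)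
    map := fun g x => equivShrink _ ((equivShrink _).symm x ≫ g)
    map_id := fun d x => by rw [Category.comp_id, Equiv.apply_symm_apply]
    map_comp := fun g g' x => by rw [Equiv.symm_apply_apply, Category.assoc]
    nonempty := fun d => ⟨equivShrink _ ((e d).symm 1)⟩
    free := fun {d} g x h => by
      have h1 := congrArg (e d) ((equivShrink _).injective
        (h.trans ((equivShrink _).apply_symm_apply x).symm))
      refine Prod.ext (Quiver.Hom.unop_inj ?_) ?_
      -- Composition in a one-object category reverses multiplication and the opposite reverses it
      -- back, so the two factors need cancellation on different sides.
      · exact (mul_eq_left (M := Equiv.Perm (Fin r))).1 (congrArg Prod.fst h1)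
      · exact (mul_eq_right (M := G)).1 (congrArg Prod.snd h1) }

theorem mono_and_free_of_mixedCofibrations (G : Type v) [Group G] [Finite G] (r n : ℕ)
    {A B : MixedDiag.{u} G r n} (φ : A ⟶ B) (hφ : mixedCofibrations G r n φ) :
    Mono φ ∧ (∀ d s k, Function.Injective (((φ.app d).app s).app k).toFun) ∧
      ∀ (d : Shape r G) (g : d ⟶ d), g ≠ 𝟙 d → ∀ s k (y : (((B.obj d).obj s).obj k : Pointed)),
        y ∉ Set.range (((φ.app d).app s).app k).toFun →
          (((B.map g).app s).app k).toFun y ≠ y := by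
  obtain ⟨h1, h2⟩ := injective_and_free_of_projectiveCofibrations (shapeFreeFamily r G) φ hφ
  refine ⟨⟨fun {C} a b hab => ?_⟩, fun d s k => h1 d k, fun d g hg s k => h2 d g hg k⟩
  refine NatTrans.ext (funext fun d => permHom_ext fun k x => h1 d k ?_)
  exact congrArg (fun q => pap (k := k) (NatTrans.app q d) x) hab

end FlatStable

theorem mainTheorem8 (G : Type v) [Group G] [Finite G] :
    (∀ {X Y : FlatStable.SymSeqG.{u} G} (f : X ⟶ Y),
      FlatStable.flatStableCofibrations G f ↔
        (∀ r : ℕ, FlatStable.mixedCofibrations G r 0 ((FlatStable.level G r 0).map f)) ∧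
        ∀ r n : ℕ, 1 ≤ n →
          FlatStable.mixedCofibrations G r n (FlatStable.latchingMap f r n)) ∧
    (∀ {X Y : FlatStable.SymSeqG.{u} G} (f : X ⟶ Y),
      FlatStable.positiveFlatStableCofibrations G f ↔
        (∀ r : ℕ, IsIso ((FlatStable.level G r 0).map f)) ∧
        ∀ r n : ℕ, 1 ≤ n →
          FlatStable.mixedCofibrations G r n (FlatStable.latchingMap f r n)) ∧
    (∀ (r n : ℕ) {A B : FlatStable.MixedDiag.{u} G r n} (φ : A ⟶ B),
      FlatStable.mixedCofibrations G r n φ →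
        Mono φ ∧
        (∀ d s k, Function.Injective (((φ.app d).app s).app k).toFun) ∧
        ∀ (d : FlatStable.Shape r G) (g : d ⟶ d), g ≠ 𝟙 d →
          ∀ s k (y : (((B.obj d).obj s).obj k : Pointed)),
            y ∉ Set.range (((φ.app d).app s).app k).toFun →
              (((B.map g).app s).app k).toFun y ≠ y) :=
  ⟨fun f => FlatStable.flatStableCofibrations_iff f,
    fun f => FlatStable.positiveFlatStableCofibrations_iff f,
    fun r n _ _ φ hφ => FlatStable.mono_and_free_of_mixedCofibrations G r n φ hφ⟩
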